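/- Let $n\ge 1$, $m\ge 0$. On $\mathbb C^{n+m}$ with coordinates $(z_1,\dots,z_n,w_1,\dots,w_m)$ let $s=\prod_{i=1}^n z_i$ and $f=\operatorname{Re}(s)$. For a smooth Hermitian metric $g$, let $V=\nabla f/|\nabla f|^2$ (gradient and norm with respect to $g$), defined where $df\neq 0$. A solution curve is a curve $\gamma$ on a nonempty open interval with values in $\{df\ne0\}$ and $\gamma'=V(\gamma)$. It comes out of a point $p$ in the unit direction $u$ if $\gamma(t)\to p$ and $(\gamma(t)-p)/|\gamma(t)-p|\to u$ as $t$ decreases to the left end of the interval. The unstable variety $S^+_p$ of $V$ at $p$ is the union of $\{p\}$ and of all solution curves coming out of $p$. (a) Let $g$ be a Kähler metric on $\mathbb C^{n+m}$ that is toroidal with respect to $X_0=\{s=0\}$: for all $i\ne j\le n$ the components $\{z_i=0\}$ and $\{z_j=0\}$ intersect orthogonally, i.e. their $g$-normal spaces are orthogonal at every point of $\{z_i=z_j=0\}$. Let $p$ be a point of $\{z_1=\dots=z_n=0\}$, let $L_i$ be the $g_p$-orthogonal complement of $\{v: v_i=0\}$ for $i\le n$, and let $C_p$ be the set of all sums $v=\sum_{i\le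 n}e_i$ with $e_i\in L_i$, all $|e_i|_{g_p}$ equal, and $\prod_{i\le n}v_i\in\mathbb R_{\ge0}$. Then: 1. $C_p$ is a cone with vertex $0$ over an $(n-1)$-torus $T^{n-1}=(S^1)^{n-1}$: there is a homeomorphism from $T^{n-1}\times[0,\infty)/(T^{n-1}\times\{0\})$ onto $C_p$ under which the parameter in $[0,\infty)$ acts as scaling of vectors. 2. $S^+_p$ is homeomorphic and tangent to $C_p$: there is a homeomorphism $\Phi:C_p\to S^+_p$ with $\Phi(0)=p$ and $\Phi(v)=p+v+o(|v|)$ as $v\to0$, which maps each open ray of $C_p$ onto a solution curve coming out of $p$ in the direction of that ray. In particular $S^+_p$ is topologically a cone over an $(n-1)$-torus. 3. Every solution curve of $V$ that has $p$ as a limit point as $t$ decreases to the left end of its interval is contained in $S^+_p$. (b) The same conclusions hold at $p=0$, with the cone $\{(z,0): \prod_{i\le n}z_i\in\mathbb R_{\ge0},\ |z_1|=\dots=|z_n|\}$ in place of $C_p$, for every smooth Hermitian metric on $\mathbb C^{n+m}$ with $g_{i\bar j}=\delta_{ij}+O(|(z,w)|)$ at the origin. -/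

import Mathlib

open Filter Topology
open scoped ContDiff

noncomputable section

/-- The space `ℂⁿ⁺ᵐ = ℂⁿ × ℂᵐ`; the coordinates `z₁, …, zₙ` are `z (Sum.inl i)`, the remaining
`m` coordinates are `z (Sum.inr k)`. -/
abbrev CSpace (n m : ℕ) : Type := EuclideanSpace ℂ (Fin n ⊕ Fin m)

/-- A smooth Hermitian metric on `ℂⁿ⁺ᵐ`, given by its underlying Riemannian metric: a smooth
family of positive definite symmetric real bilinear forms invariant under multiplication by `i`. -/
structure HermitianMetric (n m : ℕ) where
  /-- the inner product on the tangent space at a point -/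
  form : CSpace n m → CSpace n m →L[ℝ] CSpace n m →L[ℝ] ℝ
  smooth : ContDiff ℝ ∞ form
  symm : ∀ z u v, form z u v = form z v u
  pos : ∀ z v, v ≠ 0 → 0 < form z v v
  invariant : ∀ z u v, form z (Complex.I • u) (Complex.I • v) = form z u v

namespace HermitianMetric

variable {n m : ℕ} (g : HermitianMetric n m)

/-- The fundamental form `ω(u, v) = g(iu, v)`. -/
def omega (z u v : CSpace n m) : ℝ := g.form z (Complex.I • u) v

/-- The metric is Kähler: `dω = 0`, the exterior derivative being evaluated on constant vector
fields `u, v, w`. -/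
def IsKahler : Prop :=
  ∀ z u v w : CSpace n m,
    fderiv ℝ (fun x => g.omega x v w) z u + fderiv ℝ (fun x => g.omega x w u) z v
      + fderiv ℝ (fun x => g.omega x u v) z w = 0

/-- The normal space at `z` of the hypersurface `{zᵢ = const}`, `i ≤ n`: the vectors orthogonal
to its tangent space `{w | wᵢ = 0}`. -/
def normalLine (z : CSpace n m) (i : Fin n) : Set (CSpace n m) :=
  {u | ∀ w : CSpace n m, w (Sum.inl i) = 0 → g.form z u w = 0}

/-- The metric is toroidal with respect to the normal crossing divisor `∏_{i ≤ n} zᵢ = 0`: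
different components `{zᵢ = 0}` and `{zⱼ = 0}` meet orthogonally, that is, their normal spaces
are orthogonal at every point of the intersection. -/
def IsToroidal : Prop :=
  ∀ i j : Fin n, i ≠ j → ∀ z : CSpace n m, z (Sum.inl i) = 0 → z (Sum.inl j) = 0 →
    ∀ u ∈ g.normalLine z i, ∀ v ∈ g.normalLine z j, g.form z u v = 0

/-- The metric is the standard flat one at `z`; as the metric is smooth, this means that it is
the standard metric up to terms vanishing to first order at `z`. -/
def IsStandardAt (z : CSpace n m) : Prop :=
  ∀ u v : CSpace n m, g.form z u v = (∑ k, u k * (starRingEnd ℂ) (v k)).re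

/-- The linear isomorphism `v ↦ g_z(v, ·)` from tangent vectors to covectors. -/
def flat (z : CSpace n m) : CSpace n m ≃ₗ[ℝ] Module.Dual ℝ (CSpace n m) :=
  LinearMap.linearEquivOfInjective
    ((ContinuousLinearMap.coeLM ℝ).comp (g.form z).toLinearMap)
    (by
      rw [← LinearMap.ker_eq_bot, LinearMap.ker_eq_bot']
      intro v hv
      by_contra hne
      have h1 : g.form z v v = 0 := by simpa using LinearMap.congr_fun hv v
      exact absurd h1 (g.pos z v hne).ne')
    Subspace.dual_finrank_eq.symm

/-- The gradient of `F` with respect to the metric. -/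
def grad (F : CSpace n m → ℝ) (z : CSpace n m) : CSpace n m :=
  (g.flat z).symm (fderiv ℝ F z).toLinearMap

theorem form_grad (F : CSpace n m → ℝ) (z u : CSpace n m) :
    g.form z (g.grad F z) u = fderiv ℝ F z u :=
  LinearMap.congr_fun ((g.flat z).apply_symm_apply (fderiv ℝ F z).toLinearMap) u

/-- The vector field `∇F / |∇F|²`, meaningful at the points where `dF ≠ 0`. -/
def field (F : CSpace n m → ℝ) (z : CSpace n m) : CSpace n m :=
  (g.form z (g.grad F z) (g.grad F z))⁻¹ • g.grad F z

/-- `γ`, restricted to the nonempty open interval `I`, is a solution curve of `∇F / |∇F|²` in the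
set where this vector field is defined. -/
structure IsSolutionCurve (F : CSpace n m → ℝ) (I : Set ℝ) (γ : ℝ → CSpace n m) : Prop where
  isOpen : IsOpen I
  ordConnected : I.OrdConnected
  nonempty : I.Nonempty
  regular : ∀ t ∈ I, fderiv ℝ F (γ t) ≠ 0
  hasDerivAt : ∀ t ∈ I, HasDerivAt γ (g.field F (γ t)) t

end HermitianMetric

section Curves

variable {n m : ℕ}

/-- The curve `γ` on the open interval `I` comes out of `p` in the unit direction `u`: in polar
coordinates around `p` it converges to the point `(0, u)` at the left end of `I`. -/
structure ComesOutOf (I : Set ℝ) (γ : ℝ → CSpace n m) (p u : CSpace n m) : Prop where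
  norm_eq_one : ‖u‖ = 1
  tendsto : Tendsto (fun t : I => γ t) atBot (𝓝 p)
  direction : Tendsto (fun t : I => ‖γ t - p‖⁻¹ • (γ t - p)) atBot (𝓝 u)

/-- The point `p` is a limit point of `γ` at the left end of the open interval `I`. -/
def AccumulatesBackwardAt (I : Set ℝ) (γ : ℝ → CSpace n m) (p : CSpace n m) : Prop :=
  MapClusterPt p atBot (fun t : I => γ t)

end Curves

/-- The unstable variety at `p` of `∇F / |∇F|²`: the union of the solution curves coming out of
`p`, together with their end point `p`. -/
def unstableVariety {n m : ℕ} (g : HermitianMetric n m) (F : CSpace n m → ℝ) (p : CSpace n m) :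
    Set (CSpace n m) :=
  insert p {x | ∃ (I : Set ℝ) (γ : ℝ → CSpace n m) (u : CSpace n m),
    g.IsSolutionCurve F I γ ∧ ComesOutOf I γ p u ∧ x ∈ γ '' I}

/-- The function `f = Re(z₁ ⋯ zₙ)` on `ℂⁿ⁺ᵐ`. -/
def reProd (n m : ℕ) (z : CSpace n m) : ℝ := (∏ i : Fin n, z (Sum.inl i)).re

/-- The cone `{(z, 0) | z₁ ⋯ zₙ ∈ ℝ_{≥ 0}, |z₁| = … = |zₙ|}` in `ℂⁿ × ℂᵐ`. -/
def standardCone (n m : ℕ) : Set (CSpace n m) :=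
  {v | (∀ k : Fin m, v (Sum.inr k) = 0) ∧
    (∃ r : ℝ, 0 ≤ r ∧ ∏ i : Fin n, v (Sum.inl i) = (r : ℂ)) ∧
    ∀ i j : Fin n, ‖v (Sum.inl i)‖ = ‖v (Sum.inl j)‖}

/-- The same cone in the tangent space at `p`, for the inner product `g_p`: sums of vectors of
equal `g_p`-length in the normal lines of the hypersurfaces `{zᵢ = 0}` whose first `n` coordinates
have a product in `ℝ_{≥ 0}`. -/
def modelCone {n m : ℕ} (g : HermitianMetric n m) (p : CSpace n m) : Set (CSpace n m) :=
  {v | ∃ e : Fin n → CSpace n m, (∀ i, e i ∈ g.normalLine p i) ∧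
    (∀ i j, g.form p (e i) (e i) = g.form p (e j) (e j)) ∧ v = ∑ i, e i ∧
    ∃ r : ℝ, 0 ≤ r ∧ ∏ i : Fin n, v (Sum.inl i) = (r : ℂ)}

/-- The identification of all points of `X × {0}` in `X × [0, ∞)`. -/
def coneSetoid (X : Type) : Setoid (X × NNReal) where
  r a b := a = b ∨ (a.2 = 0 ∧ b.2 = 0)
  iseqv := by
    refine ⟨fun a => Or.inl rfl, ?_, ?_⟩
    · rintro a b (h | h)
      · exact Or.inl h.symm
      · exact Or.inr ⟨h.2, h.1⟩
    · rintro a b c (rfl | h) (rfl | h')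
      · exact Or.inl rfl
      · exact Or.inr h'
      · exact Or.inr h
      · exact Or.inr ⟨h.1, h'.2⟩

/-- The (open) topological cone `X × [0, ∞) / X × {0}` over `X`, with the quotient topology. -/
def TopCone (X : Type) : Type := Quotient (coneSetoid X)

instance (X : Type) [TopologicalSpace X] : TopologicalSpace (TopCone X) :=
  inferInstanceAs (TopologicalSpace (Quotient (coneSetoid X)))

/-- The class of `(x, t)` in the cone over `X`. -/
def TopCone.mk {X : Type} (x : X) (t : NNReal) : TopCone X := Quotient.mk (coneSetoid X) (x, t)

/-- The `k`-dimensional torus. -/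
abbrev Torus (k : ℕ) : Type := Fin k → Circle

/-- `C` is a cone with vertex `0` over a `k`-torus: it is homeomorphic to the topological cone over
the torus in such a way that the cone parameter is the scaling of vectors. -/
def IsConeOverTorus {n m : ℕ} (k : ℕ) (C : Set (CSpace n m)) : Prop :=
  ∃ Ψ : TopCone (Torus k) ≃ₜ C, ∀ (x : Torus k) (t : NNReal),
    (Ψ (TopCone.mk x t) : CSpace n m) = (t : ℝ) • (Ψ (TopCone.mk x 1) : CSpace n m)

/-- The unstable variety at `p` is homeomorphic and tangent to the cone `C` of tangent vectors: a
homeomorphism `Φ` from `C` onto it sends the vertex to `p`, agrees with `v ↦ p + v` up to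
`o(|v|)`, and maps each open ray of `C` onto a solution curve coming out of `p` in the direction
of that ray. -/
def UnstableVarietyModelledOn {n m : ℕ} (g : HermitianMetric n m) (F : CSpace n m → ℝ)
    (p : CSpace n m) (C : Set (CSpace n m)) : Prop :=
  ∃ Φ : C ≃ₜ unstableVariety g F p,
    (∀ v : C, (v : CSpace n m) = 0 → (Φ v : CSpace n m) = p) ∧
    (fun v : C => (Φ v : CSpace n m) - p - (v : CSpace n m))
      =o[comap (fun v : C => (v : CSpace n m)) (𝓝 0)] (fun v : C => (v : CSpace n m)) ∧
    ∀ v : C, (v : CSpace n m) ≠ 0 → ∃ (I : Set ℝ) (γ : ℝ → CSpace n m),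
      g.IsSolutionCurve F I γ ∧
      ComesOutOf I γ p (‖(v : CSpace n m)‖⁻¹ • (v : CSpace n m)) ∧
      {x | ∃ w : C, (∃ c : ℝ, 0 < c ∧ (w : CSpace n m) = c • (v : CSpace n m)) ∧
        x = (Φ w : CSpace n m)} = γ '' I

end

/-! Along `V = ∇f / |∇f|²` one has `df(V) = 1`, and since the metric is Hermitian also `ds(V) = 1`:
the complex product `s` itself moves with unit real speed. A solution curve accumulating at the
origin as time decreases therefore has `s = t - a`, and `σ = (t - a)^{1/n}` is the natural
parameter. With `y = x / σ` the equation reads `x' = W(σ, y)`, where `W(σ, y) = n σⁿ⁻¹ V(σ y)` on `∏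
yᵢ = 1`. The degenerate factor `σⁿ⁻¹` of `df` cancels, so `W` (`scaledField`) is smooth through `σ =
0`, and `W(0, ·)` sees only the metric at the origin.

For a metric standard at the origin, `W(0, y) = y` on the torus `|yᵢ| = 1`, `∏ yᵢ = 1`, `w = 0`
(`baseTorus`), and the `y`-derivative of `W` there has norm at most `1`
(`norm_scaledFieldDeriv_le`). Writing `x = σ θ + σ² h` turns the singular equation into `h(σ) = ∫₀¹
u k(uσ, h(uσ)) du`. Since `∫₀¹ u du = 1/2`, a Lipschitz constant `3/2` of `k` gives a contraction
with factor `3/4`. Each `θ` in the torus thus starts a curve depending continuously on `θ`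
(`exists_local_family`), and the same factor gives uniqueness
(`IsScaledCurve.eq_of_same_direction`).

No other curve accumulates at the origin. The bound `|V| |df| ≤ C` gives `|x| = O(σ)`
(`IsScaledCurve.exists_norm_le`). To leading order all `|xᵢ|²` have the same derivative, so the
moduli `|yᵢ|` equalise at rate `O(σ)` and `w / σ = O(σ)`. Then `y` is almost a fixed point of `W(0,
·)`, hence Lipschitz in `σ`, and converges to a point of the torus
(`IsScaledCurve.exists_direction`).

The local curves are continued by a complete flow with the same orbits (`exists_isUnstableFamily`).
In polar coordinates this is a continuous bijection from the cone to the unstable variety; local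
bounds on the radius make its inverse continuous. At a general `p` the orthogonal normal lines yield
a linear frame, unitary up to scale, that preserves `s` and reduces the claim to a metric standard
at the origin (`exists_adapted_frame`, `IsAffineSimilarity`). -/

noncomputable section

/-! ### Ordinary differential equations: uniqueness up to a time-dependent speed, and complete
flows. -/

section ODE

open Set Metric

variable {E : Type*} [NormedAddCommGroup E] [NormedSpace ℝ E]

/-- Two solutions of `u' = k(t) X(u)` on an open interval which agree at one point are equal. -/
theorem eqOn_of_hasDerivAt_smul {X : E → E} (hX : LocallyLipschitz X) {k : ℝ → ℝ} {I : Set ℝ}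
    (hI : IsOpen I) (hO : I.OrdConnected) (hk : ContinuousOn k I) {u v : ℝ → E}
    (hu : ∀ t ∈ I, HasDerivAt u (k t • X (u t)) t) (hv : ∀ t ∈ I, HasDerivAt v (k t • X (v t)) t)
    {t₀ : ℝ} (ht₀ : t₀ ∈ I) (h₀ : u t₀ = v t₀) : EqOn u v I := by
  intro t ht
  have hmin : min t t₀ ∈ I := by rcases min_choice t t₀ with h | h <;> rw [h] <;> assumption
  have hmax : max t t₀ ∈ I := by rcases max_choice t t₀ with h | h <;> rw [h] <;> assumption
  obtain ⟨a, ha, haI⟩ : ∃ a < min t t₀, a ∈ I :=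
    ((eventually_mem_nhdsWithin (a := min t t₀) (s := Iio (min t t₀))).and
      (nhdsWithin_le_nhds (hI.mem_nhds hmin))).exists
  obtain ⟨b, hb, hbI⟩ : ∃ b, max t t₀ < b ∧ b ∈ I :=
    ((eventually_mem_nhdsWithin (a := max t t₀) (s := Ioi (max t t₀))).and
      (nhdsWithin_le_nhds (hI.mem_nhds hmax))).exists
  have hab : Icc a b ⊆ I := hO.out haI hbI
  have huc : ContinuousOn u (Icc a b) := fun s hs => (hu s (hab hs)).continuousAt.continuousWithinAt
  have hvc : ContinuousOn v (Icc a b) := fun s hs => (hv s (hab hs)).continuousAt.continuousWithinAt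
  -- A uniform Lipschitz constant for `X` is available only on compact sets. The two trajectories
  -- over `[a, b]` form one, and `k` is bounded on `[a, b]`, so uniqueness is applied inside this
  -- set.
  obtain ⟨K, hK⟩ := LocallyLipschitzOn.exists_lipschitzOnWith_of_compact
    (s := u '' Icc a b ∪ v '' Icc a b)
    ((isCompact_Icc.image_of_continuousOn huc).union (isCompact_Icc.image_of_continuousOn hvc))
    hX.locallyLipschitzOn
  obtain ⟨M, hM⟩ := isCompact_Icc.exists_bound_of_continuousOn (hk.mono hab)
  have hlip : ∀ s ∈ Ioo a b, LipschitzOnWith (M.toNNReal * K) (fun x => k s • X x)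
      (u '' Icc a b ∪ v '' Icc a b) := by
    intro s hs
    refine LipschitzOnWith.of_dist_le_mul fun x hx y hy => ?_
    rw [dist_eq_norm, ← smul_sub, norm_smul, ← dist_eq_norm]
    have h1 := hM s (Ioo_subset_Icc_self hs)
    have h2 := hK.dist_le_mul x hx y hy
    push_cast
    rw [mul_assoc]
    exact mul_le_mul (h1.trans (Real.le_coe_toNNReal M)) h2 dist_nonneg (by positivity)
  refine ODE_solution_unique_of_mem_Icc (v := fun s x => k s • X x) (s := fun _ => u '' Icc a b ∪ v '' Icc a b)
    hlip (t₀ := t₀) ⟨ha.trans_le (min_le_right _ _), (le_max_right _ _).trans_lt hb⟩ huc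
    (fun s hs => hu s (hab (Ioo_subset_Icc_self hs)))
    (fun s hs => Or.inl (mem_image_of_mem _ (Ioo_subset_Icc_self hs))) hvc
    (fun s hs => hv s (hab (Ioo_subset_Icc_self hs)))
    (fun s hs => Or.inr (mem_image_of_mem _ (Ioo_subset_Icc_self hs))) h₀
    ⟨(ha.trans_le (min_le_left _ _)).le, ((le_max_left _ _).trans_lt hb).le⟩

/-- Complete flow of a locally Lipschitz vector field bounded by `1`. -/
theorem exists_continuous_flow [ProperSpace E] [CompleteSpace E] {X : E → E}
    (hX : LocallyLipschitz X) (hb : ∀ x, ‖X x‖ ≤ 1) :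
    ∃ ψ : ℝ → E → E, (∀ x, ψ 0 x = x) ∧ (∀ x t, HasDerivAt (fun s => ψ s x) (X (ψ t x)) t) ∧
      Continuous (fun q : ℝ × E => ψ q.1 q.2) := by
  have key : ∀ N : ℕ, ∃ α : E × ℝ → E, (∀ x ∈ closedBall (0 : E) N, α (x, 0) = x ∧
      ∀ t ∈ Icc (-(N : ℝ)) N, HasDerivWithinAt (fun s => α (x, s)) (X (α (x, t))) (Icc (-(N : ℝ)) N) t) ∧
      ContinuousOn α (closedBall 0 N ×ˢ Icc (-(N : ℝ)) N) := by
    intro N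
    obtain ⟨K, hK⟩ := LocallyLipschitzOn.exists_lipschitzOnWith_of_compact
      (isCompact_closedBall (0 : E) ((2 * N : NNReal) : ℝ)) hX.locallyLipschitzOn
    have h0 : (0 : ℝ) ∈ Icc (-(N : ℝ)) N := by simp
    -- Speed at most `1` keeps trajectories from the ball of radius `N` inside the ball of radius
    -- `2N` for `|t| ≤ N`.
    have hPL : IsPicardLindelof (fun _ : ℝ => X) (⟨0, h0⟩ : Icc (-(N : ℝ)) N) (0 : E) (2 * N) N 1 K :=
      IsPicardLindelof.of_time_independent (fun x _ => by simpa using hb x) hK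
        (by push_cast; simp; linarith)
    exact hPL.exists_forall_mem_closedBall_eq_hasDerivWithinAt_continuousOn
  choose α hα hαc using key
  have hder : ∀ (N : ℕ) (x : E) (t : ℝ), ‖x‖ ≤ N → |t| < N →
      HasDerivAt (fun s => α N (x, s)) (X (α N (x, t))) t := by
    intro N x t hx ht
    rw [abs_lt] at ht
    exact ((hα N x (by simpa using hx)).2 t ⟨ht.1.le, ht.2.le⟩).hasDerivAt (Icc_mem_nhds ht.1 ht.2)
  have hagree : ∀ (N M : ℕ) (x : E) (t : ℝ), ‖x‖ ≤ N → |t| < N → ‖x‖ ≤ M → |t| < M →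
      α N (x, t) = α M (x, t) := by
    intro N M x t hxN htN hxM htM
    have hpos : |t| < min (N : ℝ) M := lt_min htN htM
    refine eqOn_of_hasDerivAt_smul hX (k := fun _ => 1) (I := Ioo (-(min (N : ℝ) M)) (min (N : ℝ) M))
      isOpen_Ioo ordConnected_Ioo continuousOn_const (u := fun s => α N (x, s))
      (v := fun s => α M (x, s)) ?_ ?_ (t₀ := 0) ?_ ?_ (abs_lt.1 hpos)
    · intro s hs
      simpa using hder N x s hxN ((abs_lt.2 hs).trans_le (min_le_left _ _))
    · intro s hs
      simpa using hder M x s hxM ((abs_lt.2 hs).trans_le (min_le_right _ _))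
    · have := (abs_nonneg t).trans_lt hpos
      exact ⟨by linarith, this⟩
    · simp only [(hα N x (by simpa using hxN)).1, (hα M x (by simpa using hxM)).1]
  have hex : ∀ (x : E) (t : ℝ), ∃ N : ℕ, ‖x‖ < N ∧ |t| < N := by
    intro x t
    obtain ⟨N, hN⟩ := exists_nat_gt (max ‖x‖ |t|)
    exact ⟨N, (le_max_left _ _).trans_lt hN, (le_max_right _ _).trans_lt hN⟩
  choose ν hν1 hν2 using hex
  set ψ : ℝ → E → E := fun t x => α (ν x t) (x, t) with hψ
  have hψeq : ∀ (N : ℕ) (x : E) (t : ℝ), ‖x‖ < N → |t| < N → ψ t x = α N (x, t) :=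
    fun N x t hx ht => hagree _ _ x t (hν1 x t).le (hν2 x t) hx.le ht
  refine ⟨ψ, fun x => (hα _ x (by simpa using (hν1 x 0).le)).1, fun x t => ?_, ?_⟩
  · have hev : (fun s => ψ s x) =ᶠ[𝓝 t] fun s => α (ν x t) (x, s) := by
      filter_upwards [(isOpen_lt continuous_abs continuous_const).mem_nhds (hν2 x t)] with s hs
      exact hψeq _ _ _ (hν1 x t) hs
    exact (hder (ν x t) x t (hν1 x t).le (hν2 x t)).congr_of_eventuallyEq hev
  · rw [continuous_iff_continuousAt]
    rintro ⟨t, x⟩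
    -- The chosen index `ν` need not be locally constant. Near `(t, x)` it may be replaced by the
    -- fixed `N`, because the local flows agree wherever both are defined.
    set N := ν x t with hN
    have hmem : {q : ℝ × E | ‖q.2‖ < N ∧ |q.1| < N} ∈ 𝓝 (t, x) :=
      ((isOpen_lt (continuous_snd.norm) continuous_const).inter
        (isOpen_lt (continuous_fst.abs) continuous_const)).mem_nhds ⟨hν1 x t, hν2 x t⟩
    have hev : (fun q : ℝ × E => ψ q.1 q.2) =ᶠ[𝓝 (t, x)] fun q => α N (q.2, q.1) := by
      filter_upwards [hmem] with q hq
      exact hψeq _ _ _ hq.1 hq.2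
    refine ContinuousAt.congr_of_eventuallyEq ?_ hev
    have h1 : ContinuousAt (α N) (x, t) :=
      (hαc N).continuousAt (prod_mem_nhds
        (closedBall_mem_nhds_of_mem (by simpa using hν1 x t)) (Icc_mem_nhds (abs_lt.1 (hν2 x t)).1
          (abs_lt.1 (hν2 x t)).2))
    exact ContinuousAt.comp (f := fun q : ℝ × E => (q.2, q.1)) (x := (t, x)) h1 (by fun_prop)

end ODE

/-! ### The product `z₁ ⋯ zₙ` and its logarithmic differential. -/

section Product

open Finset

variable {n m : ℕ}

/-- The projection of `ℂⁿ⁺ᵐ` to a coordinate, as a complex linear map. -/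
def coordL (n m : ℕ) (k : Fin n ⊕ Fin m) : CSpace n m →L[ℂ] ℂ :=
  EuclideanSpace.proj (𝕜 := ℂ) k

@[simp] theorem coordL_apply (k : Fin n ⊕ Fin m) (v : CSpace n m) : coordL n m k v = v k := rfl

/-- The function `z₁ ⋯ zₙ` on `ℂⁿ⁺ᵐ`. -/
def coordProd (n m : ℕ) (z : CSpace n m) : ℂ := ∏ i : Fin n, z (Sum.inl i)

theorem reProd_eq_re (z : CSpace n m) : reProd n m z = (coordProd n m z).re := rfl

/-- The differential of `z₁ ⋯ zₙ`. -/
def coordProdDeriv (z : CSpace n m) : CSpace n m →L[ℂ] ℂ :=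
  ∑ i : Fin n, (∏ j ∈ univ.erase i, z (Sum.inl j)) • coordL n m (Sum.inl i)

theorem coordProdDeriv_apply (z v : CSpace n m) :
    coordProdDeriv z v = ∑ i : Fin n, (∏ j ∈ univ.erase i, z (Sum.inl j)) * v (Sum.inl i) := by
  simp [coordProdDeriv]

theorem hasFDerivAt_coordProd (z : CSpace n m) :
    HasFDerivAt (coordProd n m) (coordProdDeriv z) z := by
  have := HasFDerivAt.finsetProd (u := (univ : Finset (Fin n))) (x := z)
    (g := fun (i : Fin n) (z : CSpace n m) => z (Sum.inl i))
    (g' := fun i => coordL n m (Sum.inl i)) (fun i _ => (coordL n m (Sum.inl i)).hasFDerivAt)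
  exact this

theorem hasFDerivAt_reProd (z : CSpace n m) :
    HasFDerivAt (reProd n m)
      (Complex.reCLM.comp ((coordProdDeriv z).restrictScalars ℝ)) z :=
  Complex.reCLM.hasFDerivAt.comp z ((hasFDerivAt_coordProd z).restrictScalars ℝ)

theorem fderiv_reProd (z v : CSpace n m) :
    fderiv ℝ (reProd n m) z v = (coordProdDeriv z v).re := by
  rw [(hasFDerivAt_reProd z).fderiv]; rfl

theorem contDiff_reProd : ContDiff ℝ ∞ (reProd n m) := by
  have h : ContDiff ℝ ∞ (coordProd n m) := by
    unfold coordProd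
    exact contDiff_prod fun i _ => ((coordL n m (Sum.inl i)).restrictScalars ℝ).contDiff
  exact Complex.reCLM.contDiff.comp h

theorem contDiff_fderiv_reProd : ContDiff ℝ ∞ (fderiv ℝ (reProd n m)) :=
  contDiff_reProd.fderiv_right (by simp)

/-- The covector `v ↦ Re ∑ vᵢ / yᵢ`. -/
def logCovector (y : CSpace n m) : CSpace n m →L[ℝ] ℝ :=
  ∑ i : Fin n, Complex.reCLM.comp
    (((y (Sum.inl i))⁻¹ • coordL n m (Sum.inl i)).restrictScalars ℝ)

theorem logCovector_apply (y v : CSpace n m) :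
    logCovector y v = (∑ i : Fin n, (y (Sum.inl i))⁻¹ * v (Sum.inl i)).re := by
  simp [logCovector]

theorem coordProdDeriv_eq_of_ne {z : CSpace n m} (hz : ∀ i : Fin n, z (Sum.inl i) ≠ 0)
    (v : CSpace n m) :
    coordProdDeriv z v = coordProd n m z * ∑ i : Fin n, (z (Sum.inl i))⁻¹ * v (Sum.inl i) := by
  rw [coordProdDeriv_apply, mul_sum]
  refine sum_congr rfl fun i _ => ?_
  rw [coordProd, ← mul_prod_erase univ _ (mem_univ i)]
  field_simp [hz i]

/-- `ds = s ∑ dzᵢ / zᵢ`, and `s(σ y) = σⁿ` while each `1 / zᵢ` contributes `σ⁻¹`. All the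
degeneration of `df` towards the origin along `σ y` is thus the scalar `σⁿ⁻¹`, which drops out of
the rescaled field. -/
theorem fderiv_reProd_eq_logCovector {σ : ℝ} (hσ : 0 < σ) {y : CSpace n m}
    (hy : coordProd n m y = 1) (hn : 1 ≤ n) :
    fderiv ℝ (reProd n m) (σ • y) = σ ^ (n - 1) • logCovector y := by
  have hy0 : ∀ i : Fin n, y (Sum.inl i) ≠ 0 := by
    intro i h
    rw [coordProd, prod_eq_zero (mem_univ i) h] at hy
    exact zero_ne_one hy
  ext v
  have hσ' : (σ : ℂ) ≠ 0 := by exact_mod_cast hσ.ne'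
  have hne : ∀ i : Fin n, (σ • y) (Sum.inl i) ≠ 0 := by
    intro i; simp [hσ.ne', hy0 i]
  rw [fderiv_reProd, coordProdDeriv_eq_of_ne hne, smul_apply,
    logCovector_apply, smul_eq_mul, ← Complex.re_ofReal_mul]
  congr 1
  have : coordProd n m (σ • y) = (σ : ℂ) ^ n := by
    simp only [coordProd, PiLp.smul_apply, Complex.real_smul] at hy ⊢
    rw [prod_mul_distrib, hy]; simp
  rw [this, mul_sum, mul_sum]
  refine sum_congr rfl fun i _ => ?_
  obtain ⟨k, rfl⟩ := Nat.exists_eq_add_of_le' hn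
  simp only [PiLp.smul_apply, Complex.real_smul, Nat.add_sub_cancel]
  have := hy0 i
  push_cast
  field_simp
  ring

theorem logCovector_ne_zero (hn : 1 ≤ n) {y : CSpace n m} (hy : ∀ i : Fin n, y (Sum.inl i) ≠ 0) :
    logCovector y ≠ 0 := by
  intro h
  have h1 := congrArg (fun L => L (EuclideanSpace.single (Sum.inl ⟨0, hn⟩) (y (Sum.inl ⟨0, hn⟩)))) h
  simp only [logCovector_apply, zero_apply] at h1
  rw [sum_eq_single (⟨0, hn⟩ : Fin n)] at h1
  · simp [hy] at h1
  · intro b _ hb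
    simp [hb]
  · simp

end Product

/-! ### Metric duality, bounds on `∇f / |∇f|²`, and the rescaled field. -/

namespace HermitianMetric

variable {n m : ℕ} (g : HermitianMetric n m)

theorem form_ext {z u u' : CSpace n m} (h : ∀ v, g.form z u v = g.form z u' v) : u = u' := by
  by_contra hne
  have h1 := g.pos z (u - u') (sub_ne_zero.2 hne)
  have h2 : g.form z (u - u') (u - u') = 0 := by
    rw [map_sub (g.form z) u u', sub_apply, h, sub_self]
  exact h1.ne' h2

theorem isInvertible_form (z : CSpace n m) : (g.form z).IsInvertible := by
  have hinj : Function.Injective (g.form z).toLinearMap := by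
    intro u u' h
    exact g.form_ext fun v => by
      have := congrArg (fun L : CSpace n m →L[ℝ] ℝ => L v) h
      exact this
  have hfin : Module.finrank ℝ (CSpace n m) = Module.finrank ℝ (CSpace n m →L[ℝ] ℝ) := by
    rw [← (LinearMap.toContinuousLinearMap (𝕜 := ℝ) (E := CSpace n m) (F' := ℝ)).finrank_eq]
    exact Subspace.dual_finrank_eq.symm
  refine ⟨(LinearMap.linearEquivOfInjective _ hinj hfin).toContinuousLinearEquiv, ?_⟩
  ext u v
  rfl

/-- The inverse of `v ↦ g_z(v, ·)`, as a continuous linear map. -/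
def sharp (z : CSpace n m) : (CSpace n m →L[ℝ] ℝ) →L[ℝ] CSpace n m := (g.form z).inverse

theorem form_sharp (z : CSpace n m) (l : CSpace n m →L[ℝ] ℝ) (v : CSpace n m) :
    g.form z (g.sharp z l) v = l v := by
  have : g.form z (g.sharp z l) = l := (g.isInvertible_form z).self_apply_inverse l
  rw [this]

theorem contDiff_sharp : ContDiff ℝ ∞ g.sharp := by
  rw [contDiff_iff_contDiffAt]
  intro z
  exact ContDiffAt.comp (g := ContinuousLinearMap.inverse) z
    ((g.isInvertible_form z).contDiffAt_map_inverse) g.smooth.contDiffAt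

theorem grad_eq_sharp (F : CSpace n m → ℝ) (z : CSpace n m) :
    g.grad F z = g.sharp z (fderiv ℝ F z) :=
  g.form_ext fun v => by rw [g.form_grad, g.form_sharp]

theorem form_I_smul_self (z u : CSpace n m) : g.form z u (Complex.I • u) = 0 := by
  have h := g.invariant z u (Complex.I • u)
  rw [smul_smul, Complex.I_mul_I, neg_one_smul, map_neg, g.symm z (Complex.I • u) u] at h
  linarith

theorem exists_form_lower_bound : ∃ c > 0, ∀ x : CSpace n m, ‖x‖ ≤ 1 → ∀ v : CSpace n m,
    c * ‖v‖ ^ 2 ≤ g.form x v v := by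
  have hK : IsCompact (Metric.closedBall (0 : CSpace n m) 1 ×ˢ Metric.sphere (0 : CSpace n m) 1) :=
    (isCompact_closedBall _ _).prod (isCompact_sphere _ _)
  have hcont : Continuous fun q : CSpace n m × CSpace n m => g.form q.1 q.2 q.2 := by
    have h1 : Continuous g.form := g.smooth.continuous
    fun_prop
  obtain ⟨c, hc, hcK⟩ : ∃ c > 0, ∀ q ∈ Metric.closedBall (0 : CSpace n m) 1 ×ˢ
      Metric.sphere (0 : CSpace n m) 1, c ≤ g.form q.1 q.2 q.2 := by
    rcases (Metric.closedBall (0 : CSpace n m) 1 ×ˢ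
      Metric.sphere (0 : CSpace n m) 1).eq_empty_or_nonempty with he | hne
    -- The unit sphere is empty when the space is zero.
    · exact ⟨1, one_pos, by simp [he]⟩
    · obtain ⟨q, hq, hmin⟩ := hK.exists_isMinOn hne hcont.continuousOn
      refine ⟨_, g.pos q.1 q.2 ?_, hmin⟩
      intro h0
      have := hq.2
      simp [h0] at this
  refine ⟨c, hc, fun x hx v => ?_⟩
  rcases eq_or_ne v 0 with rfl | hv
  · simp
  · have hv' : ‖v‖ ≠ 0 := norm_ne_zero_iff.2 hv
    have := hcK (x, ‖v‖⁻¹ • v) ⟨by simpa using hx, by simp [norm_smul, hv']⟩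
    simp only [map_smul, smul_apply, smul_eq_mul] at this
    have h2 : g.form x v v = ‖v‖ ^ 2 * (‖v‖⁻¹ * (‖v‖⁻¹ * g.form x v v)) := by
      field_simp
    rw [h2, mul_comm]
    exact mul_le_mul_of_nonneg_left this (by positivity)

/-- In the metric, `|V|` equals `1 / |∇f|`, and on the unit ball the metric is uniformly comparable
with the Euclidean one. This bound does not see how `df` degenerates, so it can be used before
anything is known about the direction of a curve. -/
theorem exists_field_bound (F : CSpace n m → ℝ) : ∃ C > 0, ∀ x : CSpace n m, ‖x‖ ≤ 1 →
    ‖g.field F x‖ * ‖fderiv ℝ F x‖ ≤ C := by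
  obtain ⟨c, hc, hcK⟩ := g.exists_form_lower_bound
  obtain ⟨M, hM⟩ := (isCompact_closedBall (0 : CSpace n m) 1).exists_bound_of_continuousOn
    (f := fun x => (show CSpace n m →L[ℝ] CSpace n m →L[ℝ] ℝ from g.form x))
    g.smooth.continuous.continuousOn
  have hM0 : 0 ≤ M := (norm_nonneg _).trans (hM 0 (by simp))
  refine ⟨M / c + 1, by positivity, fun x hx => ?_⟩
  have hle : ‖fderiv ℝ F x‖ ≤ M * ‖g.grad F x‖ := by
    have h1 : fderiv ℝ F x = g.form x (g.grad F x) := by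
      ext v; rw [g.form_grad]
    rw [h1]
    exact ((g.form x).le_opNorm _).trans
      (mul_le_mul_of_nonneg_right (hM x (by simpa using hx)) (norm_nonneg _))
  rcases eq_or_ne (g.grad F x) 0 with h0 | h0
  · simp only [field, h0, smul_zero, norm_zero, zero_mul]
    positivity
  · have hpos := g.pos x _ h0
    have hlow := hcK x hx (g.grad F x)
    have hnorm : 0 < ‖g.grad F x‖ := norm_pos_iff.2 h0
    rw [field, norm_smul, norm_inv, Real.norm_of_nonneg hpos.le]
    calc (g.form x (g.grad F x) (g.grad F x))⁻¹ * ‖g.grad F x‖ * ‖fderiv ℝ F x‖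
        ≤ (c * ‖g.grad F x‖ ^ 2)⁻¹ * ‖g.grad F x‖ * (M * ‖g.grad F x‖) := by
          gcongr
      _ = M / c := by field_simp
      _ ≤ M / c + 1 := by linarith

theorem fderiv_field {F : CSpace n m → ℝ} {z : CSpace n m} (hz : fderiv ℝ F z ≠ 0) :
    fderiv ℝ F z (g.field F z) = 1 := by
  have h0 : g.grad F z ≠ 0 := by
    intro h
    apply hz
    ext v
    rw [← g.form_grad, h]; simp
  rw [field, map_smul, ← g.form_grad, smul_eq_mul, inv_mul_cancel₀ (g.pos z _ h0).ne']

theorem grad_ne_zero {F : CSpace n m → ℝ} {z : CSpace n m} (hz : fderiv ℝ F z ≠ 0) :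
    g.grad F z ≠ 0 := by
  intro h
  apply hz
  ext v
  rw [← g.form_grad, h]; simp

theorem fderiv_I_smul_grad (F : CSpace n m → ℝ) (z : CSpace n m) (c : ℝ) :
    fderiv ℝ F z (Complex.I • (c • g.grad F z)) = 0 := by
  rw [smul_comm, map_smul, ← g.form_grad, g.form_I_smul_self, smul_zero]

/-- For a Hermitian metric `i∇f` is orthogonal to `∇f`, so `df(iV) = 0`. By complex linearity of
`ds` this says `Im ds(V) = 0`, while `Re ds(V) = df(V) = 1`. -/
theorem coordProdDeriv_field {z : CSpace n m} (hz : fderiv ℝ (reProd n m) z ≠ 0) :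
    coordProdDeriv z (g.field (reProd n m) z) = 1 := by
  have h1 := g.fderiv_field hz
  have h2 := g.fderiv_I_smul_grad (reProd n m) z
    ((g.form z (g.grad (reProd n m) z) (g.grad (reProd n m) z))⁻¹)
  change fderiv ℝ (reProd n m) z (Complex.I • g.field (reProd n m) z) = 0 at h2
  rw [fderiv_reProd] at h1 h2
  rw [map_smul, smul_eq_mul, Complex.I_mul_re, neg_eq_zero] at h2
  exact Complex.ext (by simpa using h1) (by simpa using h2)

/-- The vector field `n σⁿ⁻¹ V(σ y)` on `{∏ yᵢ = 1}`, extended smoothly to all `σ` and to all `y`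
with nonvanishing `yᵢ`. -/
def scaledField (q : ℝ × CSpace n m) : CSpace n m :=
  ((n : ℝ) / logCovector q.2 (g.sharp (q.1 • q.2) (logCovector q.2))) •
    g.sharp (q.1 • q.2) (logCovector q.2)

theorem sharp_ne_zero {z : CSpace n m} {l : CSpace n m →L[ℝ] ℝ} (hl : l ≠ 0) : g.sharp z l ≠ 0 := by
  intro h
  apply hl
  ext v
  rw [← g.form_sharp z l v, h]; simp

theorem apply_sharp_pos {z : CSpace n m} {l : CSpace n m →L[ℝ] ℝ} (hl : l ≠ 0) :
    0 < l (g.sharp z l) := by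
  rw [← g.form_sharp z l]
  exact g.pos z _ (g.sharp_ne_zero hl)

theorem scaledField_eq {σ : ℝ} (hσ : 0 < σ) {y : CSpace n m}
    (hy : coordProd n m y = 1) (hn : 1 ≤ n) :
    g.scaledField (σ, y) = ((n : ℝ) * σ ^ (n - 1)) • g.field (reProd n m) (σ • y) := by
  have h1 : g.grad (reProd n m) (σ • y) = σ ^ (n - 1) • g.sharp (σ • y) (logCovector y) := by
    rw [g.grad_eq_sharp, fderiv_reProd_eq_logCovector hσ hy hn, map_smul]
  have hσ' : σ ^ (n - 1) ≠ 0 := by positivity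
  simp only [field, h1, scaledField, map_smul, smul_apply, smul_eq_mul,
    smul_smul, g.form_sharp]
  congr 1
  field_simp

/-- The argument of `coordProdDeriv_field`, without assuming `∏ yᵢ = 1`. It is needed in this
generality to show that curves built from the rescaled equation satisfy `s = σⁿ`. -/
theorem sum_scaledField (hn : 1 ≤ n) {σ : ℝ} {y : CSpace n m} (hy : ∀ i : Fin n, y (Sum.inl i) ≠ 0) :
    ∑ i : Fin n, (y (Sum.inl i))⁻¹ * g.scaledField (σ, y) (Sum.inl i) = n := by
  have hpos := g.apply_sharp_pos (z := σ • y) (logCovector_ne_zero hn hy)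
  have h1 : logCovector y (g.scaledField (σ, y)) = n := by
    simp only [scaledField, map_smul, smul_eq_mul]
    field_simp
  have h2 : logCovector y (Complex.I • g.scaledField (σ, y)) = 0 := by
    simp only [scaledField]
    rw [smul_comm, map_smul, ← g.form_sharp (σ • y) (logCovector y), g.form_sharp,
      ← g.form_sharp (σ • y) (logCovector y) (Complex.I • _), g.form_I_smul_self, smul_zero]
  rw [logCovector_apply] at h1 h2
  have h3 : ∑ i : Fin n, (y (Sum.inl i))⁻¹ * (Complex.I • g.scaledField (σ, y)) (Sum.inl i)
      = Complex.I * ∑ i : Fin n, (y (Sum.inl i))⁻¹ * g.scaledField (σ, y) (Sum.inl i) := by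
    rw [Finset.mul_sum]
    refine Finset.sum_congr rfl fun i _ => ?_
    simp only [PiLp.smul_apply, smul_eq_mul]; ring
  rw [h3, Complex.I_mul_re, neg_eq_zero] at h2
  exact Complex.ext (by simpa using h1) (by simpa using h2)

end HermitianMetric

/-- The points of `ℝ × ℂⁿ⁺ᵐ` at which `scaledField` is smooth. -/
def regularSet (n m : ℕ) : Set (ℝ × CSpace n m) := {q | ∀ i : Fin n, q.2 (Sum.inl i) ≠ 0}

theorem isOpen_regularSet (n m : ℕ) : IsOpen (regularSet n m) := by
  have : regularSet n m = ⋂ i : Fin n, {q | q.2 (Sum.inl i) ≠ 0} := by ext; simp [regularSet]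
  rw [this]
  refine isOpen_iInter_of_finite fun i => isOpen_ne_fun ?_ continuous_const
  exact (coordL n m (Sum.inl i)).continuous.comp continuous_snd

namespace HermitianMetric

variable {n m : ℕ} (g : HermitianMetric n m)

theorem contDiffAt_logCovector {y : CSpace n m} (hy : ∀ i : Fin n, y (Sum.inl i) ≠ 0) :
    ContDiffAt ℝ ∞ (logCovector (n := n) (m := m)) y := by
  unfold logCovector
  refine ContDiffAt.sum fun i _ => ?_
  have h1 : ContDiffAt ℝ ∞ (fun y : CSpace n m => (y (Sum.inl i))⁻¹) y :=
    (((coordL n m (Sum.inl i)).restrictScalars ℝ).contDiff.contDiffAt).inv (hy i)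
  let Λ : ℂ →L[ℝ] (CSpace n m →L[ℝ] ℝ) :=
    LinearMap.toContinuousLinearMap
      { toFun := fun c => Complex.reCLM.comp ((c • coordL n m (Sum.inl i)).restrictScalars ℝ)
        map_add' := fun a b => by ext v; simp [add_mul]
        map_smul' := fun a b => by ext v; simp [mul_assoc] }
  exact Λ.contDiff.contDiffAt.comp y h1

/-- The parameter `σ` enters only through the base point `σ y` of the metric, so `σ = 0` is not
singular; the denominator is the squared dual norm of a nonzero covector. -/
theorem contDiffOn_scaledField (hn : 1 ≤ n) :
    ContDiffOn ℝ ∞ g.scaledField (regularSet n m) := by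
  intro q hq
  refine ContDiffAt.contDiffWithinAt ?_
  have h1 : ContDiffAt ℝ ∞ (fun q : ℝ × CSpace n m => logCovector q.2) q :=
    (contDiffAt_logCovector hq).comp q contDiff_snd.contDiffAt
  have h2 : ContDiffAt ℝ ∞ (fun q : ℝ × CSpace n m => g.sharp (q.1 • q.2)) q :=
    g.contDiff_sharp.contDiffAt.comp q (contDiff_fst.smul contDiff_snd).contDiffAt
  have h3 := h2.clm_apply h1
  have h4 := h1.clm_apply h3
  exact (contDiffAt_const.div h4 (g.apply_sharp_pos (logCovector_ne_zero hn hq)).ne').smul h3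

end HermitianMetric

/-- The torus `{|yᵢ| = 1, ∏ yᵢ = 1, w = 0}` over which the standard cone is the cone. -/
def baseTorus (n m : ℕ) : Set (CSpace n m) :=
  {y | (∀ i : Fin n, ‖y (Sum.inl i)‖ = 1) ∧ coordProd n m y = 1 ∧ ∀ k : Fin m, y (Sum.inr k) = 0}

/-! ### Compactness of the torus of directions. -/

section Torus

variable {n m : ℕ}

theorem norm_sq_eq_sum (v : CSpace n m) :
    ‖v‖ ^ 2 = ∑ i : Fin n, ‖v (Sum.inl i)‖ ^ 2 + ∑ k : Fin m, ‖v (Sum.inr k)‖ ^ 2 := by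
  rw [EuclideanSpace.norm_sq_eq, Fintype.sum_sum_type]

theorem norm_coord_le (v : CSpace n m) (k : Fin n ⊕ Fin m) : ‖v k‖ ≤ ‖v‖ :=
  PiLp.norm_apply_le v k

theorem continuous_coord (k : Fin n ⊕ Fin m) : Continuous fun v : CSpace n m => v k :=
  (coordL n m k).continuous

theorem continuous_coordProd : Continuous (coordProd n m) :=
  continuous_finsetProd _ fun i _ => continuous_coord (Sum.inl i)

theorem norm_sq_of_mem_baseTorus {y : CSpace n m} (hy : y ∈ baseTorus n m) : ‖y‖ ^ 2 = n := by
  rw [norm_sq_eq_sum]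
  simp [hy.1, hy.2.2]

theorem coord_ne_zero_of_mem_baseTorus {y : CSpace n m} (hy : y ∈ baseTorus n m) (i : Fin n) :
    y (Sum.inl i) ≠ 0 := by
  rw [← norm_ne_zero_iff, hy.1 i]; exact one_ne_zero

theorem norm_pos_of_mem_baseTorus (hn : 1 ≤ n) {y : CSpace n m} (hy : y ∈ baseTorus n m) :
    0 < ‖y‖ := by
  have := norm_sq_of_mem_baseTorus hy
  have h2 : (0 : ℝ) < n := by exact_mod_cast hn
  rw [← this] at h2
  exact (sq_pos_iff.1 h2).lt_of_le' (norm_nonneg _)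

theorem isClosed_baseTorus : IsClosed (baseTorus n m) := by
  refine IsClosed.inter ?_ (IsClosed.inter ?_ ?_)
  · have : {y : CSpace n m | ∀ i : Fin n, ‖y (Sum.inl i)‖ = 1} =
      ⋂ i : Fin n, {y | ‖y (Sum.inl i)‖ = 1} := by ext; simp
    change IsClosed {y : CSpace n m | ∀ i : Fin n, ‖y (Sum.inl i)‖ = 1}
    rw [this]
    exact isClosed_iInter fun i => isClosed_eq (continuous_coord _).norm continuous_const
  · exact isClosed_eq continuous_coordProd continuous_const
  · change IsClosed {y : CSpace n m | ∀ k : Fin m, y (Sum.inr k) = 0}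
    simp only [Set.ofPred_forall]
    exact isClosed_iInter fun i => isClosed_eq (continuous_coord _) continuous_const

theorem isCompact_baseTorus : IsCompact (baseTorus n m) := by
  refine Metric.isCompact_of_isClosed_isBounded isClosed_baseTorus ?_
  refine (Metric.isBounded_closedBall (x := (0 : CSpace n m)) (r := n + 1)).subset fun y hy => ?_
  have := norm_sq_of_mem_baseTorus hy
  rw [mem_closedBall_zero_iff]
  nlinarith [norm_nonneg y]

end Torus

/-! ### The rescaled field at `σ = 0` for a metric standard at the origin. -/

namespace HermitianMetric

variable {n m : ℕ} (g : HermitianMetric n m)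

theorem sharp_zero_logCovector (hg : g.IsStandardAt 0) (y : CSpace n m) :
    g.sharp 0 (logCovector y) = WithLp.toLp 2
      (Sum.elim (fun i => (starRingEnd ℂ (y (Sum.inl i)))⁻¹) fun _ => 0) := by
  refine g.form_ext (z := 0) fun v => ?_
  rw [g.form_sharp, hg, logCovector_apply, Fintype.sum_sum_type]
  simp only [Sum.elim_inl, Sum.elim_inr, zero_mul, Finset.sum_const_zero, add_zero]
  rw [← Complex.conj_re, map_sum]
  simp

theorem scaledField_zero_inl (hg : g.IsStandardAt 0) (y : CSpace n m) (i : Fin n) :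
    g.scaledField (0, y) (Sum.inl i) =
      ((n : ℂ) / ∑ j : Fin n, (y (Sum.inl j))⁻¹ * (starRingEnd ℂ (y (Sum.inl j)))⁻¹) *
        (starRingEnd ℂ (y (Sum.inl i)))⁻¹ := by
  have h : ((∑ j : Fin n, (y (Sum.inl j))⁻¹ * (starRingEnd ℂ (y (Sum.inl j)))⁻¹ : ℂ).re : ℂ) =
      ∑ j : Fin n, (y (Sum.inl j))⁻¹ * (starRingEnd ℂ (y (Sum.inl j)))⁻¹ := by
    rw [← Complex.conj_eq_iff_re, map_sum]
    refine Finset.sum_congr rfl fun j _ => ?_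
    simp [mul_comm]
  simp only [scaledField, zero_smul, g.sharp_zero_logCovector hg, PiLp.smul_apply, Sum.elim_inl,
    logCovector_apply, Complex.real_smul]
  rw [Complex.ofReal_div, h]
  simp

theorem scaledField_zero_inr (hg : g.IsStandardAt 0) (y : CSpace n m) (k : Fin m) :
    g.scaledField (0, y) (Sum.inr k) = 0 := by
  simp [scaledField, g.sharp_zero_logCovector hg]

/-- If `|yᵢ| = 1` then `1 / ȳᵢ = yᵢ` and `∑ |yⱼ|⁻² = n`. For the flat metric the rays over the torus
are therefore exact solutions. -/
theorem scaledField_zero_of_mem_baseTorus (hg : g.IsStandardAt 0) (hn : 1 ≤ n) {y : CSpace n m}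
    (hy : y ∈ baseTorus n m) : g.scaledField (0, y) = y := by
  have h1 : ∀ i : Fin n, (starRingEnd ℂ (y (Sum.inl i)))⁻¹ = y (Sum.inl i) := by
    intro i
    rw [← map_inv₀, Complex.inv_eq_conj (hy.1 i), Complex.conj_conj]
  have hn' : (n : ℂ) ≠ 0 := by exact_mod_cast (by omega : n ≠ 0)
  ext k
  rcases k with i | k
  · rw [g.scaledField_zero_inl hg]
    simp only [h1]
    rw [Finset.sum_congr rfl fun j _ => inv_mul_cancel₀ (coord_ne_zero_of_mem_baseTorus hy j)]
    simp [hn']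
  · rw [g.scaledField_zero_inr hg, hy.2.2]

/-- The derivative of the scaled field in the `y`-direction. -/
def scaledFieldDeriv (q : ℝ × CSpace n m) : CSpace n m →L[ℝ] CSpace n m :=
  (fderiv ℝ g.scaledField q).comp (ContinuousLinearMap.inr ℝ ℝ (CSpace n m))

theorem differentiableAt_scaledField (hn : 1 ≤ n) {q : ℝ × CSpace n m} (hq : q ∈ regularSet n m) :
    DifferentiableAt ℝ g.scaledField q :=
  ((g.contDiffOn_scaledField hn).contDiffAt ((isOpen_regularSet n m).mem_nhds hq)).differentiableAt
    (by simp)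

theorem hasFDerivAt_scaledField (hn : 1 ≤ n) {σ : ℝ} {y : CSpace n m}
    (hq : (σ, y) ∈ regularSet n m) :
    HasFDerivAt (fun y => g.scaledField (σ, y)) (g.scaledFieldDeriv (σ, y)) y :=
  (g.differentiableAt_scaledField hn hq).hasFDerivAt.comp y (hasFDerivAt_prodMk_right σ y)

theorem hasDerivAt_scaledField (hn : 1 ≤ n) {σ : ℝ} {y : CSpace n m}
    (hq : (σ, y) ∈ regularSet n m) :
    HasDerivAt (fun s => g.scaledField (s, y)) (fderiv ℝ g.scaledField (σ, y) (1, 0)) σ :=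
  HasFDerivAt.comp_hasDerivAt (f := fun s : ℝ => (s, y)) σ
    (g.differentiableAt_scaledField hn hq).hasFDerivAt
    ((hasDerivAt_id' σ).prodMk (hasDerivAt_const σ y))

theorem continuousOn_fderiv_scaledField (hn : 1 ≤ n) :
    ContinuousOn (fderiv ℝ g.scaledField) (regularSet n m) :=
  (g.contDiffOn_scaledField hn).continuousOn_fderiv_of_isOpen (isOpen_regularSet n m) (by simp)

theorem scaledFieldDeriv_inl (hg : g.IsStandardAt 0) (hn : 1 ≤ n) {y : CSpace n m}
    (hy : y ∈ baseTorus n m) (v : CSpace n m) (i : Fin n) :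
    g.scaledFieldDeriv (0, y) v (Sum.inl i) = y (Sum.inl i) *
      (((2 / n * ∑ j : Fin n, (v (Sum.inl j) * (y (Sum.inl j))⁻¹).re : ℝ) : ℂ) -
        starRingEnd ℂ (v (Sum.inl i) * (y (Sum.inl i))⁻¹)) := by
  have hn' : (n : ℂ) ≠ 0 := by exact_mod_cast (by omega : n ≠ 0)
  have hy0 := coord_ne_zero_of_mem_baseTorus hy
  have hyc : ∀ i : Fin n, starRingEnd ℂ (y (Sum.inl i)) = (y (Sum.inl i))⁻¹ :=
    fun i => (Complex.inv_eq_conj (hy.1 i)).symm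
  have hreg : ((0 : ℝ), y + (0 : ℝ) • v) ∈ regularSet n m := by simpa [regularSet] using hy0
  have hline : HasDerivAt (fun t : ℝ => y + t • v) v 0 := by
    simpa using ((hasDerivAt_id (0 : ℝ)).smul_const v).const_add y
  have h1 := (g.hasFDerivAt_scaledField hn hreg).comp_hasDerivAt (0 : ℝ) hline
  have h2 : HasDerivAt (fun t : ℝ => g.scaledField (0, y + t • v) (Sum.inl i))
      (g.scaledFieldDeriv (0, y + (0 : ℝ) • v) v (Sum.inl i)) 0 :=
    ((coordL n m (Sum.inl i)).restrictScalars ℝ).hasFDerivAt.comp_hasDerivAt (0 : ℝ) h1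
  simp only [zero_smul, add_zero] at h2
  have hc : ∀ j : Fin n, HasDerivAt (fun t : ℝ => y (Sum.inl j) + t * v (Sum.inl j))
      (v (Sum.inl j)) 0 := fun j => by
    simpa using ((Complex.ofRealCLM.hasDerivAt (x := (0 : ℝ))).mul_const
      (v (Sum.inl j))).const_add (y (Sum.inl j))
  have hcc : ∀ j : Fin n, HasDerivAt (fun t : ℝ => starRingEnd ℂ (y (Sum.inl j) + t * v (Sum.inl j)))
      (starRingEnd ℂ (v (Sum.inl j))) 0 := fun j =>
    Complex.conjCLE.toContinuousLinearMap.hasFDerivAt.comp_hasDerivAt (0 : ℝ) (hc j)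
  have hi : ∀ j : Fin n, HasDerivAt (fun t : ℝ => (y (Sum.inl j) + t * v (Sum.inl j))⁻¹)
      (-(v (Sum.inl j)) / (y (Sum.inl j)) ^ 2) 0 := fun j => by
    simpa using (hc j).fun_inv (by simpa using hy0 j)
  have hic : ∀ j : Fin n, HasDerivAt
      (fun t : ℝ => (starRingEnd ℂ (y (Sum.inl j) + t * v (Sum.inl j)))⁻¹)
      (-(starRingEnd ℂ (v (Sum.inl j))) / (starRingEnd ℂ (y (Sum.inl j))) ^ 2) 0 := fun j => by
    simpa using (hcc j).fun_inv (by simpa using hy0 j)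
  have hS := HasDerivAt.fun_sum (u := Finset.univ) fun j (_ : j ∈ Finset.univ) => (hi j).mul (hic j)
  have hS0 : ∑ j : Fin n, (y (Sum.inl j) + ((0 : ℝ) : ℂ) * v (Sum.inl j))⁻¹ *
      (starRingEnd ℂ (y (Sum.inl j) + ((0 : ℝ) : ℂ) * v (Sum.inl j)))⁻¹ = n := by
    simp [hyc, hy0]
  have h3 := ((hasDerivAt_const (0 : ℝ) (n : ℂ)).div hS (by
    simp only [Pi.mul_apply]; rw [hS0]; exact hn')).mul (hic i)
  have heq : (fun t : ℝ => g.scaledField (0, y + t • v) (Sum.inl i)) =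
      fun t : ℝ => ((n : ℂ) / ∑ j : Fin n, (y (Sum.inl j) + t * v (Sum.inl j))⁻¹ *
        (starRingEnd ℂ (y (Sum.inl j) + t * v (Sum.inl j)))⁻¹) *
        (starRingEnd ℂ (y (Sum.inl i) + t * v (Sum.inl i)))⁻¹ := by
    funext t
    rw [g.scaledField_zero_inl hg]
    simp
  rw [heq] at h2
  rw [h2.unique h3]
  simp only [Pi.mul_apply, Pi.div_apply]
  rw [hS0]
  have hsum : ∑ j : Fin n, (-(v (Sum.inl j)) / (y (Sum.inl j)) ^ 2 *
      (starRingEnd ℂ (y (Sum.inl j) + ((0 : ℝ) : ℂ) * v (Sum.inl j)))⁻¹ +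
      (y (Sum.inl j) + ((0 : ℝ) : ℂ) * v (Sum.inl j))⁻¹ *
      (-(starRingEnd ℂ (v (Sum.inl j))) / (starRingEnd ℂ (y (Sum.inl j))) ^ 2)) =
      -((2 * ∑ j : Fin n, (v (Sum.inl j) * (y (Sum.inl j))⁻¹).re : ℝ) : ℂ) := by
    push_cast
    rw [Finset.mul_sum, ← Finset.sum_neg_distrib]
    refine Finset.sum_congr rfl fun j _ => ?_
    have h4 : (2 * ((v (Sum.inl j) * (y (Sum.inl j))⁻¹).re : ℂ)) =
        v (Sum.inl j) * (y (Sum.inl j))⁻¹ + starRingEnd ℂ (v (Sum.inl j) * (y (Sum.inl j))⁻¹) := by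
      rw [Complex.add_conj]; push_cast; rfl
    rw [h4]
    have := hy0 j
    simp only [zero_mul, add_zero, map_mul, map_inv₀, hyc]
    field_simp
    ring
  rw [hsum]
  have := hy0 i
  simp only [Complex.ofReal_zero, zero_mul, add_zero, map_mul, map_inv₀, hyc]
  push_cast
  field_simp
  ring

/-- With `ηⱼ = vⱼ / yⱼ` the derivative sends `ηᵢ` to `(2/n) ∑ Re ηⱼ - η̄ᵢ`. It fixes imaginary parts
and acts on real parts as twice the mean minus the identity, which is a reflection; so it is an
isometry in the first `n` coordinates, and it vanishes in the last `m` components. -/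
theorem norm_scaledFieldDeriv_le (hg : g.IsStandardAt 0) (hn : 1 ≤ n) {y : CSpace n m}
    (hy : y ∈ baseTorus n m) : ‖g.scaledFieldDeriv (0, y)‖ ≤ 1 := by
  have hn' : (n : ℝ) ≠ 0 := by exact_mod_cast (by omega : n ≠ 0)
  refine ContinuousLinearMap.opNorm_le_bound _ zero_le_one fun v => ?_
  rw [one_mul]
  refine le_of_sq_le_sq ?_ (norm_nonneg _)
  rw [norm_sq_eq_sum, norm_sq_eq_sum]
  have hinr : ∀ k : Fin m, g.scaledFieldDeriv (0, y) v (Sum.inr k) = 0 := by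
    intro k
    have hreg : ((0 : ℝ), y) ∈ regularSet n m := coord_ne_zero_of_mem_baseTorus hy
    have h1 := ((coordL n m (Sum.inr k)).restrictScalars ℝ).hasFDerivAt.comp y
      (g.hasFDerivAt_scaledField hn hreg)
    have h2 : (((coordL n m (Sum.inr k)).restrictScalars ℝ) ∘ fun y => g.scaledField (0, y)) =
        fun _ => (0 : ℂ) := by
      funext z; exact g.scaledField_zero_inr hg z k
    rw [h2] at h1
    have h3 := h1.unique (hasFDerivAt_const (0 : ℂ) y)
    exact congrArg (fun L => L v) h3
  simp only [hinr, g.scaledFieldDeriv_inl hg hn hy]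
  set η : Fin n → ℂ := fun j => v (Sum.inl j) * (y (Sum.inl j))⁻¹ with hη
  have hv : ∀ i : Fin n, ‖v (Sum.inl i)‖ ^ 2 = (η i).re ^ 2 + (η i).im ^ 2 := by
    intro i
    have h1 : ‖v (Sum.inl i)‖ = ‖η i‖ := by simp [hη, hy.1 i]
    rw [h1, Complex.sq_norm, Complex.normSq_apply]; ring
  set S : ℝ := ∑ j : Fin n, (η j).re with hS
  have hD : ∀ i : Fin n, ‖y (Sum.inl i) * (((2 / n * S : ℝ) : ℂ) - starRingEnd ℂ (η i))‖ ^ 2 =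
      (η i).re ^ 2 + (η i).im ^ 2 + ((2 / n * S) ^ 2 - 2 * (2 / n * S) * (η i).re) := by
    intro i
    rw [norm_mul, hy.1 i, one_mul, Complex.sq_norm, Complex.normSq_apply]
    simp
    ring
  have hsum : ∑ i : Fin n, ‖y (Sum.inl i) * (((2 / n * S : ℝ) : ℂ) - starRingEnd ℂ (η i))‖ ^ 2 =
      ∑ i : Fin n, ‖v (Sum.inl i)‖ ^ 2 := by
    simp only [hD, hv]
    rw [Finset.sum_add_distrib, Finset.sum_sub_distrib, ← Finset.mul_sum, ← hS]
    simp
    field_simp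
    ring
  have hk : 0 ≤ ∑ k : Fin m, ‖v (Sum.inr k)‖ ^ 2 := Finset.sum_nonneg fun _ _ => by positivity
  simp only [hη] at hsum
  rw [hsum]
  simpa using hk

theorem exists_norm_scaledField_sub_le (hn : 1 ≤ n) {K : Set (CSpace n m)} (hK : IsCompact K)
    (hK0 : ∀ y ∈ K, ∀ i : Fin n, y (Sum.inl i) ≠ 0) :
    ∃ C > 0, ∀ y ∈ K, ∀ σ ∈ Set.Icc (0 : ℝ) 1,
      ‖g.scaledField (σ, y) - g.scaledField (0, y)‖ ≤ C * σ := by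
  have hcomp : IsCompact (Set.Icc (0 : ℝ) 1 ×ˢ K) := isCompact_Icc.prod hK
  obtain ⟨C, hC⟩ := hcomp.exists_bound_of_continuousOn
    (f := fun q => fderiv ℝ g.scaledField q (1, 0))
    (((g.continuousOn_fderiv_scaledField hn).mono fun q hq => hK0 _ hq.2).clm_apply
      continuousOn_const)
  refine ⟨max C 1, by positivity, fun y hy σ hσ => ?_⟩
  have := (convex_Icc (0 : ℝ) 1).norm_image_sub_le_of_norm_hasDerivWithin_le
    (f := fun s => g.scaledField (s, y)) (f' := fun s => fderiv ℝ g.scaledField (s, y) (1, 0))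
    (C := max C 1) (x := 0) (y := σ)
    (fun s hs => (g.hasDerivAt_scaledField hn (hK0 y hy)).hasDerivWithinAt)
    (fun s hs => (hC (s, y) ⟨hs, hy⟩).trans (le_max_left _ _)) (by simp) hσ
  simpa [abs_of_nonneg hσ.1] using this

/-- The derivative has norm at most `1` over the compact torus at `σ = 0`, hence less than `3/2` on
a uniform neighbourhood. Any constant between `1` and `2` would serve; being below `2` is what the
later contraction requires. -/
theorem exists_lipschitz_scaledField (hg : g.IsStandardAt 0) (hn : 1 ≤ n) :
    ∃ ρ > 0, ρ ≤ 1 ∧ ∀ θ ∈ baseTorus n m, ∀ σ ∈ Set.Icc (0 : ℝ) ρ, ∀ y ∈ Metric.closedBall θ ρ,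
      (σ, y) ∈ regularSet n m ∧ ∀ y' ∈ Metric.closedBall θ ρ,
        ‖g.scaledField (σ, y) - g.scaledField (σ, y')‖ ≤ 3 / 2 * ‖y - y'‖ := by
  have hcont : ContinuousOn (fun q => ‖g.scaledFieldDeriv q‖) (regularSet n m) := by
    refine ContinuousOn.norm ?_
    exact (g.continuousOn_fderiv_scaledField hn).clm_comp continuousOn_const
  have hU : IsOpen (regularSet n m ∩ {q | ‖g.scaledFieldDeriv q‖ < 3 / 2}) :=
    hcont.isOpen_inter_preimage (isOpen_regularSet n m) isOpen_Iio
  have hsub : ({0} : Set ℝ) ×ˢ baseTorus n m ⊆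
      regularSet n m ∩ {q | ‖g.scaledFieldDeriv q‖ < 3 / 2} := by
    rintro ⟨s, y⟩ ⟨rfl, hy⟩
    refine ⟨coord_ne_zero_of_mem_baseTorus hy, ?_⟩
    exact (g.norm_scaledFieldDeriv_le hg hn hy).trans_lt (by norm_num)
  obtain ⟨ρ, hρ, hρU⟩ := (isCompact_singleton.prod isCompact_baseTorus).exists_cthickening_subset_open
    hU hsub
  have hmem : ∀ θ ∈ baseTorus n m, ∀ σ ∈ Set.Icc (0 : ℝ) (min ρ 1),
      ∀ y ∈ Metric.closedBall θ (min ρ 1),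
      (σ, y) ∈ regularSet n m ∩ {q | ‖g.scaledFieldDeriv q‖ < 3 / 2} := by
    intro θ hθ σ hσ y hy
    refine hρU (Metric.mem_cthickening_of_dist_le (σ, y) (0, θ) ρ _ ⟨rfl, hθ⟩ ?_)
    rw [Prod.dist_eq]
    refine max_le ?_ ((Metric.mem_closedBall.1 hy).trans (min_le_left _ _))
    simp only [Real.dist_eq, sub_zero, abs_of_nonneg hσ.1]
    exact hσ.2.trans (min_le_left _ _)
  refine ⟨min ρ 1, by positivity, min_le_right _ _, fun θ hθ σ hσ y hy =>
    ⟨(hmem θ hθ σ hσ y hy).1, fun y' hy' => ?_⟩⟩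
  exact (convex_closedBall θ (min ρ 1)).norm_image_sub_le_of_norm_hasFDerivWithin_le
    (f := fun y => g.scaledField (σ, y)) (f' := fun y => g.scaledFieldDeriv (σ, y))
    (fun z hz => (g.hasFDerivAt_scaledField hn (hmem θ hθ σ hσ z hz).1).hasFDerivWithinAt)
    (fun z hz => (hmem θ hθ σ hσ z hz).2.le) hy' hy

end HermitianMetric

/-! ### A singular equation solved as an averaged fixed-point problem. -/

section SingularODE

open Set MeasureTheory intervalIntegral
open scoped BoundedContinuousFunction

variable {E : Type*} [NormedAddCommGroup E] [NormedSpace ℝ E]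
  {Θ : Type*} [TopologicalSpace Θ] [FirstCountableTopology Θ]

/-- Averaged integral equation `h(σ) = ∫₀¹ u k(uσ, h(uσ)) du` with a parameter: existence of a
bounded solution which depends continuously on the parameter. -/
theorem exists_averaged_fixedPoint [CompleteSpace E] {k : Θ → ℝ → E → E} {σ₀ B : ℝ} (hB : 0 ≤ B)
    (hk : ContinuousOn (fun q : Θ × ℝ × E => k q.1 q.2.1 q.2.2)
      {q | q.2.1 ∈ Ioc 0 σ₀ ∧ ‖q.2.2‖ ≤ B})
    (hbound : ∀ θ, ∀ τ ∈ Ioc 0 σ₀, ∀ v, ‖v‖ ≤ B → ‖k θ τ v‖ ≤ 2 * B)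
    (hlip : ∀ θ, ∀ τ ∈ Ioc 0 σ₀, ∀ v w, ‖v‖ ≤ B → ‖w‖ ≤ B →
      ‖k θ τ v - k θ τ w‖ ≤ 3 / 2 * ‖v - w‖) :
    ∃ h : Θ → ℝ → E, ContinuousOn (fun q : Θ × ℝ => h q.1 q.2) (univ ×ˢ Ioc 0 σ₀) ∧
      ∀ θ, ∀ σ ∈ Ioc 0 σ₀, ‖h θ σ‖ ≤ B ∧
        h θ σ = ∫ u in (0 : ℝ)..1, u • k θ (u * σ) (h θ (u * σ)) := by
  classical
  -- The value `0` outside `(0, σ₀]` plays no role: for `σ` in this interval the integrand is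
  -- evaluated only at `uσ` with `0 < u ≤ 1`. The end `0` is left out because `k` is not assumed to
  -- extend there.
  let ext : ((Θ × Ioc 0 σ₀) →ᵇ E) → Θ → ℝ → E := fun f θ τ => if hτ : τ ∈ Ioc 0 σ₀ then f (θ, ⟨τ, hτ⟩) else 0
  have ext_mem : ∀ f θ τ (hτ : τ ∈ Ioc 0 σ₀), ext f θ τ = f (θ, ⟨τ, hτ⟩) :=
    fun f θ τ hτ => dif_pos hτ
  have ext_cont : ∀ f, ContinuousOn (fun q : Θ × ℝ => ext f q.1 q.2) (univ ×ˢ Ioc 0 σ₀) := by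
    intro f
    rw [continuousOn_iff_continuous_domRestrict]
    have : (univ ×ˢ Ioc 0 σ₀).domRestrict (fun q : Θ × ℝ => ext f q.1 q.2) =
        fun q : (univ ×ˢ Ioc 0 σ₀ : Set (Θ × ℝ)) => f (q.1.1, ⟨q.1.2, q.2.2⟩) := by
      funext q
      exact ext_mem f _ _ q.2.2
    rw [this]
    exact f.continuous.comp (by fun_prop)
  have ext_le : ∀ f, ‖f‖ ≤ B → ∀ θ τ, ‖ext f θ τ‖ ≤ B := by
    intro f hf θ τ
    by_cases hτ : τ ∈ Ioc 0 σ₀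
    · rw [ext_mem f θ τ hτ]; exact (f.norm_coe_le_norm _).trans hf
    · simp only [ext, dif_neg hτ, norm_zero]; exact hB
  let kf : ((Θ × Ioc 0 σ₀) →ᵇ E) → Θ → ℝ → E := fun f θ τ => k θ τ (ext f θ τ)
  have kf_cont : ∀ f, ‖f‖ ≤ B →
      ContinuousOn (fun q : Θ × ℝ => kf f q.1 q.2) (univ ×ˢ Ioc 0 σ₀) := by
    intro f hf
    refine hk.comp (f := fun q : Θ × ℝ => (q.1, q.2, ext f q.1 q.2)) ?_ ?_
    · exact continuousOn_fst.prodMk (continuousOn_snd.prodMk (ext_cont f))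
    · exact fun q hq => ⟨hq.2, ext_le f hf _ _⟩
  have mul_mem : ∀ {u σ : ℝ}, u ∈ Ioc (0 : ℝ) 1 → σ ∈ Ioc 0 σ₀ → u * σ ∈ Ioc 0 σ₀ := by
    intro u σ hu hσ
    exact ⟨mul_pos hu.1 hσ.1, by nlinarith [hu.1, hu.2, hσ.1, hσ.2]⟩
  have kf_norm : ∀ f, ‖f‖ ≤ B → ∀ θ, ∀ σ ∈ Ioc 0 σ₀, ∀ u ∈ Ioc (0 : ℝ) 1,
      ‖u • kf f θ (u * σ)‖ ≤ 2 * B * u := by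
    intro f hf θ σ hσ u hu
    rw [norm_smul, Real.norm_of_nonneg hu.1.le, mul_comm]
    exact mul_le_mul_of_nonneg_right (hbound θ _ (mul_mem hu hσ) _ (ext_le f hf _ _)) hu.1.le
  have kf_meas : ∀ f, ‖f‖ ≤ B → ∀ θ, ∀ σ ∈ Ioc 0 σ₀,
      ContinuousOn (fun u => u • kf f θ (u * σ)) (Ioc 0 1) := by
    intro f hf θ σ hσ
    refine continuousOn_id.smul ?_
    exact (kf_cont f hf).comp (f := fun u : ℝ => (θ, u * σ)) (by fun_prop)
      fun u hu => ⟨mem_univ _, mul_mem hu hσ⟩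
  have kf_aesm : ∀ f, ‖f‖ ≤ B → ∀ θ, ∀ σ ∈ Ioc 0 σ₀,
      AEStronglyMeasurable (fun u => u • kf f θ (u * σ)) (volume.restrict (uIoc (0 : ℝ) 1)) := by
    intro f hf θ σ hσ
    rw [uIoc_of_le zero_le_one]
    exact (kf_meas f hf θ σ hσ).aestronglyMeasurable measurableSet_Ioc
  have kf_int : ∀ f, ‖f‖ ≤ B → ∀ θ, ∀ σ ∈ Ioc 0 σ₀,
      IntervalIntegrable (fun u => u • kf f θ (u * σ)) volume 0 1 := by
    intro f hf θ σ hσ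
    refine IntervalIntegrable.mono_fun' (g := fun u => 2 * B * u)
      (Continuous.intervalIntegrable (by fun_prop) _ _) (kf_aesm f hf θ σ hσ) ?_
    rw [uIoc_of_le zero_le_one]
    exact (ae_restrict_iff' measurableSet_Ioc).2 (ae_of_all _ fun u hu => kf_norm f hf θ σ hσ u hu)
  -- The weight `u` has integral `1/2`. It brings the bound `2B` on `k` back to `B`, so the ball is
  -- preserved, and turns the Lipschitz constant `3/2` into the contraction factor `3/4`. Working
  -- with bounded continuous functions of `(θ, σ)` jointly gives continuity in the parameter at no
  -- extra cost.
  have hT : ∀ f : Metric.closedBall (0 : (Θ × Ioc 0 σ₀) →ᵇ E) B, ∃ f' : Metric.closedBall (0 : (Θ × Ioc 0 σ₀) →ᵇ E) B,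
      ∀ q : Θ × Ioc 0 σ₀, (f' : (Θ × Ioc 0 σ₀) →ᵇ E) q = ∫ u in (0 : ℝ)..1, u • kf f q.1 (u * q.2) := by
    rintro ⟨f, hf⟩
    rw [mem_closedBall_zero_iff] at hf
    have hc : Continuous fun q : Θ × Ioc 0 σ₀ => ∫ u in (0 : ℝ)..1, u • kf f q.1 (u * q.2) := by
      refine continuous_of_dominated_interval (bound := fun u => 2 * B * u)
        (fun q => kf_aesm f hf q.1 q.2 q.2.2) (fun q => ae_of_all _ fun u hu => ?_)
        (Continuous.intervalIntegrable (by fun_prop) _ _) (ae_of_all _ fun u hu => ?_)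
      · rw [uIoc_of_le zero_le_one] at hu
        exact kf_norm f hf q.1 q.2 q.2.2 u hu
      · rw [uIoc_of_le zero_le_one] at hu
        refine continuous_const.smul ?_
        exact (kf_cont f hf).comp_continuous (f := fun q : Θ × Ioc 0 σ₀ => (q.1, u * (q.2 : ℝ)))
          (by fun_prop) fun q => ⟨mem_univ _, mul_mem hu q.2.2⟩
    have hb : ∀ q : Θ × Ioc 0 σ₀, ‖∫ u in (0 : ℝ)..1, u • kf f q.1 (u * q.2)‖ ≤ B := by
      intro q
      refine (norm_integral_le_of_norm_le zero_le_one (g := fun u => 2 * B * u)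
        (ae_of_all _ fun u hu => kf_norm f hf q.1 q.2 q.2.2 u hu)
        (Continuous.intervalIntegrable (by fun_prop) _ _)).trans ?_
      rw [intervalIntegral.integral_const_mul, integral_id]
      linarith
    refine ⟨⟨BoundedContinuousFunction.ofNormedAddCommGroup _ hc B hb, ?_⟩, fun q => rfl⟩
    rw [mem_closedBall_zero_iff]
    exact BoundedContinuousFunction.norm_ofNormedAddCommGroup_le _ hB hb
  choose T hT using hT
  have hcontr : ContractingWith (3 / 4) T := by
    refine ⟨by rw [div_lt_one] <;> norm_num, LipschitzWith.of_dist_le_mul fun f f' => ?_⟩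
    have hf := mem_closedBall_zero_iff.1 f.2
    have hf' := mem_closedBall_zero_iff.1 f'.2
    rw [Subtype.dist_eq, Subtype.dist_eq]
    refine (BoundedContinuousFunction.dist_le (by positivity)).2 fun q => ?_
    rw [hT, hT, dist_eq_norm, ← intervalIntegral.integral_sub (kf_int f hf q.1 q.2 q.2.2)
      (kf_int f' hf' q.1 q.2 q.2.2)]
    refine (norm_integral_le_of_norm_le zero_le_one
      (g := fun u => 3 / 2 * dist (f : (Θ × Ioc 0 σ₀) →ᵇ E) f' * u) (ae_of_all _ fun u hu => ?_)
      (Continuous.intervalIntegrable (by fun_prop) _ _)).trans ?_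
    · have hm := mul_mem hu q.2.2
      rw [← smul_sub, norm_smul, Real.norm_of_nonneg hu.1.le, mul_comm]
      refine mul_le_mul_of_nonneg_right ?_ hu.1.le
      refine (hlip q.1 _ hm _ _ (ext_le f hf _ _) (ext_le f' hf' _ _)).trans ?_
      refine mul_le_mul_of_nonneg_left ?_ (by norm_num)
      rw [ext_mem _ _ _ hm, ext_mem _ _ _ hm, ← dist_eq_norm]
      exact BoundedContinuousFunction.dist_coe_le_dist _
    · rw [intervalIntegral.integral_const_mul, integral_id]
      push_cast
      linarith
  have : CompleteSpace (Metric.closedBall (0 : (Θ × Ioc 0 σ₀) →ᵇ E) B) :=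
    Metric.isClosed_closedBall.completeSpace_coe
  have : Nonempty (Metric.closedBall (0 : (Θ × Ioc 0 σ₀) →ᵇ E) B) := ⟨⟨0, by simpa using hB⟩⟩
  obtain ⟨f, hfT⟩ : ∃ f, T f = f := ⟨_, hcontr.fixedPoint_isFixedPt⟩
  refine ⟨ext f, ext_cont f, fun θ σ hσ => ⟨ext_le f (mem_closedBall_zero_iff.1 f.2) _ _, ?_⟩⟩
  have h1 := hT f (θ, ⟨σ, hσ⟩)
  rw [hfT] at h1
  rw [ext_mem _ _ _ hσ]
  exact h1

/-- A solution of the averaged integral equation gives a solution of `(σ² h)' = σ k(σ)`. -/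
theorem hasDerivAt_sq_smul_of_averaged [CompleteSpace E] {k h : ℝ → E} {σ₀ M : ℝ} (hk : ContinuousOn k (Ioc 0 σ₀))
    (hM : ∀ τ ∈ Ioc 0 σ₀, ‖k τ‖ ≤ M)
    (hh : ∀ σ ∈ Ioc 0 σ₀, h σ = ∫ u in (0 : ℝ)..1, u • k (u * σ)) {σ : ℝ} (hσ : σ ∈ Ioo 0 σ₀) :
    HasDerivAt (fun s => s ^ 2 • h s) (σ • k σ) σ := by
  have hc : ContinuousOn (fun τ => τ • k τ) (Ioc 0 σ₀) := continuousOn_id.smul hk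
  -- The substitution `τ = u s` turns the average into an ordinary integral with variable upper end.
  have heq : ∀ s ∈ Ioc 0 σ₀, s ^ 2 • h s = ∫ τ in (0 : ℝ)..s, τ • k τ := by
    intro s hs
    have h2 := intervalIntegral.smul_integral_comp_mul_right (a := 0) (b := 1) (fun τ => τ • k τ) s
    simp only [zero_mul, one_mul] at h2
    rw [← h2, hh s hs, pow_two, mul_smul]
    congr 1
    rw [← intervalIntegral.integral_smul]
    congr 1
    funext u
    rw [smul_smul, mul_comm]
  have hint : IntervalIntegrable (fun τ => τ • k τ) volume 0 σ := by
    refine IntervalIntegrable.mono_fun' (g := fun u => u * M)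
      (Continuous.intervalIntegrable (by fun_prop) _ _) ?_ ?_
    · rw [uIoc_of_le hσ.1.le]
      exact (hc.mono (Ioc_subset_Ioc_right hσ.2.le)).aestronglyMeasurable measurableSet_Ioc
    · rw [uIoc_of_le hσ.1.le]
      refine (ae_restrict_iff' measurableSet_Ioc).2 (ae_of_all _ fun u hu => ?_)
      simp only
      rw [norm_smul, Real.norm_of_nonneg hu.1.le]
      exact mul_le_mul_of_nonneg_left (hM u ⟨hu.1, hu.2.trans hσ.2.le⟩) hu.1.le
  have hnhds : Ioo 0 σ₀ ∈ 𝓝 σ := Ioo_mem_nhds hσ.1 hσ.2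
  have hd := intervalIntegral.integral_hasDerivAt_right hint
    (ContinuousOn.stronglyMeasurableAtFilter isOpen_Ioo (hc.mono Ioo_subset_Ioc_self) σ hσ)
    ((hc.mono Ioo_subset_Ioc_self).continuousAt hnhds)
  refine hd.congr_of_eventuallyEq ?_
  filter_upwards [hnhds] with s hs
  exact heq s (Ioo_subset_Ioc_self hs)

end SingularODE

/-! ### Local curves starting in every direction of the torus. -/

namespace HermitianMetric

open Set

variable {n m : ℕ} (g : HermitianMetric n m)

/-- The family of solutions of `x' = W(σ, x / σ)` which start at the origin in the directions
`θ` of the base torus. -/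
theorem exists_local_family (hg : g.IsStandardAt 0) (hn : 1 ≤ n) :
    ∃ σ₀ > 0, ∃ B ≥ 0, ∃ x : CSpace n m → ℝ → CSpace n m,
      ContinuousOn (fun q : CSpace n m × ℝ => x q.1 q.2) (baseTorus n m ×ˢ Ioc 0 σ₀) ∧
      (∀ θ ∈ baseTorus n m, ∀ σ ∈ Ioc 0 σ₀, ‖x θ σ - σ • θ‖ ≤ B * σ ^ 2) ∧
      ∀ θ ∈ baseTorus n m, ∀ σ ∈ Ioo 0 σ₀, (∀ i : Fin n, x θ σ (Sum.inl i) ≠ 0) ∧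
        HasDerivAt (x θ) (g.scaledField (σ, σ⁻¹ • x θ σ)) σ := by
  classical
  obtain ⟨ρ, hρ, hρ1, hlip⟩ := g.exists_lipschitz_scaledField hg hn
  obtain ⟨C, hC, hCK⟩ := g.exists_norm_scaledField_sub_le hn isCompact_baseTorus
    fun y hy => coord_ne_zero_of_mem_baseTorus hy
  -- At `v = 0` the function `k` below is bounded by `C`, and its Lipschitz constant adds at most
  -- `3/2 B`; the required `C + 3/2 B ≤ 2B` holds for `B = 2C`. The choice `σ₀ ≤ ρ / B` keeps `θ + τ
  -- v` in the ball where the Lipschitz estimate is valid.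
  set B : ℝ := 2 * C with hBdef
  have hB : 0 < B := by positivity
  set σ₀ : ℝ := min ρ (ρ / B) with hσ₀
  have hσ₀pos : 0 < σ₀ := by positivity
  have hball : ∀ θ : CSpace n m, ∀ τ ∈ Ioc 0 σ₀, ∀ v : CSpace n m, ‖v‖ ≤ B →
      θ + τ • v ∈ Metric.closedBall θ ρ := by
    intro θ τ hτ v hv
    rw [mem_closedBall_iff_norm, add_sub_cancel_left, norm_smul, Real.norm_of_nonneg hτ.1.le]
    calc τ * ‖v‖ ≤ (ρ / B) * B := by
          gcongr
          exact hτ.2.trans (min_le_right _ _)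
      _ = ρ := by field_simp
  have hτρ : ∀ τ ∈ Ioc 0 σ₀, τ ∈ Icc 0 ρ := fun τ hτ => ⟨hτ.1.le, hτ.2.trans (min_le_left _ _)⟩
  -- For `x = σ θ + σ² h` the equation `x' = W(σ, x / σ)` becomes `(σ² h)' = W(σ, θ + σ h) - θ = σ
  -- k(σ, h)`. Boundedness of `k` despite the factor `τ⁻¹` comes from `W(0, θ) = θ`.
  let k : baseTorus n m → ℝ → CSpace n m → CSpace n m := fun θ τ v =>
    τ⁻¹ • (g.scaledField (τ, θ + τ • v) - θ)
  have hkl : ∀ θ, ∀ τ ∈ Ioc 0 σ₀, ∀ v w, ‖v‖ ≤ B → ‖w‖ ≤ B →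
      ‖k θ τ v - k θ τ w‖ ≤ 3 / 2 * ‖v - w‖ := by
    intro θ τ hτ v w hv hw
    have h1 := (hlip θ θ.2 τ (hτρ τ hτ) _ (hball θ τ hτ v hv)).2 _ (hball θ τ hτ w hw)
    rw [add_sub_add_left_eq_sub, ← smul_sub, norm_smul, Real.norm_of_nonneg hτ.1.le] at h1
    simp only [k]
    rw [← smul_sub, sub_sub_sub_cancel_right, norm_smul, norm_inv, Real.norm_of_nonneg hτ.1.le]
    rw [inv_mul_le_iff₀ hτ.1]
    linarith
  have hkb : ∀ θ, ∀ τ ∈ Ioc 0 σ₀, ∀ v, ‖v‖ ≤ B → ‖k θ τ v‖ ≤ 2 * B := by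
    intro θ τ hτ v hv
    have h1 := hkl θ τ hτ v 0 hv (by simpa using hB.le)
    have h2 : ‖k θ τ 0‖ ≤ C := by
      have := hCK θ θ.2 τ ⟨hτ.1.le, (hτρ τ hτ).2.trans hρ1⟩
      rw [g.scaledField_zero_of_mem_baseTorus hg hn θ.2] at this
      simp only [k, smul_zero, add_zero]
      rw [norm_smul, norm_inv, Real.norm_of_nonneg hτ.1.le, inv_mul_le_iff₀ hτ.1]
      linarith
    have h3 := norm_le_norm_add_norm_sub' (k θ τ v) (k θ τ 0)
    rw [sub_zero] at h1
    linarith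
  have hkc : ContinuousOn (fun q : baseTorus n m × ℝ × CSpace n m => k q.1 q.2.1 q.2.2)
      {q | q.2.1 ∈ Ioc 0 σ₀ ∧ ‖q.2.2‖ ≤ B} := by
    refine ContinuousOn.smul (ContinuousOn.inv₀ (f := fun q : baseTorus n m × ℝ × CSpace n m => q.2.1) (by fun_prop)
      fun q hq => hq.1.1.ne') ?_
    refine ContinuousOn.sub ?_ (by fun_prop)
    refine (g.contDiffOn_scaledField hn).continuousOn.comp
      (f := fun q : baseTorus n m × ℝ × CSpace n m =>
        (q.2.1, (q.1 : CSpace n m) + q.2.1 • q.2.2)) (by fun_prop) fun q hq => ?_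
    exact (hlip q.1 q.1.2 q.2.1 (hτρ _ hq.1) _ (hball q.1 _ hq.1 _ hq.2)).1
  obtain ⟨h, hhc, hh⟩ := exists_averaged_fixedPoint hB.le hkc hkb hkl
  let x : CSpace n m → ℝ → CSpace n m := fun θ σ =>
    if hθ : θ ∈ baseTorus n m then σ • θ + σ ^ 2 • h ⟨θ, hθ⟩ σ else 0
  have hx : ∀ (θ : baseTorus n m) σ, x θ σ = σ • (θ : CSpace n m) + σ ^ 2 • h θ σ :=
    fun θ σ => dif_pos θ.2
  refine ⟨σ₀, hσ₀pos, B, hB.le, x, ?_, ?_, ?_⟩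
  · rw [continuousOn_iff_continuous_domRestrict]
    have heq : (baseTorus n m ×ˢ Ioc 0 σ₀).domRestrict (fun q : CSpace n m × ℝ => x q.1 q.2) =
        fun q : (baseTorus n m ×ˢ Ioc 0 σ₀ : Set (CSpace n m × ℝ)) =>
          q.1.2 • q.1.1 + q.1.2 ^ 2 • h ⟨q.1.1, q.2.1⟩ q.1.2 := by
      funext q
      exact hx ⟨q.1.1, q.2.1⟩ q.1.2
    rw [heq]
    have h1 : Continuous fun q : (baseTorus n m ×ˢ Ioc 0 σ₀ : Set (CSpace n m × ℝ)) =>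
        h ⟨q.1.1, q.2.1⟩ q.1.2 :=
      hhc.comp_continuous (f := fun q : (baseTorus n m ×ˢ Ioc 0 σ₀ : Set (CSpace n m × ℝ)) =>
        ((⟨q.1.1, q.2.1⟩ : baseTorus n m), q.1.2)) (by fun_prop) fun q => ⟨mem_univ _, q.2.2⟩
    exact ((by fun_prop : Continuous fun q : (baseTorus n m ×ˢ Ioc 0 σ₀ : Set (CSpace n m × ℝ)) =>
      q.1.2 • q.1.1)).add ((continuous_subtype_val.snd.pow 2).smul h1)
  · intro θ hθ σ hσ
    rw [hx ⟨θ, hθ⟩, add_sub_cancel_left, norm_smul, norm_pow, Real.norm_of_nonneg hσ.1.le, mul_comm]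
    exact mul_le_mul_of_nonneg_right (hh _ σ hσ).1 (by positivity)
  · intro θ hθ σ hσ
    have hσ' := Ioo_subset_Ioc_self hσ
    have hy : σ⁻¹ • x θ σ = θ + σ • h ⟨θ, hθ⟩ σ := by
      rw [hx ⟨θ, hθ⟩, smul_add, smul_smul, smul_smul, inv_mul_cancel₀ hσ.1.ne', one_smul]
      congr 2
      field_simp [hσ.1.ne']
    have hreg : (σ, θ + σ • h ⟨θ, hθ⟩ σ) ∈ regularSet n m :=
      (hlip θ hθ σ (hτρ _ hσ') _ (hball θ _ hσ' _ (hh ⟨θ, hθ⟩ σ hσ').1)).1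
    constructor
    · intro i h0
      apply hreg i
      simp only
      rw [← hy]
      simp [h0]
    · have hcont : ContinuousOn (fun τ => k ⟨θ, hθ⟩ τ (h ⟨θ, hθ⟩ τ)) (Ioc 0 σ₀) := by
        refine hkc.comp (f := fun τ => ((⟨θ, hθ⟩ : baseTorus n m), τ, h ⟨θ, hθ⟩ τ)) ?_ ?_
        · refine continuousOn_const.prodMk (continuousOn_id.prodMk ?_)
          exact hhc.comp (f := fun τ => ((⟨θ, hθ⟩ : baseTorus n m), τ)) (by fun_prop)
            fun τ hτ => ⟨mem_univ _, hτ⟩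
        · exact fun τ hτ => ⟨hτ, (hh _ τ hτ).1⟩
      have hd := hasDerivAt_sq_smul_of_averaged hcont
        (fun τ hτ => hkb _ τ hτ _ (hh _ τ hτ).1) (fun s hs => (hh ⟨θ, hθ⟩ s hs).2) hσ
      have hd2 := ((hasDerivAt_id σ).smul_const θ).add hd
      rw [hy]
      have hfun : x θ = (fun y => id y • θ) + fun s => s ^ 2 • h ⟨θ, hθ⟩ s := by
        funext s; exact hx ⟨θ, hθ⟩ s
      rw [hfun]
      have hval : (1 : ℝ) • θ + σ • k ⟨θ, hθ⟩ σ (h ⟨θ, hθ⟩ σ) =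
          g.scaledField (σ, θ + σ • h ⟨θ, hθ⟩ σ) := by
        simp only [k]
        rw [smul_smul, mul_inv_cancel₀ hσ.1.ne', one_smul, one_smul, add_sub_cancel]
      rw [← hval]
      exact hd2

end HermitianMetric

/-! ### Estimates on intervals with a singular left end. -/

section Calculus

open Set

/-- The mean value inequality on `[ε, σ]`, followed by `ε → 0`; the equation gives no derivative at
`0` itself. -/
theorem norm_le_of_norm_deriv_le_of_tendsto_zero {F : Type*} [NormedAddCommGroup F]
    [NormedSpace ℝ F] {f f' : ℝ → F} {b b' : ℝ → ℝ} {δ : ℝ}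
    (hf : ∀ s ∈ Ioo 0 δ, HasDerivAt f (f' s) s) (hb : ∀ s ∈ Ioo 0 δ, HasDerivAt b (b' s) s)
    (hle : ∀ s ∈ Ioo 0 δ, ‖f' s‖ ≤ b' s) (hf0 : Tendsto f (𝓝[>] 0) (𝓝 0))
    (hb0 : Tendsto b (𝓝[>] 0) (𝓝 0)) {σ : ℝ} (hσ : σ ∈ Ioo 0 δ) : ‖f σ‖ ≤ b σ := by
  have key : ∀ ε ∈ Ioo 0 σ, ‖f σ‖ ≤ ‖f ε‖ + (b σ - b ε) := by
    intro ε hε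
    have hsub : Icc ε σ ⊆ Ioo 0 δ := fun s hs => ⟨hε.1.trans_le hs.1, hs.2.trans_lt hσ.2⟩
    exact image_norm_le_of_norm_deriv_right_le_deriv_boundary' (f' := f') (a := ε) (b := σ)
      (B := fun s => ‖f ε‖ + (b s - b ε)) (B' := b')
      (fun s hs => (hf s (hsub hs)).continuousAt.continuousWithinAt)
      (fun s hs => (hf s (hsub (Ico_subset_Icc_self hs))).hasDerivWithinAt) (by simp)
      (fun s hs => ((((hb s (hsub hs)).sub_const (b ε)).const_add
        ‖f ε‖).continuousAt.continuousWithinAt))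
      (fun s hs => ((((hb s (hsub (Ico_subset_Icc_self hs))).sub_const (b ε)).const_add
        ‖f ε‖)).hasDerivWithinAt)
      (fun s hs => hle s (hsub (Ico_subset_Icc_self hs))) (right_mem_Icc.2 hε.2.le)
  have hlim : Tendsto (fun ε => ‖f ε‖ + (b σ - b ε)) (𝓝[>] 0) (𝓝 (‖(0 : F)‖ + (b σ - 0))) :=
    hf0.norm.add (tendsto_const_nhds.sub hb0)
  rw [norm_zero, zero_add, sub_zero] at hlim
  exact ge_of_tendsto hlim (by filter_upwards [Ioo_mem_nhdsGT hσ.1] with ε hε using key ε hε)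

theorem tendsto_zero_of_norm_le_mul {F : Type*} [NormedAddCommGroup F] {f : ℝ → F} {C δ : ℝ}
    (hδ : 0 < δ) (h : ∀ σ ∈ Ioo 0 δ, ‖f σ‖ ≤ C * σ) : Tendsto f (𝓝[>] 0) (𝓝 0) := by
  refine squeeze_zero_norm' (a := fun σ => C * σ)
    (by filter_upwards [Ioo_mem_nhdsGT hδ] with σ hσ using h σ hσ) ?_
  have : Tendsto (fun σ : ℝ => C * σ) (𝓝 0) (𝓝 (C * 0)) := by
    exact (continuous_const.mul continuous_id).tendsto 0
  rw [mul_zero] at this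
  exact this.mono_left nhdsWithin_le_nhds

end Calculus

section Euclidean

variable {n m : ℕ}

theorem norm_le_sum_norm_coord (v : CSpace n m) : ‖v‖ ≤ ∑ k, ‖v k‖ := by
  refine le_of_sq_le_sq ?_ (Finset.sum_nonneg fun _ _ => norm_nonneg _)
  rw [EuclideanSpace.norm_sq_eq]
  exact Finset.sum_sq_le_sq_sum_of_nonneg fun _ _ => norm_nonneg _

theorem coord_ne_zero_of_coordProd_ne_zero {y : CSpace n m} (hy : coordProd n m y ≠ 0)
    (i : Fin n) : y (Sum.inl i) ≠ 0 := fun h => hy (Finset.prod_eq_zero (Finset.mem_univ i) h)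

theorem coordProd_smul (c : ℝ) (y : CSpace n m) :
    coordProd n m (c • y) = (c : ℂ) ^ n * coordProd n m y := by
  simp [coordProd, Finset.prod_mul_distrib]

/-- Since `∏ |yᵢ| = 1`, some `|yᵢ|` is at most `1`. The vector with only entry `yᵢ` in place `i`
then has norm at most `1`, and the covector takes the value `1` on it. -/
theorem one_le_norm_logCovector (hn : 1 ≤ n) {y : CSpace n m} (hy : coordProd n m y = 1) :
    1 ≤ ‖logCovector y‖ := by
  have hy0 := coord_ne_zero_of_coordProd_ne_zero (by rw [hy]; exact one_ne_zero)
  obtain ⟨i, hi⟩ : ∃ i : Fin n, ‖y (Sum.inl i)‖ ≤ 1 := by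
    by_contra! h
    have h1 : ∏ i : Fin n, ‖y (Sum.inl i)‖ = 1 := by
      rw [← norm_prod]; change ‖coordProd n m y‖ = 1; rw [hy, norm_one]
    have h2 : (1 : ℝ) < ∏ i : Fin n, ‖y (Sum.inl i)‖ := by
      have : Nonempty (Fin n) := ⟨⟨0, hn⟩⟩
      calc (1 : ℝ) = ∏ i : Fin n, 1 := by simp
        _ < _ := Finset.prod_lt_prod_of_nonempty (fun _ _ => one_pos) (fun i _ => h i)
          Finset.univ_nonempty
    linarith
  have h1 := (logCovector y).le_opNorm (EuclideanSpace.single (Sum.inl i) (y (Sum.inl i)))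
  have h2 : logCovector y (EuclideanSpace.single (Sum.inl i) (y (Sum.inl i))) = 1 := by
    rw [logCovector_apply, Finset.sum_eq_single i]
    · simp [hy0 i]
    · intro b _ hb
      simp [hb]
    · simp
  rw [h2, norm_one, PiLp.norm_single] at h1
  nlinarith [norm_nonneg (logCovector y), norm_nonneg (y (Sum.inl i))]

end Euclidean

/-! ### Solution curves in terms of the parameter `σ`. -/

namespace HermitianMetric

open Set

variable {n m : ℕ} (g : HermitianMetric n m)

/-- A solution of `∇f / |∇f|²` on which `s = σⁿ`, in terms of the parameter `σ`. -/
def IsScaledCurve (δ : ℝ) (x : ℝ → CSpace n m) : Prop :=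
  ∀ σ ∈ Ioo 0 δ, coordProd n m (x σ) = (σ : ℂ) ^ n ∧
    HasDerivAt x (g.scaledField (σ, σ⁻¹ • x σ)) σ

variable {g}

theorem IsScaledCurve.mono {δ δ' : ℝ} {x : ℝ → CSpace n m} (h : g.IsScaledCurve δ x)
    (hle : δ' ≤ δ) : g.IsScaledCurve δ' x := fun σ hσ => h σ ⟨hσ.1, hσ.2.trans_le hle⟩

theorem IsScaledCurve.coordProd_inv_smul {δ : ℝ} {x : ℝ → CSpace n m} (h : g.IsScaledCurve δ x)
    {σ : ℝ} (hσ : σ ∈ Ioo 0 δ) : coordProd n m (σ⁻¹ • x σ) = 1 := by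
  have : (σ : ℂ) ≠ 0 := by exact_mod_cast hσ.1.ne'
  rw [coordProd_smul, (h σ hσ).1]
  push_cast
  rw [← mul_pow, inv_mul_cancel₀ this, one_pow]

theorem smul_inv_smul_self {σ : ℝ} (hσ : 0 < σ) (x : CSpace n m) : σ • σ⁻¹ • x = x :=
  smul_inv_smul₀ hσ.ne' x

theorem IsScaledCurve.scaledField_eq {δ : ℝ} {x : ℝ → CSpace n m} (h : g.IsScaledCurve δ x)
    (hn : 1 ≤ n) {σ : ℝ} (hσ : σ ∈ Ioo 0 δ) :
    g.scaledField (σ, σ⁻¹ • x σ) = ((n : ℝ) * σ ^ (n - 1)) • g.field (reProd n m) (x σ) := by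
  rw [g.scaledField_eq hσ.1 (h.coordProd_inv_smul hσ) hn, smul_inv_smul_self hσ.1]

theorem IsScaledCurve.fderiv_ne_zero {δ : ℝ} {x : ℝ → CSpace n m} (h : g.IsScaledCurve δ x)
    (hn : 1 ≤ n) {σ : ℝ} (hσ : σ ∈ Ioo 0 δ) : fderiv ℝ (reProd n m) (x σ) ≠ 0 := by
  have h1 := h.coordProd_inv_smul hσ
  rw [← smul_inv_smul_self hσ.1 (x σ), fderiv_reProd_eq_logCovector hσ.1 h1 hn]
  exact smul_ne_zero (pow_ne_zero _ hσ.1.ne') (logCovector_ne_zero hn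
    (coord_ne_zero_of_coordProd_ne_zero (by rw [h1]; exact one_ne_zero)))

/-- Curves of the scaled equation which start in a direction of the base torus satisfy
`s = σⁿ`. -/
theorem isScaledCurve_of_hasDerivAt (hn : 1 ≤ n) {δ B : ℝ} {x : ℝ → CSpace n m} {θ : CSpace n m}
    (hθ : θ ∈ baseTorus n m) (hB : ∀ σ ∈ Ioo 0 δ, ‖x σ - σ • θ‖ ≤ B * σ ^ 2)
    (hx : ∀ σ ∈ Ioo 0 δ, (∀ i : Fin n, x σ (Sum.inl i) ≠ 0) ∧
      HasDerivAt x (g.scaledField (σ, σ⁻¹ • x σ)) σ) : g.IsScaledCurve δ x := by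
  intro σ hσ
  refine ⟨?_, (hx σ hσ).2⟩
  have hδ : 0 < δ := hσ.1.trans hσ.2
  -- The quotient `s / σⁿ` has derivative zero by `sum_scaledField`, and it tends to `∏ θᵢ = 1` at
  -- the origin.
  set P : ℝ → ℂ := fun s => coordProd n m (x s) * ((s : ℂ) ^ n)⁻¹ with hP
  have hder : ∀ s ∈ Ioo 0 δ, HasDerivAt P 0 s := by
    intro s hs
    have hs0 : (s : ℂ) ≠ 0 := by exact_mod_cast hs.1.ne'
    have hxs := (hx s hs).1
    have h1 : HasDerivAt (fun s => coordProd n m (x s))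
        (coordProdDeriv (x s) (g.scaledField (s, s⁻¹ • x s))) s :=
      ((hasFDerivAt_coordProd (x s)).restrictScalars ℝ).comp_hasDerivAt s (hx s hs).2
    have hsum := g.sum_scaledField hn (σ := s) (y := s⁻¹ • x s) (fun i => by
      simp [hs.1.ne', hxs i])
    have h2 : coordProdDeriv (x s) (g.scaledField (s, s⁻¹ • x s)) =
        coordProd n m (x s) * (n * (s : ℂ)⁻¹) := by
      rw [coordProdDeriv_eq_of_ne hxs, ← hsum, Finset.sum_mul]
      congr 1
      refine Finset.sum_congr rfl fun i _ => ?_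
      simp only [PiLp.smul_apply, Complex.real_smul, Complex.ofReal_inv, mul_inv, inv_inv]
      field_simp
    have h3 : HasDerivAt (fun s : ℝ => (s : ℂ) ^ n) (n * (s : ℂ) ^ (n - 1)) s := by
      simpa using (Complex.ofRealCLM.hasDerivAt (x := s)).fun_pow n
    have h4 := h1.mul (h3.fun_inv (pow_ne_zero n hs0))
    rw [h2] at h4
    have h5 : coordProd n m (x s) * (n * (s : ℂ)⁻¹) * ((s : ℂ) ^ n)⁻¹ +
        coordProd n m (x s) * (-(n * (s : ℂ) ^ (n - 1)) / ((s : ℂ) ^ n) ^ 2) = 0 := by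
      obtain ⟨k, rfl⟩ := Nat.exists_eq_add_of_le' hn
      rw [Nat.add_sub_cancel]
      field_simp
      push_cast
      ring
    rw [h5] at h4
    exact h4
  have hlim : Tendsto P (𝓝[>] 0) (𝓝 1) := by
    have h1 : Tendsto (fun s => s⁻¹ • x s) (𝓝[>] 0) (𝓝 θ) := by
      rw [tendsto_iff_norm_sub_tendsto_zero]
      have := tendsto_zero_of_norm_le_mul (f := fun s => s⁻¹ • x s - θ) (C := B) hδ fun s hs => by
        have hs1 : s⁻¹ • x s - θ = s⁻¹ • (x s - s • θ) := by
          rw [smul_sub, inv_smul_smul₀ hs.1.ne']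
        rw [hs1, norm_smul, norm_inv, Real.norm_of_nonneg hs.1.le, inv_mul_le_iff₀ hs.1]
        have := hB s hs
        nlinarith
      simpa using this.norm
    have h2 := (continuous_coordProd.tendsto θ).comp h1
    rw [hθ.2.1] at h2
    refine h2.congr' ?_
    filter_upwards [self_mem_nhdsWithin] with s hs
    simp only [Function.comp, hP, coordProd_smul]
    push_cast
    rw [inv_pow, mul_comm]
  have hconst : ∀ s ∈ Ioo 0 δ, P s = P σ := by
    intro s hs
    refine isOpen_Ioo.is_const_of_deriv_eq_zero isPreconnected_Ioo
      (fun u hu => (hder u hu).differentiableAt.differentiableWithinAt)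
      (fun u hu => (hder u hu).deriv) hs hσ
  have h1 : P σ = 1 := by
    refine tendsto_nhds_unique (tendsto_const_nhds.congr' ?_) hlim
    filter_upwards [Ioo_mem_nhdsGT hδ] with s hs using (hconst s hs).symm
  have hs0 : (σ : ℂ) ^ n ≠ 0 := pow_ne_zero _ (by exact_mod_cast hσ.1.ne')
  simp only [hP] at h1
  rwa [← div_eq_mul_inv, div_eq_one_iff_eq hs0] at h1

/-- In terms of the parameter `t = σⁿ`, scaled curves are solutions of `∇f / |∇f|²`. -/
theorem IsScaledCurve.hasDerivAt_comp_root {δ : ℝ} {x : ℝ → CSpace n m}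
    (h : g.IsScaledCurve δ x) (hn : 1 ≤ n) {σ : ℝ} (hσ : σ ∈ Ioo 0 δ) :
    HasDerivAt (fun t : ℝ => x (t ^ ((n : ℝ)⁻¹))) (g.field (reProd n m) (x σ)) (σ ^ n) := by
  have hn0 : n ≠ 0 := by omega
  have hroot : (σ ^ n) ^ ((n : ℝ)⁻¹) = σ := Real.pow_rpow_inv_natCast hσ.1.le hn0
  have hpos : (n : ℝ) * σ ^ (n - 1) ≠ 0 :=
    mul_ne_zero (by exact_mod_cast hn0) (pow_ne_zero _ hσ.1.ne')
  have h1 : HasDerivAt (fun t : ℝ => t ^ ((n : ℝ)⁻¹)) ((n : ℝ) * σ ^ (n - 1))⁻¹ (σ ^ n) := by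
    refine HasDerivAt.of_local_left_inverse (f := fun s => s ^ n) ?_ ?_ hpos ?_
    · exact Real.continuousAt_rpow_const _ _ (Or.inl (pow_pos hσ.1 n).ne')
    · rw [hroot]
      exact hasDerivAt_pow n σ
    · filter_upwards [lt_mem_nhds (pow_pos hσ.1 n)] with t ht
      exact Real.rpow_inv_natCast_pow ht.le hn0
  have h2 := (h σ hσ).2
  rw [h.scaledField_eq hn hσ, ← hroot] at h2
  have h3 := HasDerivAt.scomp (σ ^ n) h2 h1
  rw [hroot] at h3
  rwa [smul_smul, inv_mul_cancel₀ hpos, one_smul] at h3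

/-- Solutions of `∇f / |∇f|²` with `s(γ(t)) = t - a` are scaled curves. -/
theorem isScaledCurve_of_isSolutionCurve (hn : 1 ≤ n) {I : Set ℝ} {γ : ℝ → CSpace n m} {a δ : ℝ}
    (hγ : g.IsSolutionCurve (reProd n m) I γ)
    (hs : ∀ t ∈ I, coordProd n m (γ t) = ((t - a : ℝ) : ℂ)) (hδ : ∀ σ ∈ Ioo 0 δ, a + σ ^ n ∈ I) :
    g.IsScaledCurve δ fun σ => γ (a + σ ^ n) := by
  intro σ hσ
  have hI := hδ σ hσ
  have h0 : coordProd n m (γ (a + σ ^ n)) = (σ : ℂ) ^ n := by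
    rw [hs _ hI]; push_cast; ring
  refine ⟨h0, ?_⟩
  have hσ0 : (σ : ℂ) ≠ 0 := by exact_mod_cast hσ.1.ne'
  have h1 : coordProd n m (σ⁻¹ • γ (a + σ ^ n)) = 1 := by
    rw [coordProd_smul, h0]
    push_cast
    rw [← mul_pow, inv_mul_cancel₀ hσ0, one_pow]
  rw [g.scaledField_eq hσ.1 h1 hn, smul_inv_smul_self hσ.1]
  exact HasDerivAt.scomp σ (hγ.hasDerivAt _ hI) ((hasDerivAt_pow n σ).const_add a)

/-- Integrates `ds(V) = 1`. The constant is a priori complex; accumulation at the origin will force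
it to be real. -/
theorem coordProd_eq_of_isSolutionCurve {I : Set ℝ} {γ : ℝ → CSpace n m}
    (hγ : g.IsSolutionCurve (reProd n m) I γ) :
    ∃ c : ℂ, ∀ t ∈ I, coordProd n m (γ t) = t + c := by
  obtain ⟨t₀, ht₀⟩ := hγ.nonempty
  have hder : ∀ t ∈ I, HasDerivAt (fun t : ℝ => coordProd n m (γ t) - t) 0 t := by
    intro t ht
    have h1 : HasDerivAt (fun t => coordProd n m (γ t))
        (coordProdDeriv (γ t) (g.field (reProd n m) (γ t))) t :=
      ((hasFDerivAt_coordProd (γ t)).restrictScalars ℝ).comp_hasDerivAt t (hγ.hasDerivAt t ht)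
    rw [g.coordProdDeriv_field (hγ.regular t ht)] at h1
    simpa using h1.fun_sub (Complex.ofRealCLM.hasDerivAt (x := t))
  refine ⟨coordProd n m (γ t₀) - t₀, fun t ht => ?_⟩
  have := hγ.isOpen.is_const_of_deriv_eq_zero hγ.ordConnected.isPreconnected
      (fun u hu => (hder u hu).differentiableAt.differentiableWithinAt)
      (fun u hu => (hder u hu).deriv) ht ht₀
  rw [← this]; ring

/-- The position of the time interval of a solution curve accumulating at the origin. -/
theorem exists_start_of_accumulates (hn : 1 ≤ n) {I : Set ℝ} {γ : ℝ → CSpace n m}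
    (hγ : g.IsSolutionCurve (reProd n m) I γ) (hacc : AccumulatesBackwardAt I γ 0) :
    ∃ a : ℝ, (∀ t ∈ I, a < t ∧ coordProd n m (γ t) = ((t - a : ℝ) : ℂ)) ∧
      (∃ b > a, Ioo a b ⊆ I) ∧ ∀ ε > 0, ∀ b > a, ∃ t ∈ I, t < b ∧ ‖γ t‖ < ε := by
  obtain ⟨c, hc⟩ := coordProd_eq_of_isSolutionCurve hγ
  obtain ⟨t₀, ht₀⟩ := hγ.nonempty
  have hn0 : n ≠ 0 := by omega
  have hprod0 : coordProd n m (0 : CSpace n m) = 0 := by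
    simp [coordProd, hn0]
  have hfreq : ∀ ε > 0, ∀ t₁ ∈ I, ∃ t ∈ I, t ≤ t₁ ∧ ‖γ t‖ < ε ∧ ‖(t : ℂ) + c‖ < ε := by
    intro ε hε t₁ ht₁
    have hU : {z : CSpace n m | ‖z‖ < ε ∧ ‖coordProd n m z‖ < ε} ∈ 𝓝 (0 : CSpace n m) := by
      refine ((isOpen_lt continuous_norm continuous_const).inter
        (isOpen_lt continuous_coordProd.norm continuous_const)).mem_nhds ?_
      simp [hprod0, hε]
    have h1 : ∃ᶠ t : I in atBot, γ t ∈ {z : CSpace n m | ‖z‖ < ε ∧ ‖coordProd n m z‖ < ε} :=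
      mapClusterPt_iff_frequently.1 hacc _ hU
    obtain ⟨t, ht, htle⟩ := (h1.and_eventually (eventually_le_atBot (⟨t₁, ht₁⟩ : I))).exists
    refine ⟨t, t.2, htle, ht.1, ?_⟩
    rw [← hc t t.2]
    exact ht.2
  -- `Im s` is constant along the curve and becomes arbitrarily small along the accumulating times.
  have him : c.im = 0 := by
    by_contra hne
    obtain ⟨t, -, -, -, ht⟩ := hfreq |c.im| (abs_pos.2 hne) t₀ ht₀
    have := Complex.abs_im_le_norm ((t : ℂ) + c)
    simp only [Complex.add_im, Complex.ofReal_im, zero_add] at this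
    linarith
  have hcre : c = ((c.re : ℝ) : ℂ) := Complex.ext (by simp) (by simp [him])
  have hfreq' : ∀ ε > 0, ∀ t₁ ∈ I, ∃ t ∈ I, t ≤ t₁ ∧ ‖γ t‖ < ε ∧ |t + c.re| < ε := by
    intro ε hε t₁ ht₁
    obtain ⟨t, h1, h2, h3, h4⟩ := hfreq ε hε t₁ ht₁
    rw [hcre, ← Complex.ofReal_add, Complex.norm_real] at h4
    exact ⟨t, h1, h2, h3, h4⟩
  -- There are times arbitrarily far to the left in `I` at which `t + Re c` is arbitrarily small. If
  -- `I` contained a time at or before `-Re c`, then at all times before an earlier `t₁` in `I` this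
  -- quantity would stay away from zero.
  have hlt : ∀ t ∈ I, -c.re < t := by
    intro t ht
    by_contra! hle
    obtain ⟨t₁, ht₁, ht₁I⟩ : ∃ t₁ < t, t₁ ∈ I :=
      ((eventually_mem_nhdsWithin (a := t) (s := Iio t)).and
        (nhdsWithin_le_nhds (hγ.isOpen.mem_nhds ht))).exists
    obtain ⟨u, -, hu, -, hu2⟩ := hfreq' (t - t₁) (sub_pos.2 ht₁) t₁ ht₁I
    rw [abs_lt] at hu2
    linarith [hu2.1]
  refine ⟨-c.re, fun t ht => ⟨hlt t ht, ?_⟩, ⟨t₀, hlt t₀ ht₀, fun t ht => ?_⟩, ?_⟩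
  · rw [hc t ht, hcre]; push_cast; simp
  · obtain ⟨u, huI, -, -, hu2⟩ := hfreq' (t + c.re) (by linarith [ht.1]) t₀ ht₀
    rw [abs_lt] at hu2
    exact hγ.ordConnected.out huI ht₀ ⟨by linarith [hu2.2], ht.2.le⟩
  · intro ε hε b hb
    obtain ⟨u, huI, -, hu1, hu2⟩ := hfreq' (min ε (b + c.re)) (lt_min hε (by linarith)) t₀ ht₀
    rw [abs_lt] at hu2
    exact ⟨u, huI, by linarith [hu2.2, min_le_right ε (b + c.re)], hu1.trans_le (min_le_left _ _)⟩

end HermitianMetric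

/-! ### Asymptotics and uniqueness of curves accumulating at the origin. -/

namespace HermitianMetric

open Set

variable {n m : ℕ} {g : HermitianMetric n m}

/-- `|W| = n σⁿ⁻¹ |V|`, while `|df| ≥ σⁿ⁻¹` by `one_le_norm_logCovector`; the powers of `σ` cancel
in `|V| |df| ≤ C`. -/
theorem IsScaledCurve.norm_scaledField_le {C δ : ℝ} {x : ℝ → CSpace n m}
    (h : g.IsScaledCurve δ x) (hn : 1 ≤ n)
    (hC : ∀ x : CSpace n m, ‖x‖ ≤ 1 → ‖g.field (reProd n m) x‖ * ‖fderiv ℝ (reProd n m) x‖ ≤ C)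
    {σ : ℝ} (hσ : σ ∈ Ioo 0 δ) (hx : ‖x σ‖ ≤ 1) :
    ‖g.scaledField (σ, σ⁻¹ • x σ)‖ ≤ n * C := by
  have h1 := h.coordProd_inv_smul hσ
  have h2 : ‖fderiv ℝ (reProd n m) (x σ)‖ = σ ^ (n - 1) * ‖logCovector (σ⁻¹ • x σ)‖ := by
    conv_lhs => rw [← smul_inv_smul_self hσ.1 (x σ)]
    rw [fderiv_reProd_eq_logCovector hσ.1 h1 hn, norm_smul,
      Real.norm_of_nonneg (pow_nonneg hσ.1.le _)]
  have h3 := one_le_norm_logCovector hn h1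
  have h4 := hC _ hx
  rw [h2] at h4
  rw [h.scaledField_eq hn hσ, norm_smul, norm_mul, Real.norm_natCast,
    Real.norm_of_nonneg (pow_nonneg hσ.1.le _), mul_assoc]
  have h5 : 0 ≤ σ ^ (n - 1) * ‖g.field (reProd n m) (x σ)‖ :=
    mul_nonneg (pow_nonneg hσ.1.le _) (norm_nonneg _)
  refine mul_le_mul_of_nonneg_left ?_ (by positivity)
  nlinarith

/-- A scaled curve which accumulates at the origin converges to it with `|x(σ)| = O(σ)`. -/
theorem IsScaledCurve.exists_norm_le {δ : ℝ} {x : ℝ → CSpace n m}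
    (h : g.IsScaledCurve δ x) (hn : 1 ≤ n) (hδ : 0 < δ)
    (hsmall : ∀ ε > 0, ∀ b > 0, ∃ σ ∈ Ioo 0 δ, σ < b ∧ ‖x σ‖ < ε) :
    ∃ C > 0, ∃ δ' > 0, δ' ≤ δ ∧ ∀ σ ∈ Ioo 0 δ', ‖x σ‖ ≤ C * σ := by
  obtain ⟨C₀, hC₀, hC⟩ := g.exists_field_bound (reProd n m)
  -- The summand `1` makes the speed bound strict, as the comparison argument below requires. With
  -- `σ < 1 / (4K)` and a starting point of norm less than `1/2`, the comparison function stays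
  -- below `1`, so the bound on the unit ball applies at any first contact.
  set K : ℝ := n * C₀ + 1 with hK
  have hKpos : 0 < K := by positivity
  refine ⟨K, hKpos, min δ (1 / (4 * K)), by positivity, min_le_left _ _, fun σ hσ => ?_⟩
  have hσδ : σ < δ := hσ.2.trans_le (min_le_left _ _)
  have hσK : K * σ < 1 / 4 := by
    have := hσ.2.trans_le (min_le_right _ _)
    rw [lt_div_iff₀ (by positivity)] at this
    linarith
  refine le_of_forall_pos_le_add fun ε hε => ?_
  obtain ⟨τ, hτ, hτσ, hτx⟩ := hsmall (min ε (1 / 2)) (by positivity) σ hσ.1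
  have hsub : ∀ s ∈ Icc τ σ, s ∈ Ioo 0 δ := fun s hs => ⟨hτ.1.trans_le hs.1, hs.2.trans_lt hσδ⟩
  have hle := image_norm_le_of_norm_deriv_right_lt_deriv_boundary (f := x) (a := τ) (b := σ)
    (f' := fun s => g.scaledField (s, s⁻¹ • x s)) (B := fun s => ‖x τ‖ + K * (s - τ))
    (B' := fun _ => K)
    (fun s hs => (h s (hsub s hs)).2.continuousAt.continuousWithinAt)
    (fun s hs => (h s (hsub s (Ico_subset_Icc_self hs))).2.hasDerivWithinAt) (by simp)
    (fun s => by simpa using (((hasDerivAt_id s).sub_const τ).const_mul K).const_add ‖x τ‖)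
    (fun s hs hsx => by
      have h1 : ‖x s‖ ≤ 1 := by
        rw [hsx]
        have := hτx.trans_le (min_le_right _ _)
        nlinarith [hs.1, hs.2, hτ.1]
      exact (h.norm_scaledField_le hn hC (hsub s (Ico_subset_Icc_self hs)) h1).trans_lt
        (by rw [hK]; linarith)) (right_mem_Icc.2 hτσ.le)
  have := hτx.trans_le (min_le_left _ _)
  nlinarith [hτ.1]

/-- Each component is a real multiple of `yᵢ`, with one common factor times `|yᵢ|⁻²`. Its inner
product with `yᵢ`, when all `yᵢ` are nonzero, is therefore the same for every `i`, which is why the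
moduli equalise. -/
theorem scaledField_zero_inl_real (hg : g.IsStandardAt 0) (y : CSpace n m) (i : Fin n) :
    g.scaledField (0, y) (Sum.inl i) =
      (((n / ∑ j : Fin n, (‖y (Sum.inl j)‖ ^ 2)⁻¹) * (‖y (Sum.inl i)‖ ^ 2)⁻¹ : ℝ) : ℂ) *
        y (Sum.inl i) := by
  have hinv : ∀ z : ℂ, (starRingEnd ℂ z)⁻¹ = ((‖z‖ ^ 2)⁻¹ : ℝ) * z := by
    intro z
    rw [Complex.inv_def, Complex.conj_conj, Complex.normSq_conj, Complex.normSq_eq_norm_sq, mul_comm]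
  have hS : ∀ z : ℂ, z⁻¹ * (starRingEnd ℂ z)⁻¹ = ((‖z‖ ^ 2)⁻¹ : ℝ) := by
    intro z
    rw [← mul_inv, Complex.mul_conj, Complex.normSq_eq_norm_sq]; push_cast; rfl
  rw [g.scaledField_zero_inl hg, hinv]
  simp only [hS]
  push_cast
  ring

end HermitianMetric

namespace HermitianMetric

open Set

variable {n m : ℕ} {g : HermitianMetric n m}

/-- On compact sets of points of `{∏ yᵢ = 1}`, almost equal moduli `|yᵢ|` make `y` almost a fixed
point of the unperturbed field. -/
theorem exists_norm_scaledField_zero_sub_le (hg : g.IsStandardAt 0) (hn : 1 ≤ n)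
    {C : ℝ} (hC : 0 < C) :
    ∃ M > 0, ∀ y : CSpace n m, ‖y‖ ≤ C → coordProd n m y = 1 → ∀ a : ℝ,
      (∀ i j : Fin n, |‖y (Sum.inl i)‖ ^ 2 - ‖y (Sum.inl j)‖ ^ 2| ≤ a) → ∀ i : Fin n,
        ‖g.scaledField (0, y) (Sum.inl i) - y (Sum.inl i)‖ ≤ M * a := by
  have hK : IsCompact {y : CSpace n m | ‖y‖ ≤ C ∧ coordProd n m y = 1} := by
    refine (isCompact_closedBall (0 : CSpace n m) C).of_isClosed_subset
      ((isClosed_le continuous_norm continuous_const).inter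
        (isClosed_eq continuous_coordProd continuous_const)) fun y hy => by simpa using hy.1
  have hne : ∀ y ∈ {y : CSpace n m | ‖y‖ ≤ C ∧ coordProd n m y = 1}, ∀ i : Fin n,
      y (Sum.inl i) ≠ 0 := fun y hy =>
    coord_ne_zero_of_coordProd_ne_zero (by rw [hy.2]; exact one_ne_zero)
  obtain ⟨M, hM⟩ := hK.exists_bound_of_continuousOn
    (f := fun y => ∑ i : Fin n, (‖y (Sum.inl i)‖ ^ 2)⁻¹) (continuousOn_finsetSum _ fun i _ =>
      ContinuousOn.inv₀ ((continuous_coord _).norm.pow 2).continuousOn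
        fun y hy => pow_ne_zero _ (norm_ne_zero_iff.2 (hne y hy i)))
  refine ⟨C ^ 3 * n * (max M 1) ^ 2, by positivity, fun y hy hy1 a ha i => ?_⟩
  have hy0 : ∀ i : Fin n, 0 < ‖y (Sum.inl i)‖ := fun i => norm_pos_iff.2 (hne y ⟨hy, hy1⟩ i)
  have hyC : ∀ i : Fin n, ‖y (Sum.inl i)‖ ≤ C := fun i => (norm_coord_le y _).trans hy
  set q : Fin n → ℝ := fun j => (‖y (Sum.inl j)‖ ^ 2)⁻¹ with hq
  have hq0 : ∀ j, 0 < q j := fun j => by have := hy0 j; positivity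
  set S : ℝ := ∑ j : Fin n, q j with hS
  have hqS : ∀ j, q j ≤ S := fun j =>
    Finset.single_le_sum (f := q) (fun j _ => (hq0 j).le) (Finset.mem_univ j)
  have hSM : S ≤ max M 1 := by
    have := hM y ⟨hy, hy1⟩
    exact ((le_abs_self _).trans this).trans (le_max_left _ _)
  have hSC : (C ^ 2)⁻¹ ≤ S := by
    refine le_trans ?_ (hqS i)
    simp only [hq]
    have := hyC i
    have := hy0 i
    gcongr
  have hSpos : 0 < S := (hq0 i).trans_le (hqS i)
  rw [scaledField_zero_inl_real hg]
  have hsub : (((n / S) * q i : ℝ) : ℂ) * y (Sum.inl i) - y (Sum.inl i) =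
      (((n / S) * q i - 1 : ℝ) : ℂ) * y (Sum.inl i) := by push_cast; ring
  have hdiff : ∀ j, |q i - q j| ≤ (max M 1) ^ 2 * a := by
    intro j
    have h1 : q i - q j = (q i * q j) * (‖y (Sum.inl j)‖ ^ 2 - ‖y (Sum.inl i)‖ ^ 2) := by
      have := (hy0 i).ne'
      have := (hy0 j).ne'
      simp only [hq]
      field_simp
    rw [h1, abs_mul, abs_of_pos (mul_pos (hq0 i) (hq0 j)), pow_two (max M 1)]
    have := ha j i
    have h2 := (hqS i).trans hSM
    have h3 := (hqS j).trans hSM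
    have := hq0 i
    have := hq0 j
    gcongr
  -- The coefficient of `yᵢ` is `qᵢ` divided by the mean of the `qⱼ`, so its distance from `1` is
  -- controlled by the differences `qᵢ - qⱼ`.
  have hcoef : |(n / S) * q i - 1| ≤ C ^ 2 * (n * ((max M 1) ^ 2 * a)) := by
    have h1 : (n / S) * q i - 1 = S⁻¹ * ∑ j : Fin n, (q i - q j) := by
      rw [Finset.sum_sub_distrib, ← hS]
      simp
      field_simp
    rw [h1, abs_mul, abs_of_pos (inv_pos.2 hSpos)]
    have h2 : S⁻¹ ≤ C ^ 2 := by
      rw [inv_le_comm₀ hSpos (by positivity)]; exact hSC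
    have h3 : |∑ j : Fin n, (q i - q j)| ≤ n * ((max M 1) ^ 2 * a) := by
      refine (Finset.abs_sum_le_sum_abs _ _).trans ((Finset.sum_le_sum fun j _ => hdiff j).trans ?_)
      simp
    gcongr
  change ‖(((n / S) * q i : ℝ) : ℂ) * y (Sum.inl i) - y (Sum.inl i)‖ ≤ _
  rw [hsub, norm_mul, Complex.norm_real, Real.norm_eq_abs]
  calc |(n / S) * q i - 1| * ‖y (Sum.inl i)‖ ≤ (C ^ 2 * (n * ((max M 1) ^ 2 * a))) * C :=
        mul_le_mul hcoef (hyC i) (norm_nonneg _) ((abs_nonneg _).trans hcoef)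
    _ = C ^ 3 * n * (max M 1) ^ 2 * a := by ring

/-- A scaled curve of size `O(σ)` starts at the origin in a direction of the base torus. -/
theorem IsScaledCurve.exists_direction (hg : g.IsStandardAt 0) {δ : ℝ} {x : ℝ → CSpace n m}
    (h : g.IsScaledCurve δ x) (hn : 1 ≤ n) (hδ : 0 < δ) {C : ℝ} (hC : 0 < C)
    (hle : ∀ σ ∈ Ioo 0 δ, ‖x σ‖ ≤ C * σ) :
    ∃ θ ∈ baseTorus n m, ∃ B, ∃ δ' > 0, δ' ≤ δ ∧ ∀ σ ∈ Ioo 0 δ', ‖x σ - σ • θ‖ ≤ B * σ ^ 2 := by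
  set δ₁ : ℝ := min δ 1 with hδ₁
  have hδ₁pos : 0 < δ₁ := by positivity
  replace h := h.mono (min_le_left δ 1)
  have hle' : ∀ σ ∈ Ioo 0 δ₁, ‖x σ‖ ≤ C * σ := fun σ hσ => hle σ ⟨hσ.1, hσ.2.trans_le (min_le_left _ _)⟩
  set K : Set (CSpace n m) := {y | ‖y‖ ≤ C ∧ coordProd n m y = 1} with hKdef
  have hK : IsCompact K := by
    refine (isCompact_closedBall (0 : CSpace n m) C).of_isClosed_subset
      ((isClosed_le continuous_norm continuous_const).inter
        (isClosed_eq continuous_coordProd continuous_const)) fun y hy => by simpa using hy.1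
  obtain ⟨R, hR, hRK⟩ := g.exists_norm_scaledField_sub_le hn hK fun y hy =>
    coord_ne_zero_of_coordProd_ne_zero (by rw [hy.2]; exact one_ne_zero)
  obtain ⟨M, hM, hMy⟩ := exists_norm_scaledField_zero_sub_le hg hn hC
  set y : ℝ → CSpace n m := fun σ => σ⁻¹ • x σ with hy
  have hyK : ∀ σ ∈ Ioo 0 δ₁, y σ ∈ K := by
    intro σ hσ
    refine ⟨?_, h.coordProd_inv_smul hσ⟩
    rw [hy, norm_smul, norm_inv, Real.norm_of_nonneg hσ.1.le, inv_mul_le_iff₀ hσ.1, mul_comm]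
    exact hle' σ hσ
  have hyR : ∀ σ ∈ Ioo 0 δ₁, ‖g.scaledField (σ, y σ) - g.scaledField (0, y σ)‖ ≤ R * σ :=
    fun σ hσ => hRK _ (hyK σ hσ) σ ⟨hσ.1.le, (hσ.2.trans_le (min_le_right _ _)).le⟩
  have hxy : ∀ σ ∈ Ioo 0 δ₁, ∀ k, x σ k = σ * y σ k := by
    intro σ hσ k
    have : x σ = σ • y σ := (smul_inv_smul_self hσ.1 _).symm
    rw [this]; simp
  have hcoord : ∀ σ ∈ Ioo 0 δ₁, ∀ k, HasDerivAt (fun s => x s k) (g.scaledField (σ, y σ) k) σ :=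
    fun σ hσ k => ((coordL n m k).restrictScalars ℝ).hasFDerivAt.comp_hasDerivAt σ (h σ hσ).2
  have hx0 : Tendsto x (𝓝[>] 0) (𝓝 0) := tendsto_zero_of_norm_le_mul hδ₁pos hle'
  have hxk0 : ∀ k, Tendsto (fun s => x s k) (𝓝[>] 0) (𝓝 0) := fun k =>
    ((continuous_coord k).tendsto (0 : CSpace n m)).comp hx0
  -- the moduli of the first coordinates
  have hinner : ∀ σ ∈ Ioo 0 δ₁, ∃ c : ℝ, ∀ i : Fin n,
      |inner ℝ (x σ (Sum.inl i)) (g.scaledField (σ, y σ) (Sum.inl i)) - c| ≤ C * R * σ ^ 2 := by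
    intro σ hσ
    have hyne : ∀ i : Fin n, ‖y σ (Sum.inl i)‖ ≠ 0 := fun i => norm_ne_zero_iff.2
      (coord_ne_zero_of_coordProd_ne_zero (by rw [(hyK σ hσ).2]; exact one_ne_zero) i)
    refine ⟨σ * (n / ∑ j : Fin n, (‖y σ (Sum.inl j)‖ ^ 2)⁻¹), fun i => ?_⟩
    have h1 : g.scaledField (σ, y σ) (Sum.inl i) = g.scaledField (0, y σ) (Sum.inl i) +
        (g.scaledField (σ, y σ) - g.scaledField (0, y σ)) (Sum.inl i) := by simp
    have h2 : inner ℝ (x σ (Sum.inl i)) (g.scaledField (0, y σ) (Sum.inl i)) =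
        σ * (n / ∑ j : Fin n, (‖y σ (Sum.inl j)‖ ^ 2)⁻¹) := by
      rw [scaledField_zero_inl_real hg, hxy σ hσ, ← Complex.real_smul, ← Complex.real_smul,
        real_inner_smul_left, real_inner_smul_right, real_inner_self_eq_norm_sq]
      have := hyne i
      field_simp
    rw [h1, inner_add_right, h2, add_sub_cancel_left]
    refine (abs_real_inner_le_norm _ _).trans ?_
    calc ‖x σ (Sum.inl i)‖ * ‖(g.scaledField (σ, y σ) - g.scaledField (0, y σ)) (Sum.inl i)‖
        ≤ (C * σ) * (R * σ) := by
          refine mul_le_mul ((norm_coord_le _ _).trans (hle' σ hσ))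
            ((norm_coord_le _ _).trans (hyR σ hσ)) (norm_nonneg _) ?_
          exact mul_nonneg hC.le hσ.1.le
      _ = C * R * σ ^ 2 := by ring
  have hmod : ∀ i j : Fin n, ∀ σ ∈ Ioo 0 δ₁,
      |‖y σ (Sum.inl i)‖ ^ 2 - ‖y σ (Sum.inl j)‖ ^ 2| ≤ 4 * C * R * σ := by
    intro i j σ hσ
    have hd : ∀ s ∈ Ioo 0 δ₁, HasDerivAt
        (fun s => ‖x s (Sum.inl i)‖ ^ 2 - ‖x s (Sum.inl j)‖ ^ 2)
        (2 * inner ℝ (x s (Sum.inl i)) (g.scaledField (s, y s) (Sum.inl i)) -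
          2 * inner ℝ (x s (Sum.inl j)) (g.scaledField (s, y s) (Sum.inl j))) s :=
      fun s hs => (hcoord s hs _).norm_sq.sub (hcoord s hs _).norm_sq
    -- The common leading term cancels in the difference, leaving a derivative of size at most `4 C
    -- R s²`. This integrates to order `s³`; dividing by `σ²` in passing from `x` to `y` leaves
    -- `O(σ)`.
    have hb : ∀ s ∈ Ioo 0 δ₁, HasDerivAt (fun s : ℝ => 4 * C * R * s ^ 3)
        (4 * C * R * (3 * s ^ 2)) s := fun s hs => by
      simpa using (hasDerivAt_pow 3 s).const_mul (4 * C * R)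
    have hx3 := norm_le_of_norm_deriv_le_of_tendsto_zero hd hb (fun s hs => by
      obtain ⟨c, hc⟩ := hinner s hs
      have h1 := abs_le.1 (hc i)
      have h2 := abs_le.1 (hc j)
      have : 0 ≤ C * R * s ^ 2 := by positivity
      rw [Real.norm_eq_abs, abs_le]
      constructor <;> linarith) (by
        have := ((hxk0 (Sum.inl i)).norm.pow 2).sub ((hxk0 (Sum.inl j)).norm.pow 2)
        simpa using this) (by
        have : Tendsto (fun s : ℝ => 4 * C * R * s ^ 3) (𝓝 0) (𝓝 (4 * C * R * 0 ^ 3)) :=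
          (by fun_prop : Continuous fun s : ℝ => 4 * C * R * s ^ 3).tendsto 0
        simpa using this.mono_left nhdsWithin_le_nhds) hσ
    rw [Real.norm_eq_abs, hxy σ hσ, hxy σ hσ, norm_mul, norm_mul, Complex.norm_real,
      Real.norm_of_nonneg hσ.1.le, mul_pow, mul_pow, ← mul_sub, abs_mul,
      abs_of_nonneg (sq_nonneg σ)] at hx3
    have hσ2 : 0 < σ ^ 2 := pow_pos hσ.1 2
    refine le_of_mul_le_mul_left ?_ hσ2
    linarith
  -- the last coordinates
  have hlast : ∀ k : Fin m, ∀ σ ∈ Ioo 0 δ₁, ‖y σ (Sum.inr k)‖ ≤ R * σ := by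
    intro k σ hσ
    have hb : ∀ s ∈ Ioo 0 δ₁, HasDerivAt (fun s : ℝ => R * s ^ 2) (R * (2 * s)) s := fun s hs => by
      simpa using (hasDerivAt_pow 2 s).const_mul R
    have hx2 := norm_le_of_norm_deriv_le_of_tendsto_zero
      (fun s hs => hcoord s hs (Sum.inr k)) hb (fun s hs => by
      have h1 := (norm_coord_le _ (Sum.inr k)).trans (hyR s hs)
      rw [PiLp.sub_apply, g.scaledField_zero_inr hg, sub_zero] at h1
      have : 0 ≤ R * s := mul_nonneg hR.le hs.1.le
      linarith) (hxk0 _) (by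
        have : Tendsto (fun s : ℝ => R * s ^ 2) (𝓝 0) (𝓝 (R * 0 ^ 2)) :=
          (by fun_prop : Continuous fun s : ℝ => R * s ^ 2).tendsto 0
        simpa using this.mono_left nhdsWithin_le_nhds) hσ
    rw [hxy σ hσ, norm_mul, Complex.norm_real, Real.norm_of_nonneg hσ.1.le] at hx2
    refine le_of_mul_le_mul_left ?_ hσ.1
    linarith
  -- the curve `y` is Lipschitz
  obtain ⟨L, hL⟩ : ∃ L, ∀ σ ∈ Ioo 0 δ₁, ‖g.scaledField (σ, y σ) - y σ‖ ≤ L * σ := by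
    refine ⟨R + (n * (M * (4 * C * R)) + m * R), fun σ hσ => ?_⟩
    have h1 : ‖g.scaledField (0, y σ) - y σ‖ ≤ (n * (M * (4 * C * R)) + m * R) * σ := by
      refine (norm_le_sum_norm_coord _).trans ?_
      rw [Fintype.sum_sum_type]
      have h2 : ∑ i : Fin n, ‖(g.scaledField (0, y σ) - y σ) (Sum.inl i)‖ ≤
          ∑ i : Fin n, M * (4 * C * R * σ) := Finset.sum_le_sum fun i _ =>
        hMy _ (hyK σ hσ).1 (hyK σ hσ).2 _ (fun i j => hmod i j σ hσ) i
      have h3 : ∑ k : Fin m, ‖(g.scaledField (0, y σ) - y σ) (Sum.inr k)‖ ≤ ∑ k : Fin m, R * σ :=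
        Finset.sum_le_sum fun k _ => by
          rw [PiLp.sub_apply, g.scaledField_zero_inr hg, zero_sub, norm_neg]
          exact hlast k σ hσ
      simp only [Finset.sum_const, Finset.card_univ, Fintype.card_fin, nsmul_eq_mul] at h2 h3
      linarith
    have h4 := norm_add_le (g.scaledField (σ, y σ) - g.scaledField (0, y σ))
      (g.scaledField (0, y σ) - y σ)
    rw [sub_add_sub_cancel] at h4
    linarith [hyR σ hσ]
  -- `σ y' = W(σ, y) - y`, and the right side is `O(σ)`; so `y'` is bounded up to the singular end.
  have hyd : ∀ σ ∈ Ioo 0 δ₁, HasDerivAt y (σ⁻¹ • (g.scaledField (σ, y σ) - y σ)) σ := by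
    intro σ hσ
    have h1 := (hasDerivAt_inv hσ.1.ne').smul (h σ hσ).2
    have h2 : σ⁻¹ • g.scaledField (σ, σ⁻¹ • x σ) + -(σ ^ 2)⁻¹ • x σ =
        σ⁻¹ • (g.scaledField (σ, y σ) - y σ) := by
      rw [smul_sub, sub_eq_add_neg, hy]
      simp only
      rw [smul_smul, neg_smul]
      congr 3
      field_simp
    rw [h2] at h1
    exact h1
  have hydle : ∀ σ ∈ Ioo 0 δ₁, ‖σ⁻¹ • (g.scaledField (σ, y σ) - y σ)‖ ≤ L := by
    intro σ hσ
    rw [norm_smul, norm_inv, Real.norm_of_nonneg hσ.1.le, inv_mul_le_iff₀ hσ.1, mul_comm]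
    exact hL σ hσ
  have hLnn : 0 ≤ L := (norm_nonneg _).trans (hydle (δ₁ / 2) ⟨by linarith, by linarith⟩)
  have hylip : ∀ σ ∈ Ioo 0 δ₁, ∀ s ∈ Ioo 0 σ, ‖y s - y σ‖ ≤ L * σ := by
    intro σ hσ s hs
    have := (convex_Ioo 0 δ₁).norm_image_sub_le_of_norm_hasDerivWithin_le
      (fun u hu => (hyd u hu).hasDerivWithinAt) hydle hσ (⟨hs.1, hs.2.trans hσ.2⟩ : s ∈ Ioo 0 δ₁)
    rw [Real.norm_eq_abs, abs_sub_comm, abs_of_pos (sub_pos.2 hs.2)] at this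
    refine this.trans ?_
    have := hs.1
    gcongr
    linarith
  -- Compactness gives one cluster point, and the Lipschitz bound upgrades it to a limit with rate
  -- `L σ`.
  obtain ⟨θ, hθK, hθ⟩ : ∃ θ ∈ K, MapClusterPt θ (𝓝[>] (0 : ℝ)) y := by
    refine hK.exists_mapClusterPt (tendsto_principal.2 ?_)
    filter_upwards [Ioo_mem_nhdsGT hδ₁pos] with σ hσ using hyK σ hσ
  have hyθ : ∀ σ ∈ Ioo 0 δ₁, ‖y σ - θ‖ ≤ L * σ := by
    intro σ hσ
    have h1 : θ ∈ Metric.closedBall (y σ) (L * σ) := by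
      refine Metric.isClosed_closedBall.mem_of_mapClusterPt hθ ?_
      filter_upwards [Ioo_mem_nhdsGT hσ.1] with s hs
      rw [mem_closedBall_iff_norm]
      exact hylip σ hσ s hs
    rw [← dist_eq_norm, dist_comm]
    exact h1
  have hytend : Tendsto y (𝓝[>] 0) (𝓝 θ) := by
    rw [tendsto_iff_norm_sub_tendsto_zero]
    simpa using (tendsto_zero_of_norm_le_mul (f := fun σ => y σ - θ) hδ₁pos hyθ).norm
  have hθmod : ∀ i j : Fin n, ‖θ (Sum.inl i)‖ = ‖θ (Sum.inl j)‖ := by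
    intro i j
    have h1 : Tendsto (fun σ => ‖y σ (Sum.inl i)‖ ^ 2 - ‖y σ (Sum.inl j)‖ ^ 2) (𝓝[>] 0)
        (𝓝 (‖θ (Sum.inl i)‖ ^ 2 - ‖θ (Sum.inl j)‖ ^ 2)) :=
      ((((continuous_coord (Sum.inl i)).tendsto θ).comp hytend).norm.pow 2).sub
        ((((continuous_coord (Sum.inl j)).tendsto θ).comp hytend).norm.pow 2)
    have h2 := tendsto_nhds_unique h1 (tendsto_zero_of_norm_le_mul hδ₁pos (hmod i j))
    exact (sq_eq_sq₀ (norm_nonneg _) (norm_nonneg _)).1 (sub_eq_zero.1 h2)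
  have hθT : θ ∈ baseTorus n m := by
    refine ⟨fun i => ?_, hθK.2, fun k => ?_⟩
    · have h1 : ∏ j : Fin n, ‖θ (Sum.inl j)‖ = 1 := by
        rw [← norm_prod]; change ‖coordProd n m θ‖ = 1; rw [hθK.2, norm_one]
      rw [Finset.prod_congr rfl fun j _ => hθmod j i, Finset.prod_const, Finset.card_univ,
        Fintype.card_fin] at h1
      exact (pow_eq_one_iff_of_nonneg (norm_nonneg _) (by omega)).1 h1
    · exact tendsto_nhds_unique (((continuous_coord (Sum.inr k)).tendsto θ).comp hytend)
        (tendsto_zero_of_norm_le_mul hδ₁pos (hlast k))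
  refine ⟨θ, hθT, L, δ₁, hδ₁pos, min_le_left _ _, fun σ hσ => ?_⟩
  have h1 : x σ - σ • θ = σ • (y σ - θ) := by
    rw [smul_sub, smul_inv_smul_self hσ.1]
  rw [h1, norm_smul, Real.norm_of_nonneg hσ.1.le]
  nlinarith [hyθ σ hσ, hσ.1]

/-- Two scaled curves which start at the origin in the same direction agree near the origin. -/
theorem IsScaledCurve.eq_of_same_direction (hg : g.IsStandardAt 0) (hn : 1 ≤ n) {δ B : ℝ}
    {x x' : ℝ → CSpace n m} (h : g.IsScaledCurve δ x) (h' : g.IsScaledCurve δ x') (hδ : 0 < δ)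
    {θ : CSpace n m} (hθ : θ ∈ baseTorus n m) (hB : ∀ σ ∈ Ioo 0 δ, ‖x σ - σ • θ‖ ≤ B * σ ^ 2)
    (hB' : ∀ σ ∈ Ioo 0 δ, ‖x' σ - σ • θ‖ ≤ B * σ ^ 2) :
    ∃ δ' > 0, δ' ≤ δ ∧ ∀ σ ∈ Ioo 0 δ', x σ = x' σ := by
  obtain ⟨ρ, hρ, hρ1, hlip⟩ := g.exists_lipschitz_scaledField hg hn
  have hB0 : 0 ≤ B := by
    have h1 := (norm_nonneg _).trans (hB (δ / 2) ⟨by linarith, by linarith⟩)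
    exact nonneg_of_mul_nonneg_left h1 (by positivity)
  set δ' : ℝ := min δ (min ρ (ρ / (B + 1))) with hδ'
  have hδ'pos : 0 < δ' := by positivity
  refine ⟨δ', hδ'pos, min_le_left _ _, ?_⟩
  have hball : ∀ z : ℝ → CSpace n m, (∀ σ ∈ Ioo 0 δ, ‖z σ - σ • θ‖ ≤ B * σ ^ 2) →
      ∀ σ ∈ Ioo 0 δ', σ⁻¹ • z σ ∈ Metric.closedBall θ ρ := by
    intro z hz σ hσ
    have h1 : σ⁻¹ • z σ - θ = σ⁻¹ • (z σ - σ • θ) := by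
      rw [smul_sub, inv_smul_smul₀ hσ.1.ne']
    rw [mem_closedBall_iff_norm, h1, norm_smul, norm_inv, Real.norm_of_nonneg hσ.1.le,
      inv_mul_le_iff₀ hσ.1]
    have h2 := hz σ ⟨hσ.1, hσ.2.trans_le (min_le_left _ _)⟩
    have h3 : σ ≤ ρ / (B + 1) := (hσ.2.trans_le ((min_le_right _ _).trans (min_le_right _ _))).le
    rw [le_div_iff₀ (by positivity)] at h3
    nlinarith [hσ.1]
  have hd : ∀ σ ∈ Ioo 0 δ', HasDerivAt (fun s => x s - x' s)
      (g.scaledField (σ, σ⁻¹ • x σ) - g.scaledField (σ, σ⁻¹ • x' σ)) σ := fun σ hσ =>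
    ((h.mono (min_le_left _ _)) σ hσ).2.fun_sub ((h'.mono (min_le_left _ _)) σ hσ).2
  have hdle : ∀ σ ∈ Ioo 0 δ', ‖g.scaledField (σ, σ⁻¹ • x σ) - g.scaledField (σ, σ⁻¹ • x' σ)‖ ≤
      3 / 2 * (σ⁻¹ * ‖x σ - x' σ‖) := by
    intro σ hσ
    have h1 := (hlip θ hθ σ ⟨hσ.1.le, (hσ.2.trans_le ((min_le_right _ _).trans
      (min_le_left _ _))).le⟩ _ (hball x hB σ hσ)).2 _ (hball x' hB' σ hσ)
    rwa [← smul_sub, norm_smul, norm_inv, Real.norm_of_nonneg hσ.1.le] at h1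
  -- A bound `A σ²` on `x - x'` gives a derivative of size at most `3/2 A σ`, which integrates to
  -- `3/4 A σ²`. Iteration forces the difference to vanish.
  have hstep : ∀ A ≥ 0, (∀ σ ∈ Ioo 0 δ', ‖x σ - x' σ‖ ≤ A * σ ^ 2) →
      ∀ σ ∈ Ioo 0 δ', ‖x σ - x' σ‖ ≤ (3 / 4 * A) * σ ^ 2 := by
    intro A hA hle σ hσ
    refine norm_le_of_norm_deriv_le_of_tendsto_zero hd (b := fun s => (3 / 4 * A) * s ^ 2)
      (b' := fun s => (3 / 4 * A) * (2 * s)) (fun s hs => by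
        simpa using (hasDerivAt_pow 2 s).const_mul (3 / 4 * A)) (fun s hs => ?_) ?_ ?_ hσ
    · refine (hdle s hs).trans ?_
      have h1 : s⁻¹ * ‖x s - x' s‖ ≤ A * s := by
        rw [inv_mul_le_iff₀ hs.1]
        nlinarith [hle s hs]
      linarith
    · refine tendsto_zero_of_norm_le_mul (C := A * δ') hδ'pos fun s hs => (hle s hs).trans ?_
      have h1 := hs.1
      have h2 := hs.2.le
      rw [pow_two, ← mul_assoc]
      gcongr
    · have : Tendsto (fun s : ℝ => (3 / 4 * A) * s ^ 2) (𝓝 0) (𝓝 ((3 / 4 * A) * 0 ^ 2)) :=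
          (by fun_prop : Continuous fun s : ℝ => (3 / 4 * A) * s ^ 2).tendsto 0
      simpa using this.mono_left nhdsWithin_le_nhds
  have hiter : ∀ k : ℕ, ∀ σ ∈ Ioo 0 δ', ‖x σ - x' σ‖ ≤ ((3 / 4) ^ k * (2 * B)) * σ ^ 2 := by
    intro k
    induction k with
    | zero =>
      intro σ hσ
      have hσ' : σ ∈ Ioo 0 δ := ⟨hσ.1, hσ.2.trans_le (min_le_left _ _)⟩
      have h1 := norm_sub_le (x σ - σ • θ) (x' σ - σ • θ)
      rw [sub_sub_sub_cancel_right] at h1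
      have := hB σ hσ'
      have := hB' σ hσ'
      rw [pow_zero, one_mul]
      linarith
    | succ k ih =>
      intro σ hσ
      have := hstep _ (by positivity) ih σ hσ
      rwa [← mul_assoc, ← pow_succ'] at this
  intro σ hσ
  have hlim : Tendsto (fun k : ℕ => (((3 : ℝ) / 4) ^ k * (2 * B)) * σ ^ 2) atTop
      (𝓝 ((0 * (2 * B)) * σ ^ 2)) :=
    ((tendsto_pow_atTop_nhds_zero_of_lt_one (by norm_num) (by norm_num)).mul_const _).mul_const _
  have h0 : ‖x σ - x' σ‖ ≤ (0 * (2 * B)) * σ ^ 2 := ge_of_tendsto' hlim fun k => hiter k σ hσ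
  rw [zero_mul, zero_mul] at h0
  exact sub_eq_zero.1 (norm_le_zero_iff.1 h0)

end HermitianMetric

/-! ### Continuation along a complete flow with the same regular orbits. -/

namespace HermitianMetric

open Set

variable {n m : ℕ} (g : HermitianMetric n m)

/-- The gradient of `Re(z₁ ⋯ zₙ)`, rescaled to a bounded vector field on the whole space. -/
def tamedGrad (x : CSpace n m) : CSpace n m :=
  (1 + ‖g.grad (reProd n m) x‖ ^ 2)⁻¹ • g.grad (reProd n m) x

theorem contDiff_grad : ContDiff ℝ ∞ (g.grad (reProd n m)) := by
  have h : g.grad (reProd n m) = fun x => g.sharp x (fderiv ℝ (reProd n m) x) :=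
    funext fun x => g.grad_eq_sharp _ x
  rw [h]
  exact g.contDiff_sharp.clm_apply contDiff_fderiv_reProd

theorem one_add_norm_sq_pos (v : CSpace n m) : 0 < 1 + ‖v‖ ^ 2 := by positivity

theorem locallyLipschitz_tamedGrad : LocallyLipschitz g.tamedGrad := by
  have h : ContDiff ℝ ∞ g.tamedGrad := by
    have h1 := g.contDiff_grad
    exact ((contDiff_const.add (h1.norm_sq ℝ)).inv fun x => (one_add_norm_sq_pos _).ne').smul h1
  exact (h.of_le (by simp)).locallyLipschitz

theorem norm_tamedGrad_le (x : CSpace n m) : ‖g.tamedGrad x‖ ≤ 1 := by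
  rw [tamedGrad, norm_smul, norm_inv, Real.norm_of_nonneg (one_add_norm_sq_pos _).le,
    inv_mul_le_iff₀ (one_add_norm_sq_pos _)]
  nlinarith [sq_nonneg (‖g.grad (reProd n m) x‖ - 1)]

/-- The ratio between `∇f / |∇f|²` and the tamed gradient. -/
def speedRatio (x : CSpace n m) : ℝ :=
  (1 + ‖g.grad (reProd n m) x‖ ^ 2) / g.form x (g.grad (reProd n m) x) (g.grad (reProd n m) x)

theorem field_eq_speedRatio_smul (x : CSpace n m) :
    g.field (reProd n m) x = g.speedRatio x • g.tamedGrad x := by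
  have := (one_add_norm_sq_pos (g.grad (reProd n m) x)).ne'
  rw [field, speedRatio, tamedGrad, smul_smul]
  congr 1
  field_simp

theorem form_grad_self_pos {x : CSpace n m} (hx : fderiv ℝ (reProd n m) x ≠ 0) :
    0 < g.form x (g.grad (reProd n m) x) (g.grad (reProd n m) x) :=
  g.pos x _ (g.grad_ne_zero hx)

theorem continuousAt_speedRatio {x : CSpace n m} (hx : fderiv ℝ (reProd n m) x ≠ 0) :
    ContinuousAt g.speedRatio x := by
  have h1 := g.contDiff_grad.continuous
  have h2 : Continuous g.form := g.smooth.continuous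
  have h3 : Continuous fun x => g.form x (g.grad (reProd n m) x) (g.grad (reProd n m) x) := by
    fun_prop
  exact ContinuousAt.div (by fun_prop) h3.continuousAt (g.form_grad_self_pos hx).ne'

/-- A complete flow of the tamed gradient. -/
structure IsTamedFlow (ψ : ℝ → CSpace n m → CSpace n m) : Prop where
  zero : ∀ x, ψ 0 x = x
  hasDerivAt : ∀ x t, HasDerivAt (fun s => ψ s x) (g.tamedGrad (ψ t x)) t
  continuous : Continuous fun q : ℝ × CSpace n m => ψ q.1 q.2

theorem exists_isTamedFlow : ∃ ψ, g.IsTamedFlow ψ := by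
  obtain ⟨ψ, h1, h2, h3⟩ := exists_continuous_flow g.locallyLipschitz_tamedGrad g.norm_tamedGrad_le
  exact ⟨ψ, h1, h2, h3⟩

namespace IsTamedFlow

variable {g} {ψ : ℝ → CSpace n m → CSpace n m}

theorem eq_of_eq_at {u v : ℝ → CSpace n m} (hu : ∀ t, HasDerivAt u (g.tamedGrad (u t)) t)
    (hv : ∀ t, HasDerivAt v (g.tamedGrad (v t)) t) {t₀ : ℝ} (h : u t₀ = v t₀) : u = v := by
  funext t
  exact eqOn_of_hasDerivAt_smul g.locallyLipschitz_tamedGrad (k := fun _ => 1) isOpen_univ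
    ordConnected_univ continuousOn_const (fun t _ => by simpa using hu t)
    (fun t _ => by simpa using hv t) (mem_univ t₀) h (mem_univ t)

theorem add_apply (hψ : g.IsTamedFlow ψ) (s t : ℝ) (x : CSpace n m) :
    ψ (s + t) x = ψ s (ψ t x) := by
  have h := eq_of_eq_at (u := fun s => ψ (s + t) x) (v := fun s => ψ s (ψ t x))
    (fun s => (hψ.hasDerivAt x (s + t)).comp_add_const s t)
    (fun s => hψ.hasDerivAt (ψ t x) s) (t₀ := 0) (by simp [hψ.zero])
  exact congrFun h s

/-- A critical point is a rest point of the tamed gradient, so by uniqueness an orbit of regular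
points never meets one. -/
theorem fderiv_ne_zero (hψ : g.IsTamedFlow ψ) {x : CSpace n m}
    (hx : fderiv ℝ (reProd n m) x ≠ 0) (t : ℝ) : fderiv ℝ (reProd n m) (ψ t x) ≠ 0 := by
  intro h0
  have hg0 : g.tamedGrad (ψ t x) = 0 := by
    have : g.grad (reProd n m) (ψ t x) = 0 := by rw [g.grad_eq_sharp, h0, map_zero]
    rw [tamedGrad, this, smul_zero]
  have h := eq_of_eq_at (u := fun s => ψ s x) (v := fun _ => ψ t x) (fun s => hψ.hasDerivAt x s)
    (fun s => by rw [hg0]; exact hasDerivAt_const s _) (t₀ := t) rfl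
  have h1 := congrFun h 0
  simp only [hψ.zero] at h1
  rw [← h1] at h0
  exact hx h0

theorem hasDerivAt_reProd (hψ : g.IsTamedFlow ψ) (x : CSpace n m) (t : ℝ) :
    HasDerivAt (fun s => reProd n m (ψ s x))
      (fderiv ℝ (reProd n m) (ψ t x) (g.tamedGrad (ψ t x))) t := by
  have h : DifferentiableAt ℝ (reProd n m) (ψ t x) := (hasFDerivAt_reProd _).differentiableAt
  exact h.hasFDerivAt.comp_hasDerivAt t (hψ.hasDerivAt x t)

theorem fderiv_tamedGrad_pos {x : CSpace n m} (hx : fderiv ℝ (reProd n m) x ≠ 0) :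
    0 < fderiv ℝ (reProd n m) x (g.tamedGrad x) := by
  rw [tamedGrad, map_smul, ← g.form_grad, smul_eq_mul]
  exact mul_pos (inv_pos.2 (one_add_norm_sq_pos _)) (g.form_grad_self_pos hx)

theorem strictMono_reProd (hψ : g.IsTamedFlow ψ) {x : CSpace n m}
    (hx : fderiv ℝ (reProd n m) x ≠ 0) : StrictMono fun s => reProd n m (ψ s x) :=
  strictMono_of_hasDerivAt_pos (fun t => hψ.hasDerivAt_reProd x t)
    fun t => fderiv_tamedGrad_pos (hψ.fderiv_ne_zero hx t)

/-- Solution curves of `∇f / |∇f|²` stay in orbits of the tamed gradient. -/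
theorem exists_eq_of_isSolutionCurve (hψ : g.IsTamedFlow ψ) {I : Set ℝ} {γ : ℝ → CSpace n m}
    (hγ : g.IsSolutionCurve (reProd n m) I γ) {t₀ t : ℝ} (ht₀ : t₀ ∈ I) (ht : t ∈ I) :
    ∃ τ, γ t = ψ τ (γ t₀) := by
  have hk : ContinuousOn (fun t => g.speedRatio (γ t)) I := fun t ht =>
    (ContinuousAt.comp (g.continuousAt_speedRatio (hγ.regular t ht))
      (hγ.hasDerivAt t ht).continuousAt).continuousWithinAt
  -- `T` is the flow time elapsed along `γ`. Freezing the speed ratio along `γ` as a function of `t`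
  -- makes `γ` and the reparametrised orbit solve the same equation `u' = k(t) X(u)`, so uniqueness
  -- for that equation identifies them.
  set T : ℝ → ℝ := fun t => ∫ s in t₀..t, g.speedRatio (γ s) with hT
  have hTd : ∀ t ∈ I, HasDerivAt T (g.speedRatio (γ t)) t := by
    intro t ht
    refine intervalIntegral.integral_hasDerivAt_right ?_
      (hk.stronglyMeasurableAtFilter hγ.isOpen t ht) (hk.continuousAt (hγ.isOpen.mem_nhds ht))
    exact (hk.mono (hγ.ordConnected.uIcc_subset ht₀ ht)).intervalIntegrable
  have h := eqOn_of_hasDerivAt_smul g.locallyLipschitz_tamedGrad hγ.isOpen hγ.ordConnected hk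
    (u := γ) (v := fun t => ψ (T t) (γ t₀))
    (fun t ht => by
      have := hγ.hasDerivAt t ht
      rwa [g.field_eq_speedRatio_smul] at this)
    (fun t ht => HasDerivAt.scomp t (hψ.hasDerivAt (γ t₀) (T t)) (hTd t ht)) ht₀
    (by simp [hT, hψ.zero]) ht
  exact ⟨T t, h⟩

/-- Orbits of the tamed gradient, parametrized by the value of `f`, are solution curves. -/
theorem isSolutionCurve_orbit (hψ : g.IsTamedFlow ψ) {x : CSpace n m}
    (hx : fderiv ℝ (reProd n m) x ≠ 0) :
    ∃ μ : ℝ → ℝ, (∀ τ, μ (reProd n m (ψ τ x)) = τ) ∧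
      IsOpen (range fun τ => reProd n m (ψ τ x)) ∧
      (range fun τ => reProd n m (ψ τ x)).OrdConnected ∧
      ∀ I ⊆ range fun τ => reProd n m (ψ τ x), IsOpen I → I.OrdConnected → I.Nonempty →
        g.IsSolutionCurve (reProd n m) I fun t => ψ (μ t) x := by
  set f : ℝ → ℝ := fun τ => reProd n m (ψ τ x) with hf
  have hmono : StrictMono f := hψ.strictMono_reProd hx
  have hcont : Continuous f := continuous_iff_continuousAt.2 fun t =>
    (hψ.hasDerivAt_reProd x t).continuousAt
  have hconn : (range f).OrdConnected := (isPreconnected_range hcont).ordConnected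
  have hemb : IsEmbedding f := hmono.isEmbedding_of_ordConnected hconn
  have hopen : IsOpen (range f) := by
    rw [isOpen_iff_mem_nhds]
    rintro _ ⟨τ, rfl⟩
    exact mem_of_superset (Icc_mem_nhds (hmono (by linarith : τ - 1 < τ))
      (hmono (by linarith : τ < τ + 1))) (hconn.out ⟨_, rfl⟩ ⟨_, rfl⟩)
  set μ : ℝ → ℝ := Function.invFun f with hμ
  have hμf : ∀ τ, μ (f τ) = τ := Function.leftInverse_invFun hmono.injective
  have hfμ : ∀ t ∈ range f, f (μ t) = t := fun t ht => Function.invFun_eq ht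
  refine ⟨μ, hμf, hopen, hconn, fun I hI hIo hIc hIn => ⟨hIo, hIc, hIn, fun t _ =>
    hψ.fderiv_ne_zero hx _, fun t ht => ?_⟩⟩
  have hμc : ContinuousAt μ t := by
    rw [ContinuousAt, hemb.tendsto_nhds_iff, hfμ t (hI ht)]
    refine tendsto_id.congr' ?_
    filter_upwards [hopen.mem_nhds (hI ht)] with s hs using (hfμ s hs).symm
  have hpos := fderiv_tamedGrad_pos (g := g) (hψ.fderiv_ne_zero hx (μ t))
  have hμd := HasDerivAt.of_local_left_inverse hμc (hψ.hasDerivAt_reProd x (μ t)) hpos.ne'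
    (by filter_upwards [hopen.mem_nhds (hI ht)] with s hs using hfμ s hs)
  -- Using the value of `f` as time divides the tamed gradient `X` by `df(X)`, and `X / df(X)` is
  -- `∇f / |∇f|²` because the taming factor cancels.
  have h := HasDerivAt.scomp t (hψ.hasDerivAt x (μ t)) hμd
  have heq : (fderiv ℝ (reProd n m) (ψ (μ t) x) (g.tamedGrad (ψ (μ t) x)))⁻¹ •
      g.tamedGrad (ψ (μ t) x) = g.field (reProd n m) (ψ (μ t) x) := by
    have h0 := (one_add_norm_sq_pos (g.grad (reProd n m) (ψ (μ t) x))).ne'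
    have h1 := (g.form_grad_self_pos (hψ.fderiv_ne_zero hx (μ t))).ne'
    rw [g.field_eq_speedRatio_smul]
    congr 1
    rw [tamedGrad, map_smul, ← g.form_grad, speedRatio, smul_eq_mul]
    field_simp
  rw [heq] at h
  exact h

end IsTamedFlow

variable {g}

theorem IsScaledCurve.reProd_eq {δ : ℝ} {x : ℝ → CSpace n m} (h : g.IsScaledCurve δ x) {σ : ℝ}
    (hσ : σ ∈ Ioo 0 δ) : reProd n m (x σ) = σ ^ n := by
  rw [reProd_eq_re, (h σ hσ).1, ← Complex.ofReal_pow, Complex.ofReal_re]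

theorem root_mem_Ioo {n : ℕ} (hn : 1 ≤ n) {δ t : ℝ} (hδ : 0 < δ) (ht : t ∈ Ioo 0 (δ ^ n)) :
    t ^ ((n : ℝ)⁻¹) ∈ Ioo 0 δ ∧ (t ^ ((n : ℝ)⁻¹)) ^ n = t := by
  have hpow := Real.rpow_inv_natCast_pow ht.1.le (by omega : n ≠ 0)
  refine ⟨⟨Real.rpow_pos_of_pos ht.1 _, ?_⟩, hpow⟩
  refine lt_of_pow_lt_pow_left₀ n hδ.le ?_
  rw [hpow]; exact ht.2

theorem pow_mem_Ioo {n : ℕ} (hn : 1 ≤ n) {δ σ : ℝ} (hσ : σ ∈ Ioo 0 δ) : σ ^ n ∈ Ioo 0 (δ ^ n) :=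
  ⟨pow_pos hσ.1 n, pow_lt_pow_left₀ hσ.2 hσ.1.le (by omega)⟩

theorem IsScaledCurve.isSolutionCurve {δ : ℝ} {x : ℝ → CSpace n m} (h : g.IsScaledCurve δ x)
    (hn : 1 ≤ n) (hδ : 0 < δ) : g.IsSolutionCurve (reProd n m) (Ioo 0 (δ ^ n))
      fun t => x (t ^ ((n : ℝ)⁻¹)) := by
  refine ⟨isOpen_Ioo, ordConnected_Ioo, nonempty_Ioo.2 (pow_pos hδ n), fun t ht => ?_,
    fun t ht => ?_⟩
  · exact h.fderiv_ne_zero hn (root_mem_Ioo hn hδ ht).1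
  · have h1 := h.hasDerivAt_comp_root hn (root_mem_Ioo hn hδ ht).1
    rwa [(root_mem_Ioo hn hδ ht).2] at h1

theorem IsScaledCurve.exists_flow_eq {δ : ℝ} {x : ℝ → CSpace n m} (h : g.IsScaledCurve δ x)
    (hn : 1 ≤ n) {ψ : ℝ → CSpace n m → CSpace n m} (hψ : g.IsTamedFlow ψ) {σ σ' : ℝ}
    (hσ : σ ∈ Ioo 0 δ) (hσ' : σ' ∈ Ioo 0 δ) : ∃ τ, x σ' = ψ τ (x σ) := by
  have h1 := hψ.exists_eq_of_isSolutionCurve (h.isSolutionCurve hn (hσ.1.trans hσ.2))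
    (pow_mem_Ioo hn hσ) (pow_mem_Ioo hn hσ')
  have hn0 : n ≠ 0 := by omega
  rwa [Real.pow_rpow_inv_natCast hσ.1.le hn0, Real.pow_rpow_inv_natCast hσ'.1.le hn0] at h1

/-- A solution curve accumulating at the origin agrees near its start with a given scaled curve. -/
theorem exists_eq_family_of_accumulates (hg : g.IsStandardAt 0) (hn : 1 ≤ n) {δ B : ℝ}
    (hδ : 0 < δ) {x : CSpace n m → ℝ → CSpace n m}
    (hx : ∀ θ ∈ baseTorus n m, g.IsScaledCurve δ (x θ))
    (hB : ∀ θ ∈ baseTorus n m, ∀ σ ∈ Ioo 0 δ, ‖x θ σ - σ • θ‖ ≤ B * σ ^ 2)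
    {I : Set ℝ} {γ : ℝ → CSpace n m} (hγ : g.IsSolutionCurve (reProd n m) I γ)
    (hacc : AccumulatesBackwardAt I γ 0) :
    (∀ t ∈ I, 0 < reProd n m (γ t)) ∧
      ∃ θ ∈ baseTorus n m, ∃ σ ∈ Ioo 0 δ, ∃ t ∈ I, γ t = x θ σ := by
  have hn0 : n ≠ 0 := by omega
  obtain ⟨a, ha, ⟨b, hb, hbI⟩, hsmall⟩ := exists_start_of_accumulates hn hγ hacc
  refine ⟨fun t ht => ?_, ?_⟩
  · rw [reProd_eq_re, (ha t ht).2, Complex.ofReal_re]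
    linarith [(ha t ht).1]
  set δ₁ : ℝ := (b - a) ^ ((n : ℝ)⁻¹) with hδ₁
  have hδ₁pos : 0 < δ₁ := Real.rpow_pos_of_pos (by linarith) _
  have hδ₁n : δ₁ ^ n = b - a := Real.rpow_inv_natCast_pow (by linarith) hn0
  have hI : ∀ σ ∈ Ioo 0 δ₁, a + σ ^ n ∈ I := by
    intro σ hσ
    have := pow_mem_Ioo hn hσ
    rw [hδ₁n] at this
    exact hbI ⟨by linarith [this.1], by linarith [this.2]⟩
  have hsc : g.IsScaledCurve δ₁ fun σ => γ (a + σ ^ n) :=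
    isScaledCurve_of_isSolutionCurve hn hγ (fun t ht => (ha t ht).2) hI
  have hsm : ∀ ε > 0, ∀ c > 0, ∃ σ ∈ Ioo 0 δ₁, σ < c ∧ ‖γ (a + σ ^ n)‖ < ε := by
    intro ε hε c hc
    obtain ⟨t, htI, ht, htε⟩ := hsmall ε hε (a + (min c δ₁) ^ n) (by
      have : 0 < (min c δ₁) ^ n := by positivity
      linarith)
    have h1 := (ha t htI).1
    have h2 := root_mem_Ioo hn (by positivity : 0 < min c δ₁)
      (⟨by linarith, by linarith⟩ : t - a ∈ Ioo 0 ((min c δ₁) ^ n))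
    refine ⟨_, ⟨h2.1.1, h2.1.2.trans_le (min_le_right _ _)⟩, h2.1.2.trans_le (min_le_left _ _), ?_⟩
    rw [h2.2, add_sub_cancel]
    exact htε
  obtain ⟨C, hC, δ₂, hδ₂, hδ₂₁, hle⟩ := hsc.exists_norm_le hn hδ₁pos hsm
  obtain ⟨θ, hθ, B', δ₃, hδ₃, hδ₃₂, hdir⟩ := (hsc.mono hδ₂₁).exists_direction hg hn hδ₂ hC hle
  have hmin : 0 < min δ δ₃ := by positivity
  obtain ⟨δ₄, hδ₄, hδ₄le, heq⟩ := ((hsc.mono (hδ₃₂.trans hδ₂₁)).mono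
    (min_le_right δ δ₃)).eq_of_same_direction hg hn ((hx θ hθ).mono (min_le_left δ δ₃)) hmin hθ
    (B := max B B') (fun σ hσ => (hdir σ ⟨hσ.1, hσ.2.trans_le (min_le_right _ _)⟩).trans
      (mul_le_mul_of_nonneg_right (le_max_right _ _) (sq_nonneg σ)))
    (fun σ hσ => (hB θ hθ σ ⟨hσ.1, hσ.2.trans_le (min_le_left _ _)⟩).trans
      (mul_le_mul_of_nonneg_right (le_max_left _ _) (sq_nonneg σ)))
  -- A single common point suffices, since both curves run in orbits of the same flow.
  have h4 : δ₄ / 2 ∈ Ioo 0 δ₄ := ⟨by linarith, by linarith⟩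
  have h4δ : δ₄ / 2 < min δ δ₃ := h4.2.trans_le hδ₄le
  exact ⟨θ, hθ, δ₄ / 2, ⟨h4.1, h4δ.trans_le (min_le_left _ _)⟩, a + (δ₄ / 2) ^ n,
    hI _ ⟨h4.1, h4δ.trans_le ((min_le_right _ _).trans (hδ₃₂.trans hδ₂₁))⟩, heq _ h4⟩

end HermitianMetric

/-! ### The global family of curves coming out of the origin. -/

namespace HermitianMetric

open Set

variable {n m : ℕ} (g : HermitianMetric n m)

/-- A parametrization of the unstable variety at the origin: `Q θ r` runs through the solution
curve coming out of the origin in the direction `θ`. -/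
structure IsUnstableFamily (Q : CSpace n m → ℝ → CSpace n m) : Prop where
  continuousOn : ContinuousOn (fun q : CSpace n m × ℝ => Q q.1 q.2) (baseTorus n m ×ˢ Ioi 0)
  approx : ∃ σ₀ > 0, ∃ B ≥ 0, ∀ θ ∈ baseTorus n m, ∀ r ∈ Ioc 0 σ₀, ‖Q θ r - r • θ‖ ≤ B * r ^ 2
  injective : ∀ θ ∈ baseTorus n m, ∀ θ' ∈ baseTorus n m, ∀ r > 0, ∀ r' > 0, Q θ r = Q θ' r' →
    θ = θ' ∧ r = r'
  ne_zero : ∀ θ ∈ baseTorus n m, ∀ r > 0, Q θ r ≠ 0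
  bounded_zero : ∃ R, ∀ᶠ z in 𝓝 0, ∀ θ ∈ baseTorus n m, ∀ r > 0, Q θ r = z → r ≤ R
  bounded : ∀ θ₀ ∈ baseTorus n m, ∀ r₀ > 0, ∃ R, ∀ᶠ z in 𝓝 (Q θ₀ r₀), ∀ θ ∈ baseTorus n m,
    ∀ r > 0, Q θ r = z → r ≤ R
  curve : ∀ θ ∈ baseTorus n m, ∃ (I : Set ℝ) (γ : ℝ → CSpace n m),
    g.IsSolutionCurve (reProd n m) I γ ∧ ComesOutOf I γ 0 (‖θ‖⁻¹ • θ) ∧ γ '' I = Q θ '' Ioi 0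
  accumulates : ∀ (I : Set ℝ) (γ : ℝ → CSpace n m), g.IsSolutionCurve (reProd n m) I γ →
    AccumulatesBackwardAt I γ 0 → ∃ θ ∈ baseTorus n m, γ '' I ⊆ Q θ '' Ioi 0

variable {g}

theorem reProd_zero (hn : 1 ≤ n) : reProd n m 0 = 0 := by
  have hn0 : n ≠ 0 := by omega
  simp [reProd, hn0]

theorem tendsto_inv_smul_of_norm_sub_le {x : ℝ → CSpace n m} {θ : CSpace n m} {B δ : ℝ} (hδ : 0 < δ)
    (h : ∀ σ ∈ Ioo 0 δ, ‖x σ - σ • θ‖ ≤ B * σ ^ 2) :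
    Tendsto (fun σ => σ⁻¹ • x σ) (𝓝[>] 0) (𝓝 θ) := by
  rw [tendsto_iff_norm_sub_tendsto_zero]
  have := tendsto_zero_of_norm_le_mul (f := fun s => s⁻¹ • x s - θ) (C := B) hδ fun s hs => by
    have hs1 : s⁻¹ • x s - θ = s⁻¹ • (x s - s • θ) := by
      rw [smul_sub, inv_smul_smul₀ hs.1.ne']
    rw [hs1, norm_smul, norm_inv, Real.norm_of_nonneg hs.1.le, inv_mul_le_iff₀ hs.1]
    have := h s hs
    nlinarith
  simpa using this.norm

theorem tendsto_root_nhdsGT_zero (hn : 1 ≤ n) :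
    Tendsto (fun t : ℝ => t ^ ((n : ℝ)⁻¹)) (𝓝[>] 0) (𝓝[>] 0) := by
  have hn0 : (n : ℝ)⁻¹ ≠ 0 := inv_ne_zero (by exact_mod_cast (by omega : n ≠ 0))
  refine tendsto_nhdsWithin_iff.2 ⟨?_, ?_⟩
  · have h := (Real.continuousAt_rpow_const 0 ((n : ℝ)⁻¹) (Or.inr (by positivity))).tendsto
    rw [Real.zero_rpow hn0] at h
    exact h.mono_left nhdsWithin_le_nhds
  · filter_upwards [self_mem_nhdsWithin] with t ht using Real.rpow_pos_of_pos ht _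

/-- A curve which for small times is a scaled curve in terms of `σ = t^{1/n}` comes out of the
origin. -/
theorem comesOutOf_of_eq_root (hn : 1 ≤ n) {I : Set ℝ} {γ : ℝ → CSpace n m} {x : ℝ → CSpace n m}
    {θ : CSpace n m} {B δ : ℝ} (hδ : 0 < δ) (hθ : θ ∈ baseTorus n m)
    (h : ∀ σ ∈ Ioo 0 δ, ‖x σ - σ • θ‖ ≤ B * σ ^ 2) (hI0 : I ⊆ Ioi 0) {c : ℝ} (hc : 0 < c)
    (hI : Ioo 0 c ⊆ I) (heq : ∀ t ∈ Ioo 0 c, γ t = x (t ^ ((n : ℝ)⁻¹))) :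
    ComesOutOf I γ 0 (‖θ‖⁻¹ • θ) := by
  have hθ0 : ‖θ‖ ≠ 0 := (norm_pos_of_mem_baseTorus hn hθ).ne'
  have hmap : map ((↑) : I → ℝ) atBot = 𝓝[>] 0 :=
    map_coe_atBot_of_Ioo_subset hI0 fun b' hb' =>
      ⟨min b' c, lt_min hb' hc, fun t ht => hI ⟨ht.1, ht.2.trans_le (min_le_right _ _)⟩⟩
  have hval : Tendsto ((↑) : I → ℝ) atBot (𝓝[>] 0) := hmap.le
  have hroot := tendsto_root_nhdsGT_zero hn
  have hy := tendsto_inv_smul_of_norm_sub_le hδ h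
  have hx : Tendsto x (𝓝[>] 0) (𝓝 0) := by
    have h1 : Tendsto (fun σ : ℝ => σ) (𝓝[>] 0) (𝓝 0) := nhdsWithin_le_nhds
    have h2 := h1.smul hy
    rw [zero_smul] at h2
    refine h2.congr' ?_
    filter_upwards [self_mem_nhdsWithin] with σ hσ
    exact smul_inv_smul₀ (ne_of_gt hσ) _
  have hev : ∀ᶠ t in 𝓝[>] (0 : ℝ), x (t ^ ((n : ℝ)⁻¹)) = γ t := by
    filter_upwards [Ioo_mem_nhdsGT hc] with t ht using (heq t ht).symm
  refine ⟨by rw [norm_smul, norm_inv, norm_norm, inv_mul_cancel₀ hθ0], ?_, ?_⟩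
  · exact ((hx.comp hroot).congr' hev).comp hval
  · have h1 : Tendsto (fun σ : ℝ => ‖σ⁻¹ • x σ‖⁻¹ • σ⁻¹ • x σ) (𝓝[>] 0) (𝓝 (‖θ‖⁻¹ • θ)) :=
      (hy.norm.inv₀ hθ0).smul hy
    have h2 : Tendsto (fun t => ‖γ t - 0‖⁻¹ • (γ t - 0)) (𝓝[>] 0) (𝓝 (‖θ‖⁻¹ • θ)) := by
      refine (h1.comp hroot).congr' ?_
      filter_upwards [hev, self_mem_nhdsWithin] with t ht ht0
      have hpos : 0 < t ^ ((n : ℝ)⁻¹) := Real.rpow_pos_of_pos ht0 _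
      simp only [Function.comp]
      rw [sub_zero, ← ht, norm_smul, norm_inv, Real.norm_of_nonneg hpos.le, smul_smul, mul_inv,
        inv_inv, mul_right_comm, mul_inv_cancel₀ hpos.ne', one_mul]
    exact h2.comp hval

/-- The local curves are used up to `σ₀` and the tamed flow beyond. Along each resulting curve `f`
is positive and strictly increasing, which recovers `r`; the direction `θ` is recovered as the limit
of `x / σ` at the origin. -/
theorem exists_isUnstableFamily (hg : g.IsStandardAt 0) (hn : 1 ≤ n) :
    ∃ Q, g.IsUnstableFamily Q := by
  obtain ⟨δ, hδ, B, hB0, x, hxc, hxB, hxd⟩ := g.exists_local_family hg hn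
  have hxB' : ∀ θ ∈ baseTorus n m, ∀ σ ∈ Ioo 0 δ, ‖x θ σ - σ • θ‖ ≤ B * σ ^ 2 :=
    fun θ hθ σ hσ => hxB θ hθ σ (Ioo_subset_Ioc_self hσ)
  have hx : ∀ θ ∈ baseTorus n m, g.IsScaledCurve δ (x θ) := fun θ hθ =>
    isScaledCurve_of_hasDerivAt hn hθ (hxB' θ hθ) (hxd θ hθ)
  obtain ⟨ψ, hψ⟩ := g.exists_isTamedFlow
  set σ₀ : ℝ := δ / 2 with hσ₀def
  have hσ₀ : 0 < σ₀ := by positivity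
  have hσ₀δ : σ₀ < δ := by rw [hσ₀def]; linarith
  have hσ₀mem : σ₀ ∈ Ioo 0 δ := ⟨hσ₀, hσ₀δ⟩
  have hlocal : ∀ {r}, r ∈ Ioc 0 σ₀ → r ∈ Ioo 0 δ := fun hr => ⟨hr.1, hr.2.trans_lt hσ₀δ⟩
  have hb0 : ∀ θ ∈ baseTorus n m, fderiv ℝ (reProd n m) (x θ σ₀) ≠ 0 := fun θ hθ =>
    (hx θ hθ).fderiv_ne_zero hn hσ₀mem
  have hmono : ∀ θ ∈ baseTorus n m, StrictMono fun τ => reProd n m (ψ τ (x θ σ₀)) := fun θ hθ =>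
    hψ.strictMono_reProd (hb0 θ hθ)
  have hbval : ∀ θ ∈ baseTorus n m, reProd n m (ψ 0 (x θ σ₀)) = σ₀ ^ n := fun θ hθ => by
    rw [hψ.zero, (hx θ hθ).reProd_eq hσ₀mem]
  have hcontf : Continuous (reProd n m) := contDiff_reProd.continuous
  -- Truncating both arguments glues the two regimes in one jointly continuous formula, as the flow
  -- at time `0` is the identity. Beyond `σ₀` the parameter `r - σ₀` is flow time and no longer
  -- determined by the `n`-th root of `f`.
  set Q : CSpace n m → ℝ → CSpace n m := fun θ r => ψ (max (r - σ₀) 0) (x θ (min r σ₀)) with hQ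
  have hQle : ∀ θ r, r ≤ σ₀ → Q θ r = x θ r := by
    intro θ r hr
    simp only [hQ]
    rw [max_eq_right (by linarith), min_eq_left hr, hψ.zero]
  have hQge : ∀ θ r, σ₀ ≤ r → Q θ r = ψ (r - σ₀) (x θ σ₀) := by
    intro θ r hr
    simp only [hQ]
    rw [max_eq_left (by linarith), min_eq_right hr]
  have hQlef : ∀ θ ∈ baseTorus n m, ∀ r ∈ Ioc 0 σ₀, reProd n m (Q θ r) = r ^ n := by
    intro θ hθ r hr
    rw [hQle θ r hr.2, (hx θ hθ).reProd_eq (hlocal hr)]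
  have hQgef : ∀ θ ∈ baseTorus n m, ∀ r > σ₀, σ₀ ^ n < reProd n m (Q θ r) := by
    intro θ hθ r hr
    rw [hQge θ r hr.le, ← hbval θ hθ]
    exact hmono θ hθ (by linarith)
  have hQpos : ∀ θ ∈ baseTorus n m, ∀ r > 0, 0 < reProd n m (Q θ r) := by
    intro θ hθ r hr
    rcases le_or_gt r σ₀ with h | h
    · rw [hQlef θ hθ r ⟨hr, h⟩]; positivity
    · exact (pow_pos hσ₀ n).trans (hQgef θ hθ r h)
  have hQmono : ∀ θ ∈ baseTorus n m, StrictMonoOn (fun r => reProd n m (Q θ r)) (Ioi 0) := by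
    intro θ hθ r hr r' hr' hlt
    simp only
    rcases le_or_gt r' σ₀ with h' | h'
    · rw [hQlef θ hθ r ⟨hr, hlt.le.trans h'⟩, hQlef θ hθ r' ⟨hr', h'⟩]
      exact pow_lt_pow_left₀ hlt (le_of_lt hr) (by omega)
    · rcases le_or_gt r σ₀ with h | h
      · rw [hQlef θ hθ r ⟨hr, h⟩]
        exact (pow_le_pow_left₀ (le_of_lt hr) h n).trans_lt (hQgef θ hθ r' h')
      · rw [hQge θ r h.le, hQge θ r' h'.le]
        exact hmono θ hθ (by linarith)
  have horb : ∀ θ ∈ baseTorus n m, ∀ r > 0, ∃ τ, Q θ r = ψ τ (x θ σ₀) := by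
    intro θ hθ r hr
    rcases le_or_gt r σ₀ with h | h
    · rw [hQle θ r h]
      exact (hx θ hθ).exists_flow_eq hn hψ hσ₀mem (hlocal ⟨hr, h⟩)
    · exact ⟨r - σ₀, hQge θ r h.le⟩
  -- For `τ < 0` the value of `f` lies in `(0, σ₀ⁿ)`; its `n`-th root gives the parameter `r`, and
  -- strict monotonicity of `f` on the orbit identifies the two points.
  have hsurj : ∀ θ ∈ baseTorus n m, ∀ τ, 0 < reProd n m (ψ τ (x θ σ₀)) →
      ψ τ (x θ σ₀) ∈ Q θ '' Ioi 0 := by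
    intro θ hθ τ hτ
    rcases le_or_gt 0 τ with h | h
    · refine ⟨τ + σ₀, by simp only [mem_Ioi]; linarith, ?_⟩
      rw [hQge θ _ (by linarith), add_sub_cancel_right]
    · have hlt := hmono θ hθ h
      simp only [hbval θ hθ] at hlt
      obtain ⟨hr, hrn⟩ := root_mem_Ioo hn hσ₀ ⟨hτ, hlt⟩
      set r := (reProd n m (ψ τ (x θ σ₀))) ^ ((n : ℝ)⁻¹) with hrdef
      refine ⟨r, hr.1, ?_⟩
      obtain ⟨τ', hτ'⟩ := horb θ hθ r hr.1
      have h1 := hQlef θ hθ r (Ioo_subset_Ioc_self hr)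
      rw [hrn, hτ'] at h1
      rw [hτ', (hmono θ hθ).injective h1]
  -- A common point makes the orbits coincide. Matching values of `f` then shows that the two local
  -- curves agree for all small `σ`, and so do their limiting directions.
  have hinjθ : ∀ θ ∈ baseTorus n m, ∀ θ' ∈ baseTorus n m, ∀ τ τ',
      ψ τ (x θ σ₀) = ψ τ' (x θ' σ₀) → θ = θ' := by
    intro θ hθ θ' hθ' τ τ' h
    have h1 : ∀ s, ψ s (x θ σ₀) = ψ (s - τ + τ') (x θ' σ₀) := by
      intro s
      have : s = (s - τ) + τ := by ring
      conv_lhs => rw [this]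
      rw [hψ.add_apply, h, ← hψ.add_apply]
    have h2 : ∀ σ ∈ Ioc 0 σ₀, x θ σ = x θ' σ := by
      intro σ hσ
      obtain ⟨s, hs⟩ := horb θ hθ σ hσ.1
      obtain ⟨s', hs'⟩ := horb θ' hθ' σ hσ.1
      have h3 := hQlef θ hθ σ hσ
      have h4 := hQlef θ' hθ' σ hσ
      rw [← hQle θ σ hσ.2, ← hQle θ' σ hσ.2, hs, hs', h1]
      rw [hs, h1] at h3
      rw [hs'] at h4
      rw [(hmono θ' hθ').injective (h3.trans h4.symm)]
    have h5 := tendsto_inv_smul_of_norm_sub_le hδ (hxB' θ hθ)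
    have h6 := tendsto_inv_smul_of_norm_sub_le hδ (hxB' θ' hθ')
    refine tendsto_nhds_unique (h5.congr' ?_) h6
    filter_upwards [Ioc_mem_nhdsGT hσ₀] with σ hσ
    rw [h2 σ hσ]
  refine ⟨Q, ?_, ⟨σ₀, hσ₀, B, hB0, fun θ hθ r hr => ?_⟩, ?_, ?_, ?_, ?_, ?_, ?_⟩
  · have h1 : ContinuousOn (fun q : CSpace n m × ℝ => x q.1 (min q.2 σ₀))
        (baseTorus n m ×ˢ Ioi 0) :=
      hxc.comp (f := fun q : CSpace n m × ℝ => (q.1, min q.2 σ₀)) (by fun_prop) fun q hq =>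
        ⟨hq.1, lt_min hq.2 hσ₀, (min_le_right _ _).trans hσ₀δ.le⟩
    exact hψ.continuous.comp_continuousOn (ContinuousOn.prodMk (by fun_prop) h1)
  · rw [hQle θ r hr.2]
    exact hxB' θ hθ r (hlocal hr)
  · intro θ hθ θ' hθ' r hr r' hr' h
    obtain ⟨τ, hτ⟩ := horb θ hθ r hr
    obtain ⟨τ', hτ'⟩ := horb θ' hθ' r' hr'
    have h1 : θ = θ' := hinjθ θ hθ θ' hθ' τ τ' (by rw [← hτ, ← hτ', h])
    refine ⟨h1, (hQmono θ hθ).injOn hr hr' ?_⟩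
    rw [h, h1]
  · intro θ hθ r hr h
    have := hQpos θ hθ r hr
    rw [h, reProd_zero hn] at this
    exact lt_irrefl _ this
  -- Near the origin `f < σ₀ⁿ`, whereas `f > σ₀ⁿ` on the part `r > σ₀`.
  · refine ⟨σ₀, ?_⟩
    have hnhds : {z : CSpace n m | reProd n m z < σ₀ ^ n} ∈ 𝓝 0 :=
      (isOpen_lt hcontf continuous_const).mem_nhds (by
        simp only [mem_ofPred_eq, reProd_zero hn]; positivity)
    filter_upwards [hnhds] with z hz θ hθ r hr hQz
    by_contra! hlt
    have := hQgef θ hθ r hlt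
    rw [hQz] at this
    exact lt_asymm hz this
  · intro θ₀ hθ₀ r₀ hr₀
    obtain ⟨τ₀, hτ₀⟩ := horb θ₀ hθ₀ r₀ hr₀
    -- Flowing backwards for a time `T > τ₀` brings `Q θ₀ r₀` strictly below the level `σ₀ⁿ`, which
    -- is an open condition; points with `r > σ₀ + T` remain above that level.
    set T : ℝ := max τ₀ 0 + 1 with hT
    refine ⟨σ₀ + T, ?_⟩
    have hnhds : {z : CSpace n m | reProd n m (ψ (-T) z) < σ₀ ^ n} ∈ 𝓝 (Q θ₀ r₀) := by
      refine (isOpen_lt (hcontf.comp (hψ.continuous.comp (by fun_prop : Continuous fun z =>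
        ((-T, z) : ℝ × CSpace n m)))) continuous_const).mem_nhds ?_
      simp only [mem_ofPred_eq, Function.comp]
      rw [hτ₀, ← hψ.add_apply, ← hbval θ₀ hθ₀]
      refine hmono θ₀ hθ₀ ?_
      have := le_max_left τ₀ 0
      rw [hT]; linarith
    filter_upwards [hnhds] with z hz θ hθ r hr hQz
    by_contra! hlt
    have hTpos : 0 < T := by have := le_max_right τ₀ 0; rw [hT]; linarith
    rw [← hQz, hQge θ r (by linarith), ← hψ.add_apply, ← hbval θ hθ] at hz
    have := (hmono θ hθ).lt_iff_lt.1 hz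
    linarith
  · intro θ hθ
    obtain ⟨μ, hμ, hJo, hJc, hsol⟩ := hψ.isSolutionCurve_orbit (hb0 θ hθ)
    set J := range fun τ => reProd n m (ψ τ (x θ σ₀)) with hJ
    have hmem : ∀ r > 0, reProd n m (Q θ r) ∈ J ∧ ψ (μ (reProd n m (Q θ r))) (x θ σ₀) = Q θ r := by
      intro r hr
      obtain ⟨τ, hτ⟩ := horb θ hθ r hr
      rw [hτ]
      exact ⟨⟨τ, rfl⟩, by rw [hμ]⟩
    have hsmall : ∀ t ∈ Ioo 0 (σ₀ ^ n), t ∈ J ∧ ψ (μ t) (x θ σ₀) = x θ (t ^ ((n : ℝ)⁻¹)) := by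
      intro t ht
      obtain ⟨hr, hrn⟩ := root_mem_Ioo hn hσ₀ ht
      have h1 := hmem _ hr.1
      rw [hQlef θ hθ _ (Ioo_subset_Ioc_self hr), hrn, hQle θ _ hr.2.le] at h1
      exact h1
    -- Only positive values of `f` are kept: for `n = 1` the origin is a regular point and the orbit
    -- continues through it.
    refine ⟨J ∩ Ioi 0, fun t => ψ (μ t) (x θ σ₀), hsol _ inter_subset_left (hJo.inter isOpen_Ioi)
      (hJc.inter ordConnected_Ioi) ⟨_, (hmem 1 one_pos).1, hQpos θ hθ 1 one_pos⟩, ?_, ?_⟩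
    · exact comesOutOf_of_eq_root hn hδ hθ (hxB' θ hθ) inter_subset_right (pow_pos hσ₀ n)
        (fun t ht => ⟨(hsmall t ht).1, ht.1⟩) fun t ht => (hsmall t ht).2
    · refine Subset.antisymm ?_ ?_
      · rintro _ ⟨t, ⟨⟨τ, rfl⟩, ht⟩, rfl⟩
        simp only [hμ]
        exact hsurj θ hθ τ ht
      · rintro _ ⟨r, hr, rfl⟩
        exact ⟨reProd n m (Q θ r), ⟨(hmem r hr).1, hQpos θ hθ r hr⟩, (hmem r hr).2⟩
  · intro I γ hγ hacc
    obtain ⟨hpos, θ, hθ, σ, hσ, t₀, ht₀, heq⟩ :=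
      exists_eq_family_of_accumulates hg hn hδ hx hxB' hγ hacc
    refine ⟨θ, hθ, ?_⟩
    rintro _ ⟨t, ht, rfl⟩
    obtain ⟨τ, hτ⟩ := hψ.exists_eq_of_isSolutionCurve hγ ht₀ ht
    obtain ⟨τ', hτ'⟩ := (hx θ hθ).exists_flow_eq hn hψ hσ₀mem hσ
    have h1 : γ t = ψ (τ + τ') (x θ σ₀) := by
      rw [hτ, heq, hτ', ← hψ.add_apply]
    have h2 := hpos t ht
    rw [h1] at h2 ⊢
    exact hsurj θ hθ _ h2

end HermitianMetric

/-! ### Polar coordinates on the standard cone and its torus link. -/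

section Topological

open Set

/-- A continuous bijection to a Hausdorff space is a homeomorphism if the preimage of a
neighbourhood of each point is contained in a compact set. -/
theorem Equiv.continuous_symm_of_locally_compact_preimage {X Y : Type*} [TopologicalSpace X]
    [TopologicalSpace Y] [T2Space Y] (e : X ≃ Y) (he : Continuous e)
    (h : ∀ y, ∃ K : Set X, IsCompact K ∧ ∀ᶠ y' in 𝓝 y, e.symm y' ∈ K) : Continuous e.symm := by
  rw [continuous_iff_continuousAt]
  intro y
  obtain ⟨K, hK, hmem⟩ := h y
  refine hK.tendsto_nhds_of_unique_mapClusterPt hmem fun x _ hx => ?_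
  -- Any cluster point of the inverse in `K` is mapped by `e` to a cluster point of the identity at
  -- `y`, hence to `y`. The cluster point is thus unique, and compactness gives convergence.
  have h1 : MapClusterPt (e x) (𝓝 y) (e ∘ e.symm) := hx.continuousAt_comp he.continuousAt
  rw [Equiv.self_comp_symm, mapClusterPt_id_iff] at h1
  have h2 : e x = y := eq_of_nhds_neBot h1.neBot
  rw [← h2, e.symm_apply_apply]

variable {n m : ℕ}

theorem smul_mem_standardCone {θ : CSpace n m} (hθ : θ ∈ baseTorus n m) {r : ℝ} (hr : 0 ≤ r) :
    r • θ ∈ standardCone n m := by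
  refine ⟨fun k => by simp [hθ.2.2], ⟨r ^ n, by positivity, ?_⟩, fun i j => by simp [hθ.1]⟩
  have := coordProd_smul r θ
  rw [hθ.2.1, mul_one] at this
  rw [coordProd] at this
  rw [this]; push_cast; rfl

/-- Polar coordinates on the standard cone. -/
theorem exists_polar_of_mem_standardCone (hn : 1 ≤ n) {v : CSpace n m} (hv : v ∈ standardCone n m)
    (hv0 : v ≠ 0) : ∃ θ ∈ baseTorus n m, ∃ r > (0 : ℝ), v = r • θ := by
  obtain ⟨h1, ⟨c, hc, hprod⟩, h3⟩ := hv
  set i₀ : Fin n := ⟨0, hn⟩ with hi₀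
  set r : ℝ := ‖v (Sum.inl i₀)‖ with hr
  have hri : ∀ i, ‖v (Sum.inl i)‖ = r := fun i => h3 i i₀
  have hrpos : 0 < r := by
    refine lt_of_le_of_ne (norm_nonneg _) fun h0 => hv0 ?_
    ext k
    rcases k with i | k
    · have := hri i
      rw [← h0, norm_eq_zero] at this
      simpa using this
    · simpa using h1 k
  have hcr : c = r ^ n := by
    have h4 := congrArg norm hprod
    rw [norm_prod, Finset.prod_congr rfl fun i _ => hri i, Complex.norm_real,
      Real.norm_of_nonneg hc] at h4
    simpa using h4.symm
  refine ⟨r⁻¹ • v, ⟨fun i => ?_, ?_, fun k => by simp [h1 k]⟩, r, hrpos,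
    (smul_inv_smul₀ hrpos.ne' v).symm⟩
  · rw [PiLp.smul_apply, norm_smul, hri, norm_inv, Real.norm_of_nonneg hrpos.le,
      inv_mul_cancel₀ hrpos.ne']
  · have hr0 : (r : ℂ) ≠ 0 := by exact_mod_cast hrpos.ne'
    rw [coordProd_smul, coordProd, hprod, hcr]
    push_cast
    rw [← mul_pow, inv_mul_cancel₀ hr0, one_pow]

theorem isClosed_standardCone : IsClosed (standardCone n m) := by
  have hreal : IsClosed {c : ℂ | ∃ r : ℝ, 0 ≤ r ∧ c = r} := by
    have : {c : ℂ | ∃ r : ℝ, 0 ≤ r ∧ c = r} = {c | 0 ≤ c.re} ∩ {c | c.im = 0} := by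
      ext c
      constructor
      · rintro ⟨r, hr, rfl⟩
        simpa using hr
      · rintro ⟨h1, h2⟩
        exact ⟨c.re, h1, Complex.ext (by simp) (by simpa using h2)⟩
    rw [this]
    exact (isClosed_le continuous_const Complex.continuous_re).inter
      (isClosed_eq Complex.continuous_im continuous_const)
  refine IsClosed.inter ?_ (IsClosed.inter ?_ ?_)
  · change IsClosed {v : CSpace n m | ∀ k : Fin m, v (Sum.inr k) = 0}
    simp only [Set.ofPred_forall]
    exact isClosed_iInter fun i => isClosed_eq (continuous_coord _) continuous_const
  · exact hreal.preimage continuous_coordProd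
  · change IsClosed {v : CSpace n m | ∀ i j : Fin n, ‖v (Sum.inl i)‖ = ‖v (Sum.inl j)‖}
    simp only [Set.ofPred_forall]
    exact isClosed_iInter fun i => isClosed_iInter fun j =>
      isClosed_eq (continuous_coord _).norm (continuous_coord _).norm

theorem isCompact_bounded_standardCone (R : ℝ) :
    IsCompact {v : standardCone n m | ‖(v : CSpace n m)‖ ≤ R} := by
  have h := isClosed_standardCone.isClosedEmbedding_subtypeVal.isCompact_preimage
    (isCompact_closedBall (0 : CSpace n m) R)
  refine h.of_isClosed_subset (isClosed_le continuous_subtype_val.norm continuous_const)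
    fun v hv => ?_
  simpa using hv

theorem zero_mem_standardCone (hn : 1 ≤ n) : (0 : CSpace n m) ∈ standardCone n m :=
  ⟨fun k => rfl, ⟨0, le_rfl, by
    have : n ≠ 0 := by omega
    simp [this]⟩, fun i j => rfl⟩

theorem norm_of_mem_baseTorus {θ : CSpace n m} (hθ : θ ∈ baseTorus n m) : ‖θ‖ = √n := by
  rw [← norm_sq_of_mem_baseTorus hθ, Real.sqrt_sq (norm_nonneg _)]

theorem sqrt_natCast_pos (hn : 1 ≤ n) : 0 < √(n : ℝ) := Real.sqrt_pos.2 (by exact_mod_cast hn)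

/-- The point of the base torus with the given last `k` of the `k + 1` arguments. -/
def torusPoint (k m : ℕ) (x : Torus k) : CSpace (k + 1) m :=
  WithLp.toLp 2 (Sum.elim (Fin.cons (∏ i, (x i : ℂ))⁻¹ fun i => (x i : ℂ)) fun _ => 0)

theorem torusPoint_mem (k m : ℕ) (x : Torus k) : torusPoint k m x ∈ baseTorus (k + 1) m := by
  refine ⟨fun i => ?_, ?_, fun _ => rfl⟩
  · refine Fin.cases ?_ (fun j => ?_) i
    · simp only [torusPoint, Sum.elim_inl, Fin.cons_zero, norm_inv, norm_prod]
      rw [Finset.prod_eq_one fun j _ => Circle.norm_coe (x j), inv_one]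
    · exact Circle.norm_coe (x j)
  · rw [coordProd, Fin.prod_univ_succ]
    simp only [torusPoint, Sum.elim_inl, Fin.cons_zero, Fin.cons_succ]
    exact inv_mul_cancel₀ (Finset.prod_ne_zero_iff.2 fun i _ => Circle.coe_ne_zero _)

theorem torusPoint_injective (k m : ℕ) : Function.Injective (torusPoint k m) := by
  intro x y h
  funext i
  have := congrArg (fun v : CSpace (k + 1) m => v (Sum.inl i.succ)) h
  exact Circle.coe_injective this

theorem exists_torusPoint_eq {k m : ℕ} {θ : CSpace (k + 1) m} (hθ : θ ∈ baseTorus (k + 1) m) :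
    ∃ x, torusPoint k m x = θ := by
  have hex : ∀ i : Fin k, ∃ c : Circle, (c : ℂ) = θ (Sum.inl i.succ) := fun i =>
    ⟨⟨θ (Sum.inl i.succ), mem_sphere_zero_iff_norm.2 (hθ.1 _)⟩, rfl⟩
  choose x hx using hex
  have h := hθ.2.1
  rw [coordProd, Fin.prod_univ_succ] at h
  refine ⟨x, ?_⟩
  ext i
  rcases i with i | i
  · refine Fin.cases ?_ (fun j => ?_) i
    · simp only [torusPoint, Sum.elim_inl, Fin.cons_zero, hx]
      exact (eq_inv_of_mul_eq_one_left h).symm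
    · simp only [torusPoint, Sum.elim_inl, Fin.cons_succ, hx]
  · exact (hθ.2.2 i).symm

theorem continuous_torusPoint (k m : ℕ) : Continuous (torusPoint k m) := by
  have hc : ∀ i, Continuous fun x : Torus k => (x i : ℂ) := fun i =>
    continuous_subtype_val.comp (continuous_apply i)
  refine (PiLp.continuous_toLp 2 _).comp (continuous_pi ?_)
  rintro (i | i)
  · refine Fin.cases ?_ (fun j => ?_) i
    · simp only [Sum.elim_inl, Fin.cons_zero]
      exact (continuous_finsetProd _ fun i _ => hc i).inv₀ fun x =>
        Finset.prod_ne_zero_iff.2 fun i _ => Circle.coe_ne_zero _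
    · simp only [Sum.elim_inl, Fin.cons_succ]
      exact hc j
  · exact continuous_const

/-- Scaling points of the torus covers the cone. All these points have norm `√(k + 1)`, so the norm
recovers the cone parameter, and bounded parts of the cone come from compact parts of the product
with `[0, ∞)`. -/
theorem isConeOverTorus_standardCone (k m : ℕ) :
    IsConeOverTorus k (standardCone (k + 1) m) := by
  let F : Torus k × NNReal → standardCone (k + 1) m := fun q =>
    ⟨(q.2 : ℝ) • torusPoint k m q.1, smul_mem_standardCone (torusPoint_mem k m q.1) q.2.2⟩
  have hF : Continuous F := by
    refine Continuous.subtype_mk ?_ _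
    exact (NNReal.continuous_coe.comp continuous_snd).smul
      ((continuous_torusPoint k m).comp continuous_fst)
  have hFr : ∀ a b : Torus k × NNReal, (coneSetoid (Torus k)) a b → F a = F b := by
    rintro a b (rfl | ⟨ha, hb⟩)
    · rfl
    · exact Subtype.ext (by simp [F, ha, hb])
  let f : TopCone (Torus k) → standardCone (k + 1) m := Quotient.lift F hFr
  have hf : Continuous f := Continuous.quotient_lift hF hFr
  have hfmk : ∀ x t, f (TopCone.mk x t) = F (x, t) := fun x t => rfl
  have hinj : Function.Injective f := by
    rintro ⟨x, t⟩ ⟨y, s⟩ h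
    have h1 : (t : ℝ) • torusPoint k m x = (s : ℝ) • torusPoint k m y := congrArg Subtype.val h
    have hts : t = s := by
      have h2 := congrArg norm h1
      rw [norm_smul, norm_smul, norm_of_mem_baseTorus (torusPoint_mem k m x),
        norm_of_mem_baseTorus (torusPoint_mem k m y)] at h2
      have h3 := mul_right_cancel₀ (sqrt_natCast_pos (by omega : 1 ≤ k + 1)).ne' h2
      simpa using h3
    subst hts
    refine Quotient.sound ?_
    rcases eq_or_ne t 0 with ht | ht
    · exact Or.inr ⟨ht, ht⟩
    · have h3 := smul_right_injective (CSpace (k + 1) m) (NNReal.coe_ne_zero.2 ht) h1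
      exact Or.inl (by rw [torusPoint_injective k m h3])
  have hsurj : Function.Surjective f := by
    rintro ⟨v, hv⟩
    by_cases hv0 : v = 0
    · subst hv0
      exact ⟨TopCone.mk 1 0, Subtype.ext (by simp [hfmk, F])⟩
    · obtain ⟨θ, hθ, r, hr, rfl⟩ := exists_polar_of_mem_standardCone (by omega) hv hv0
      obtain ⟨x, rfl⟩ := exists_torusPoint_eq hθ
      exact ⟨TopCone.mk x ⟨r, hr.le⟩, rfl⟩
  let e : TopCone (Torus k) ≃ standardCone (k + 1) m := Equiv.ofBijective f ⟨hinj, hsurj⟩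
  have hsymm : Continuous e.symm := by
    refine e.continuous_symm_of_locally_compact_preimage hf fun v => ?_
    have hc : IsCompact ((univ : Set (Torus k)) ×ˢ Icc (0 : NNReal) (‖(v : CSpace (k + 1) m)‖₊ + 1)) :=
      isCompact_univ.prod isCompact_Icc
    refine ⟨(fun q : Torus k × NNReal => TopCone.mk q.1 q.2) '' _,
      hc.image (continuous_quotient_mk' (s := coneSetoid (Torus k))), ?_⟩
    have hev : ∀ᶠ v' : standardCone (k + 1) m in 𝓝 v,
        ‖(v' : CSpace (k + 1) m)‖ < ‖(v : CSpace (k + 1) m)‖ + 1 :=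
      (isOpen_lt continuous_subtype_val.norm continuous_const).mem_nhds (by simp)
    filter_upwards [hev] with v' hv'
    obtain ⟨q, hq⟩ := e.surjective v'
    rw [← hq, e.symm_apply_apply]
    obtain ⟨⟨x, t⟩, rfl⟩ := Quotient.exists_rep q
    refine ⟨(x, t), ⟨mem_univ _, zero_le, ?_⟩, rfl⟩
    rw [← hq] at hv'
    have h1 : ((e (Quotient.mk _ (x, t)) : standardCone (k + 1) m) : CSpace (k + 1) m) =
        (t : ℝ) • torusPoint k m x := rfl
    rw [h1, norm_smul, Real.norm_of_nonneg t.coe_nonneg,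
      norm_of_mem_baseTorus (torusPoint_mem k m x)] at hv'
    -- Torus points have norm at least `1`, so the cone parameter is bounded by the norm of the
    -- vector.
    have h2 : 1 ≤ √((k + 1 : ℕ) : ℝ) := by
      rw [Real.one_le_sqrt]; push_cast; linarith [(Nat.cast_nonneg k : (0 : ℝ) ≤ k)]
    have h3 : (t : ℝ) ≤ ‖(v : CSpace (k + 1) m)‖ + 1 := by nlinarith [t.coe_nonneg]
    exact h3
  refine ⟨⟨e, hf, hsymm⟩, fun x t => ?_⟩
  change (t : ℝ) • torusPoint k m x = (t : ℝ) • (((1 : NNReal) : ℝ) • torusPoint k m x)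
  simp

end Topological

/-! ### The homeomorphism from the standard cone to the unstable variety. -/

namespace HermitianMetric

open Set

variable {n m : ℕ} {g : HermitianMetric n m}

theorem accumulatesBackwardAt_of_comesOutOf {I : Set ℝ} {γ : ℝ → CSpace n m} {p u : CSpace n m}
    (hI : I.Nonempty) (h : ComesOutOf I γ p u) : AccumulatesBackwardAt I γ p := by
  have : Nonempty I := hI.to_subtype
  exact h.tendsto.mapClusterPt

namespace IsUnstableFamily

variable {Q : CSpace n m → ℝ → CSpace n m}

/-- A curve coming out of the origin accumulates there, so it already lies in one curve of the
family; its direction need not be compared with `θ`. -/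
theorem mem_unstableVariety_iff (hQ : g.IsUnstableFamily Q) {z : CSpace n m} :
    z ∈ unstableVariety g (reProd n m) 0 ↔ z = 0 ∨ ∃ θ ∈ baseTorus n m, ∃ r > 0, z = Q θ r := by
  constructor
  · rintro (h | ⟨I, γ, u, hγ, hout, hz⟩)
    · exact Or.inl h
    · obtain ⟨θ, hθ, hsub⟩ := hQ.accumulates I γ hγ
        (accumulatesBackwardAt_of_comesOutOf hγ.nonempty hout)
      obtain ⟨r, hr, hrz⟩ := hsub hz
      exact Or.inr ⟨θ, hθ, r, hr, hrz.symm⟩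
  · rintro (h | ⟨θ, hθ, r, hr, rfl⟩)
    · exact Or.inl h
    · obtain ⟨I, γ, hγ, hout, him⟩ := hQ.curve θ hθ
      exact Or.inr ⟨I, γ, _, hγ, hout, by rw [him]; exact ⟨r, hr, rfl⟩⟩

theorem image_subset_unstableVariety (hQ : g.IsUnstableFamily Q) {I : Set ℝ} {γ : ℝ → CSpace n m}
    (hγ : g.IsSolutionCurve (reProd n m) I γ) (hacc : AccumulatesBackwardAt I γ 0) :
    γ '' I ⊆ unstableVariety g (reProd n m) 0 := by
  obtain ⟨θ, hθ, hsub⟩ := hQ.accumulates I γ hγ hacc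
  intro z hz
  obtain ⟨r, hr, hrz⟩ := hsub hz
  exact hQ.mem_unstableVariety_iff.2 (Or.inr ⟨θ, hθ, r, hr, hrz.symm⟩)

/-- The map from the standard cone to the unstable variety which is given by `Q` in polar
coordinates. -/
def coneMap (Q : CSpace n m → ℝ → CSpace n m) (v : CSpace n m) : CSpace n m :=
  open Classical in if v = 0 then 0 else Q ((‖v‖ / √n)⁻¹ • v) (‖v‖ / √n)

theorem coneMap_zero (Q : CSpace n m → ℝ → CSpace n m) : coneMap Q 0 = 0 := if_pos rfl

theorem coneMap_smul (hn : 1 ≤ n) {θ : CSpace n m} (hθ : θ ∈ baseTorus n m) {r : ℝ} (hr : 0 < r) :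
    coneMap Q (r • θ) = Q θ r := by
  have hθ0 : θ ≠ 0 := norm_pos_iff.1 (norm_pos_of_mem_baseTorus hn hθ)
  have h1 : ‖r • θ‖ / √n = r := by
    rw [norm_smul, Real.norm_of_nonneg hr.le, norm_of_mem_baseTorus hθ]
    have := (sqrt_natCast_pos hn).ne'
    field_simp
  rw [coneMap, if_neg (smul_ne_zero hr.ne' hθ0), h1, inv_smul_smul₀ hr.ne']

theorem norm_coneMap_sub_le (hQ : g.IsUnstableFamily Q) (hn : 1 ≤ n) :
    ∃ δ > 0, ∃ B ≥ 0, ∀ v ∈ standardCone n m, ‖v‖ < δ → ‖coneMap Q v - v‖ ≤ B * ‖v‖ ^ 2 := by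
  obtain ⟨σ₀, hσ₀, B, hB, happrox⟩ := hQ.approx
  have hsq : 1 ≤ √(n : ℝ) := by rw [Real.one_le_sqrt]; exact_mod_cast hn
  refine ⟨σ₀, hσ₀, B, hB, fun v hv hlt => ?_⟩
  by_cases hv0 : v = 0
  · subst hv0
    simp [coneMap_zero]
  · obtain ⟨θ, hθ, r, hr, rfl⟩ := exists_polar_of_mem_standardCone hn hv hv0
    rw [norm_smul, Real.norm_of_nonneg hr.le, norm_of_mem_baseTorus hθ] at hlt ⊢
    rw [coneMap_smul hn hθ hr]
    have hle : r ≤ r * √n := by nlinarith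
    refine (happrox θ hθ r ⟨hr, hle.trans hlt.le⟩).trans ?_
    gcongr

theorem continuousOn_coneMap (hQ : g.IsUnstableFamily Q) (hn : 1 ≤ n) :
    ContinuousOn (coneMap Q) (standardCone n m) := by
  intro v hv
  by_cases hv0 : v = 0
  · subst hv0
    obtain ⟨δ, hδ, B, hB, hle⟩ := hQ.norm_coneMap_sub_le hn
    rw [ContinuousWithinAt, coneMap_zero]
    have h1 : Tendsto (fun v : CSpace n m => B * ‖v‖ ^ 2 + ‖v‖) (𝓝[standardCone n m] 0) (𝓝 0) := by
      have : Tendsto (fun v : CSpace n m => B * ‖v‖ ^ 2 + ‖v‖) (𝓝 0)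
          (𝓝 (B * ‖(0 : CSpace n m)‖ ^ 2 + ‖(0 : CSpace n m)‖)) :=
        (by fun_prop : Continuous fun v : CSpace n m => B * ‖v‖ ^ 2 + ‖v‖).tendsto 0
      simp only [norm_zero, ne_eq, OfNat.ofNat_ne_zero, not_false_eq_true, zero_pow, mul_zero,
        add_zero] at this
      exact this.mono_left nhdsWithin_le_nhds
    refine squeeze_zero_norm' ?_ h1
    filter_upwards [self_mem_nhdsWithin, nhdsWithin_le_nhds (Metric.ball_mem_nhds 0 hδ)] with w hw hwδ
    have h2 := hle w hw (by simpa using hwδ)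
    have h3 := norm_le_norm_add_norm_sub' (coneMap Q w) w
    linarith
  · have hU : {w : CSpace n m | w ≠ 0} ∈ 𝓝 v := isOpen_ne.mem_nhds hv0
    have heq : coneMap Q =ᶠ[𝓝[standardCone n m ∩ {w | w ≠ 0}] v]
        fun w => Q ((‖w‖ / √n)⁻¹ • w) (‖w‖ / √n) := by
      filter_upwards [self_mem_nhdsWithin] with w hw
      rw [coneMap, if_neg hw.2]
    have hmem : ∀ w ∈ standardCone n m ∩ {w | w ≠ 0},
        ((‖w‖ / √n)⁻¹ • w, ‖w‖ / √n) ∈ baseTorus n m ×ˢ Ioi (0 : ℝ) := by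
      rintro w ⟨hw, hw0⟩
      obtain ⟨θ, hθ, r, hr, rfl⟩ := exists_polar_of_mem_standardCone hn hw hw0
      have h1 : ‖r • θ‖ / √n = r := by
        rw [norm_smul, Real.norm_of_nonneg hr.le, norm_of_mem_baseTorus hθ]
        have := (sqrt_natCast_pos hn).ne'
        field_simp
      rw [h1, inv_smul_smul₀ hr.ne']
      exact ⟨hθ, hr⟩
    have hc : ContinuousOn (fun w : CSpace n m => ((‖w‖ / √n)⁻¹ • w, ‖w‖ / √n))
        (standardCone n m ∩ {w | w ≠ 0}) := by
      have h1 : ContinuousOn (fun w : CSpace n m => ‖w‖ / √n) (standardCone n m ∩ {w | w ≠ 0}) := by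
        fun_prop
      refine ContinuousOn.prodMk (ContinuousOn.smul (h1.inv₀ fun w hw => ?_) continuousOn_id) h1
      exact div_ne_zero (norm_ne_zero_iff.2 hw.2) (sqrt_natCast_pos hn).ne'
    have h2 := hQ.continuousOn.comp hc hmem v ⟨hv, hv0⟩
    have h3 : ContinuousWithinAt (coneMap Q) (standardCone n m ∩ {w | w ≠ 0}) v :=
      h2.congr_of_eventuallyEq heq (by rw [coneMap, if_neg hv0]; rfl)
    exact (continuousWithinAt_inter hU).1 h3

theorem coneMap_mem (hQ : g.IsUnstableFamily Q) (hn : 1 ≤ n) {v : CSpace n m}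
    (hv : v ∈ standardCone n m) : coneMap Q v ∈ unstableVariety g (reProd n m) 0 := by
  rw [hQ.mem_unstableVariety_iff]
  by_cases hv0 : v = 0
  · left; rw [hv0, coneMap_zero]
  · obtain ⟨θ, hθ, r, hr, rfl⟩ := exists_polar_of_mem_standardCone hn hv hv0
    exact Or.inr ⟨θ, hθ, r, hr, coneMap_smul hn hθ hr⟩

theorem coneMap_injOn (hQ : g.IsUnstableFamily Q) (hn : 1 ≤ n) :
    InjOn (coneMap Q) (standardCone n m) := by
  intro v hv w hw h
  by_cases hv0 : v = 0 <;> by_cases hw0 : w = 0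
  · rw [hv0, hw0]
  · obtain ⟨θ, hθ, r, hr, rfl⟩ := exists_polar_of_mem_standardCone hn hw hw0
    rw [hv0, coneMap_zero, coneMap_smul hn hθ hr] at h
    exact absurd h.symm (hQ.ne_zero θ hθ r hr)
  · obtain ⟨θ, hθ, r, hr, rfl⟩ := exists_polar_of_mem_standardCone hn hv hv0
    rw [hw0, coneMap_zero, coneMap_smul hn hθ hr] at h
    exact absurd h (hQ.ne_zero θ hθ r hr)
  · obtain ⟨θ, hθ, r, hr, rfl⟩ := exists_polar_of_mem_standardCone hn hv hv0
    obtain ⟨θ', hθ', r', hr', rfl⟩ := exists_polar_of_mem_standardCone hn hw hw0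
    rw [coneMap_smul hn hθ hr, coneMap_smul hn hθ' hr'] at h
    obtain ⟨h1, h2⟩ := hQ.injective θ hθ θ' hθ' r hr r' hr' h
    rw [h1, h2]

theorem coneMap_surj (hQ : g.IsUnstableFamily Q) (hn : 1 ≤ n) {z : CSpace n m}
    (hz : z ∈ unstableVariety g (reProd n m) 0) : ∃ v ∈ standardCone n m, coneMap Q v = z := by
  rcases hQ.mem_unstableVariety_iff.1 hz with rfl | ⟨θ, hθ, r, hr, rfl⟩
  · exact ⟨0, zero_mem_standardCone hn, coneMap_zero Q⟩
  · exact ⟨r • θ, smul_mem_standardCone hθ hr.le, coneMap_smul hn hθ hr⟩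

/-- The local boundedness that makes the inverse of `coneMap` continuous: bounded parts of the cone
are compact, and a continuous bijection could otherwise send points going to infinity close to `z`.
-/
theorem exists_norm_bound (hQ : g.IsUnstableFamily Q) (hn : 1 ≤ n) {z : CSpace n m}
    (hz : z ∈ unstableVariety g (reProd n m) 0) :
    ∃ R, ∀ᶠ z' in 𝓝 z, ∀ v ∈ standardCone n m, coneMap Q v = z' → ‖v‖ ≤ R := by
  have key : ∀ R, (∀ᶠ z' in 𝓝 z, ∀ θ ∈ baseTorus n m, ∀ r > 0, Q θ r = z' → r ≤ R) →
      ∀ᶠ z' in 𝓝 z, ∀ v ∈ standardCone n m, coneMap Q v = z' → ‖v‖ ≤ max R 0 * √n := by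
    intro R hR
    filter_upwards [hR] with z' hz' v hv hvz
    by_cases hv0 : v = 0
    · rw [hv0, norm_zero]
      positivity
    · obtain ⟨θ, hθ, r, hr, rfl⟩ := exists_polar_of_mem_standardCone hn hv hv0
      rw [coneMap_smul hn hθ hr] at hvz
      rw [norm_smul, Real.norm_of_nonneg hr.le, norm_of_mem_baseTorus hθ]
      have := (hz' θ hθ r hr hvz).trans (le_max_left R 0)
      gcongr
  rcases hQ.mem_unstableVariety_iff.1 hz with rfl | ⟨θ, hθ, r, hr, rfl⟩
  · obtain ⟨R, hR⟩ := hQ.bounded_zero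
    exact ⟨_, key R hR⟩
  · obtain ⟨R, hR⟩ := hQ.bounded θ hθ r hr
    exact ⟨_, key R hR⟩

theorem unstableVarietyModelledOn (hQ : g.IsUnstableFamily Q) (hn : 1 ≤ n) :
    UnstableVarietyModelledOn g (reProd n m) 0 (standardCone n m) := by
  let f : standardCone n m → unstableVariety g (reProd n m) 0 := fun v =>
    ⟨coneMap Q v, hQ.coneMap_mem hn v.2⟩
  have hfc : Continuous f :=
    Continuous.subtype_mk (continuousOn_iff_continuous_domRestrict.1 (hQ.continuousOn_coneMap hn)) _
  have hfb : Function.Bijective f := by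
    constructor
    · intro v w h
      exact Subtype.ext (hQ.coneMap_injOn hn v.2 w.2 (congrArg Subtype.val h))
    · rintro ⟨z, hz⟩
      obtain ⟨v, hv, hvz⟩ := hQ.coneMap_surj hn hz
      exact ⟨⟨v, hv⟩, Subtype.ext hvz⟩
  let e := Equiv.ofBijective f hfb
  have hsymm : Continuous e.symm := by
    refine e.continuous_symm_of_locally_compact_preimage hfc fun z => ?_
    obtain ⟨R, hR⟩ := hQ.exists_norm_bound hn z.2
    refine ⟨_, isCompact_bounded_standardCone R, ?_⟩
    filter_upwards [continuous_subtype_val.continuousAt.eventually hR] with z' hz'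
    refine hz' _ (e.symm z').2 ?_
    exact congrArg Subtype.val (e.apply_symm_apply z')
  refine ⟨⟨e, hfc, hsymm⟩, fun v hv => ?_, ?_, fun v hv0 => ?_⟩
  · change coneMap Q v = 0
    rw [hv, coneMap_zero]
  · obtain ⟨δ, hδ, B, hB, hle⟩ := hQ.norm_coneMap_sub_le hn
    refine Asymptotics.IsLittleO.of_bound fun c hc => ?_
    rw [eventually_comap]
    filter_upwards [Metric.ball_mem_nhds (0 : CSpace n m)
      (by positivity : 0 < min δ (c / (B + 1)))] with w hw v hvw
    rw [mem_ball_zero_iff, ← hvw] at hw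
    change ‖coneMap Q v - 0 - v‖ ≤ c * ‖(v : CSpace n m)‖
    rw [sub_zero]
    refine (hle v v.2 (hw.trans_le (min_le_left _ _))).trans ?_
    have h1 := hw.trans_le (min_le_right _ _)
    rw [lt_div_iff₀ (by positivity)] at h1
    have h2 := norm_nonneg (v : CSpace n m)
    nlinarith
  · obtain ⟨v, hv⟩ := v
    obtain ⟨θ, hθ, r, hr, rfl⟩ := exists_polar_of_mem_standardCone hn hv hv0
    obtain ⟨I, γ, hγ, hout, him⟩ := hQ.curve θ hθ
    have hdir : ‖r • θ‖⁻¹ • r • θ = ‖θ‖⁻¹ • θ := by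
      rw [norm_smul, Real.norm_of_nonneg hr.le, smul_smul, mul_inv, mul_right_comm,
        inv_mul_cancel₀ hr.ne', one_mul]
    refine ⟨I, γ, hγ, by simpa only [hdir] using hout, ?_⟩
    rw [him]
    ext z
    constructor
    · rintro ⟨w, ⟨c, hc, hw⟩, rfl⟩
      refine ⟨c * r, mul_pos hc hr, ?_⟩
      change Q θ (c * r) = coneMap Q w
      rw [hw]
      simp only
      rw [smul_smul, coneMap_smul hn hθ (mul_pos hc hr)]
    · rintro ⟨s, hs, rfl⟩
      refine ⟨⟨s • θ, smul_mem_standardCone hθ (le_of_lt hs)⟩, ⟨s / r, div_pos hs hr, ?_⟩, ?_⟩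
      · simp only
        rw [smul_smul, div_mul_cancel₀ _ hr.ne']
      · exact (coneMap_smul hn hθ hs).symm

end IsUnstableFamily

/-- The conclusions at the origin, for a metric which is standard there. -/
theorem standard_conclusions (hg : g.IsStandardAt 0) (hn : 1 ≤ n) :
    IsConeOverTorus (n - 1) (standardCone n m) ∧
      UnstableVarietyModelledOn g (reProd n m) 0 (standardCone n m) ∧
      ∀ (I : Set ℝ) (γ : ℝ → CSpace n m), g.IsSolutionCurve (reProd n m) I γ →
        AccumulatesBackwardAt I γ 0 → γ '' I ⊆ unstableVariety g (reProd n m) 0 := by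
  obtain ⟨Q, hQ⟩ := exists_isUnstableFamily hg hn
  refine ⟨?_, hQ.unstableVarietyModelledOn hn, fun I γ => hQ.image_subset_unstableVariety⟩
  obtain ⟨k, rfl⟩ := Nat.exists_eq_add_of_le' hn
  exact isConeOverTorus_standardCone k m

end HermitianMetric

/-! ### Unitary frames for an invariant real inner product. -/

section UnitaryFrame

variable {V : Type*} [AddCommGroup V] [Module ℂ V] [Module ℝ V] [IsScalarTower ℝ ℂ V]

theorem Complex.smul_eq_re_add_im (r : ℂ) (x : V) : r • x = r.re • x + r.im • Complex.I • x := by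
  conv_lhs => rw [← Complex.re_add_im r, add_smul, mul_smul]
  congr 1
  · rw [← smul_one_smul ℂ r.re x, Complex.real_smul, mul_one]
  · rw [← smul_one_smul ℂ r.im (Complex.I • x), Complex.real_smul, mul_one]

/-- The complex inner product whose real part is a given positive definite real inner product
invariant under multiplication by `i`. -/
abbrev InnerProductSpace.Core.ofInvariantForm (B : V →ₗ[ℝ] V →ₗ[ℝ] ℝ)
    (hsymm : ∀ u v, B u v = B v u) (hpos : ∀ v, v ≠ 0 → 0 < B v v)
    (hinv : ∀ u v, B (Complex.I • u) (Complex.I • v) = B u v) : InnerProductSpace.Core ℂ V where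
  -- Conjugate linearity in the first argument dictates the imaginary part, namely the real part of
  -- the inner product of `iu` with `v`.
  inner u v := ⟨B u v, B (Complex.I • u) v⟩
  conj_inner_symm u v := by
    apply Complex.ext
    · simp [hsymm u v]
    · have h := hinv (Complex.I • v) u
      rw [smul_smul, Complex.I_mul_I, neg_one_smul, map_neg, LinearMap.neg_apply] at h
      simp [hsymm (Complex.I • u) v, ← h]
  re_inner_nonneg v := by
    rcases eq_or_ne v 0 with rfl | hv
    · simp
    · exact (hpos v hv).le
  add_left u v w := by
    apply Complex.ext <;> simp
  smul_left u v r := by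
    have h : Complex.I • r • u = r.re • Complex.I • u - r.im • u := by
      rw [Complex.smul_eq_re_add_im r u, smul_add, smul_comm Complex.I r.re, smul_comm Complex.I r.im,
        smul_smul Complex.I Complex.I, Complex.I_mul_I, neg_one_smul, smul_neg, sub_eq_add_neg]
    apply Complex.ext
    · change B (r • u) v = _
      rw [Complex.smul_eq_re_add_im r u]
      simp
    · change B (Complex.I • r • u) v = _
      rw [h]
      simp
      ring
  definite v hv := by
    by_contra hne
    exact (hpos v hne).ne' (congrArg Complex.re hv)

/-- A unitary family for an invariant real inner product extends to a unitary isomorphism. -/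
theorem exists_unitary_extension [FiniteDimensional ℂ V] {ι : Type*} [Fintype ι] [DecidableEq ι]
    (hcard : Module.finrank ℂ V = Fintype.card ι) (B : V →ₗ[ℝ] V →ₗ[ℝ] ℝ)
    (hsymm : ∀ u v, B u v = B v u) (hpos : ∀ v, v ≠ 0 → 0 < B v v)
    (hinv : ∀ u v, B (Complex.I • u) (Complex.I • v) = B u v) (s : Set ι) (e : ι → V)
    (he : ∀ i ∈ s, B (e i) (e i) = 1)
    (he' : ∀ i ∈ s, ∀ j ∈ s, i ≠ j → ∀ c : ℂ, B (c • e i) (e j) = 0) :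
    ∃ L : EuclideanSpace ℂ ι ≃ₗ[ℂ] V, (∀ i ∈ s, L (EuclideanSpace.single i 1) = e i) ∧
      ∀ u v, B (L u) (L v) = (∑ k, u k * (starRingEnd ℂ) (v k)).re := by
  let core := InnerProductSpace.Core.ofInvariantForm B hsymm hpos hinv
  let _ : NormedAddCommGroup V := core.toNormedAddCommGroup
  let _ : InnerProductSpace ℂ V := InnerProductSpace.ofCore core.toCore
  have hinner : ∀ u v : V, inner ℂ u v = (⟨B u v, B (Complex.I • u) v⟩ : ℂ) := fun u v => rfl
  have horth : Orthonormal ℂ (s.domRestrict e) := by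
    rw [orthonormal_iff_ite]
    rintro ⟨i, hi⟩ ⟨j, hj⟩
    simp only [Set.domRestrict_apply, hinner]
    split_ifs with h
    · obtain rfl : i = j := congrArg Subtype.val h
      have h1 := hinv (Complex.I • e i) (e i)
      rw [smul_smul, Complex.I_mul_I, neg_one_smul, map_neg, LinearMap.neg_apply,
        hsymm (e i)] at h1
      apply Complex.ext
      · exact he i hi
      · change B (Complex.I • e i) (e i) = 0
        linarith
    · have hij : i ≠ j := fun h' => h (Subtype.ext h')
      apply Complex.ext
      · simpa using he' i hi j hj hij 1
      · exact he' i hi j hj hij Complex.I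
  obtain ⟨b, hb⟩ := horth.exists_orthonormalBasis_extension_of_card_eq hcard
  refine ⟨b.repr.symm.toLinearEquiv, fun i hi => ?_, fun u v => ?_⟩
  · rw [← hb i hi]
    exact b.repr_symm_single i
  · have h1 : inner ℂ (b.repr.symm v) (b.repr.symm u) = inner ℂ v u :=
      b.repr.symm.inner_map_map v u
    have h2 := congrArg Complex.re h1
    rw [hinner, EuclideanSpace.inner_eq_star_dotProduct] at h2
    rw [hsymm]
    exact h2

end UnitaryFrame

/-! ### Linear coordinates adapted to orthogonal normal lines. -/

namespace HermitianMetric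

variable {n m : ℕ} (g : HermitianMetric n m)

/-- The normal vector of `{zᵢ = const}` representing the real part of the `i`-th coordinate. -/
def normalVector (p : CSpace n m) (i : Fin n) : CSpace n m :=
  g.sharp p (Complex.reCLM.comp ((coordL n m (Sum.inl i)).restrictScalars ℝ))

theorem form_normalVector (p : CSpace n m) (i : Fin n) (v : CSpace n m) :
    g.form p (g.normalVector p i) v = (v (Sum.inl i)).re := by
  rw [normalVector, form_sharp]
  rfl

/-- The hyperplane `wᵢ = 0` is complex and the metric is invariant under multiplication by `i`, so
its normal space is a complex subspace. -/
theorem smul_normalVector_mem (p : CSpace n m) (i : Fin n) (c : ℂ) :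
    c • g.normalVector p i ∈ g.normalLine p i := by
  intro w hw
  have h : g.form p (Complex.I • g.normalVector p i) w = 0 := by
    have h1 := g.invariant p (g.normalVector p i) (-(Complex.I • w))
    rw [smul_neg, smul_smul, Complex.I_mul_I, neg_one_smul, neg_neg] at h1
    rw [h1, form_normalVector]
    simp [hw]
  rw [Complex.smul_eq_re_add_im c (g.normalVector p i)]
  simp [h, form_normalVector, hw]

theorem normalVector_ne_zero (p : CSpace n m) (i : Fin n) : g.normalVector p i ≠ 0 := by
  intro h
  have h1 := g.form_normalVector p i (EuclideanSpace.single (Sum.inl i) 1)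
  simp [h] at h1

/-- If the normal lines at `p` are orthogonal, there are linear coordinates in which the metric at
`p` is a multiple of the standard one and which rescale the coordinates `zᵢ` by real factors of
product `1`. -/
theorem exists_adapted_frame {p : CSpace n m}
    (hort : ∀ i j, i ≠ j → ∀ u ∈ g.normalLine p i, ∀ v ∈ g.normalLine p j, g.form p u v = 0)
    (hn : 1 ≤ n) :
    ∃ (L : CSpace n m ≃L[ℂ] CSpace n m) (c : ℝ) (d : Fin n → ℝ), 0 < c ∧ (∀ i, 0 < d i) ∧
      ∏ i, d i = 1 ∧
      (∀ u v, g.form p (L u) (L v) = c * (∑ k, u k * (starRingEnd ℂ) (v k)).re) ∧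
      ∀ u i, L u (Sum.inl i) = d i * u (Sum.inl i) := by
  set N : Fin n → ℝ := fun i => √(g.form p (g.normalVector p i) (g.normalVector p i)) with hN
  have hNpos : ∀ i, 0 < N i := fun i => Real.sqrt_pos.2 (g.pos p _ (g.normalVector_ne_zero p i))
  have hNsq : ∀ i, g.form p (g.normalVector p i) (g.normalVector p i) = N i * N i := fun i =>
    (Real.mul_self_sqrt (g.pos p _ (g.normalVector_ne_zero p i)).le).symm
  let B : CSpace n m →ₗ[ℝ] CSpace n m →ₗ[ℝ] ℝ :=
    (ContinuousLinearMap.coeLM ℝ).comp (g.form p).toLinearMap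
  have hB : ∀ u v, B u v = g.form p u v := fun u v => rfl
  -- Only the normalised normal vectors are prescribed; the zeros at the last `m` indices are
  -- placeholders, and the extension chooses those frame vectors.
  let e : Fin n ⊕ Fin m → CSpace n m :=
    Sum.elim (fun i => ((N i)⁻¹ : ℝ) • g.normalVector p i) fun _ => 0
  obtain ⟨L, hL, hform⟩ := exists_unitary_extension (V := CSpace n m) (by simp) B (g.symm p) (g.pos p)
    (g.invariant p) (Set.range Sum.inl) e
    (by
      rintro _ ⟨i, rfl⟩
      have := (hNpos i).ne'
      rw [hB]
      simp only [e, Sum.elim_inl, map_smul, smul_apply, smul_eq_mul, hNsq]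
      field_simp)
    (by
      rintro _ ⟨i, rfl⟩ _ ⟨j, rfl⟩ hij c
      refine hort i j (fun h => hij (by rw [h])) _ ?_ _ ?_
      · have := g.smul_normalVector_mem p i (c * ((N i)⁻¹ : ℝ))
        rwa [mul_smul, Complex.coe_smul] at this
      · have := g.smul_normalVector_mem p j ((N j)⁻¹ : ℝ)
        rwa [Complex.coe_smul] at this)
  -- Pairing with the normal vector is the real part of the `i`-th coordinate. As this vector is `N
  -- i` times a frame vector, `L` multiplies that real part by `N i`; applying this to `iu` as well
  -- gives the complex coordinate.
  have hre : ∀ i u, (L u (Sum.inl i)).re = N i * (u (Sum.inl i)).re := by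
    intro i u
    rw [← g.form_normalVector p i (L u)]
    have h1 : g.normalVector p i = N i • L (EuclideanSpace.single (Sum.inl i) 1) := by
      rw [hL _ ⟨i, rfl⟩]
      exact (smul_inv_smul₀ (hNpos i).ne' _).symm
    rw [h1, map_smul, smul_apply, smul_eq_mul, ← hB, hform]
    congr 1
    rw [Finset.sum_eq_single (Sum.inl i)]
    · simp
    · intro k _ hk
      simp [hk]
    · simp
  have hcoord : ∀ i u, L u (Sum.inl i) = N i * u (Sum.inl i) := by
    intro i u
    have h1 := hre i u
    have h2 := hre i (Complex.I • u)
    rw [map_smul] at h2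
    apply Complex.ext
    · simpa using h1
    · simpa using h2
  have hP : 0 < ∏ i, N i := Finset.prod_pos fun i _ => hNpos i
  -- A common rescaling by `l` makes the factors `l N i` have product `1`, so that `L` preserves `∏
  -- zᵢ`; the price is the constant `l²` in front of the metric.
  set l : ℝ := (∏ i, N i) ^ (-(1 : ℝ) / n) with hl
  have hlpos : 0 < l := Real.rpow_pos_of_pos hP _
  have hln : l ^ n = (∏ i, N i)⁻¹ := by
    have hn0 : (n : ℝ) ≠ 0 := by positivity
    rw [hl, ← Real.rpow_natCast, ← Real.rpow_mul hP.le, div_mul_cancel₀ _ hn0, Real.rpow_neg_one]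
  have hl0 : (l : ℂ) ≠ 0 := by exact_mod_cast hlpos.ne'
  refine ⟨((LinearEquiv.smulOfNeZero ℂ (CSpace n m) (l : ℂ) hl0).trans L).toContinuousLinearEquiv,
    l ^ 2, fun i => l * N i, by positivity, fun i => mul_pos hlpos (hNpos i), ?_, fun u v => ?_,
    fun u i => ?_⟩
  · rw [Finset.prod_mul_distrib, Finset.prod_const, Finset.card_univ, Fintype.card_fin, hln,
      inv_mul_cancel₀ hP.ne']
  · change g.form p (L ((l : ℂ) • u)) (L ((l : ℂ) • v)) = _
    rw [Complex.coe_smul, Complex.coe_smul, ← hB, hform, ← Complex.re_ofReal_mul, Finset.mul_sum]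
    congr 1
    refine Finset.sum_congr rfl fun k _ => ?_
    simp only [PiLp.smul_apply, Complex.real_smul, map_mul, Complex.conj_ofReal]
    push_cast
    ring
  · change L ((l : ℂ) • u) (Sum.inl i) = _
    rw [hcoord, PiLp.smul_apply, smul_eq_mul]
    push_cast
    ring

/-- In adapted linear coordinates the model cone is the standard cone. -/
theorem modelCone_eq_image {p : CSpace n m} {L : CSpace n m ≃L[ℂ] CSpace n m} {c : ℝ}
    {d : Fin n → ℝ} (hc : 0 < c) (hd : ∀ i, 0 < d i) (hprod : ∏ i, d i = 1)
    (hform : ∀ u v, g.form p (L u) (L v) = c * (∑ k, u k * (starRingEnd ℂ) (v k)).re)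
    (hcoord : ∀ u i, L u (Sum.inl i) = d i * u (Sum.inl i)) :
    modelCone g p = L '' standardCone n m := by
  have hdc : ∏ i, (d i : ℂ) = 1 := by exact_mod_cast hprod
  have hsingle : ∀ i (a : ℂ), g.form p (L (EuclideanSpace.single (Sum.inl i) a))
      (L (EuclideanSpace.single (Sum.inl i) a)) = c * ‖a‖ ^ 2 := by
    intro i a
    rw [hform, Finset.sum_eq_single (Sum.inl i)]
    · rw [PiLp.single_apply, if_pos rfl, Complex.mul_conj, Complex.ofReal_re,
        Complex.normSq_eq_norm_sq]
    · intro k _ hk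
      simp [hk]
    · simp
  have hnormal : ∀ i, ∀ u ∈ g.normalLine p i, ∃ a : ℂ, u = L (EuclideanSpace.single (Sum.inl i) a) := by
    intro i u hu
    set a := L.symm u with ha
    have hu' : L a = u := L.apply_symm_apply u
    refine ⟨a (Sum.inl i), ?_⟩
    rw [← hu']
    congr 1
    ext k
    by_cases hk : k = Sum.inl i
    · subst hk; simp
    · have h1 := hu (L (EuclideanSpace.single k (a k))) (by
        rw [hcoord]; simp [Ne.symm hk])
      rw [← hu', hform, Finset.sum_eq_single k] at h1
      · rw [PiLp.single_apply, if_neg hk]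
        simpa [hc.ne', Complex.mul_conj, ← Complex.ofReal_pow] using h1
      · intro l _ hl
        simp [hl]
      · simp
  have hmem : ∀ i (a : ℂ), L (EuclideanSpace.single (Sum.inl i) a) ∈ g.normalLine p i := by
    intro i a w hw
    obtain ⟨b, rfl⟩ := L.surjective w
    have hb : b (Sum.inl i) = 0 := by
      rw [hcoord] at hw
      simpa [(hd i).ne'] using hw
    rw [hform, Finset.sum_eq_single (Sum.inl i)]
    · simp [hb]
    · intro k _ hk
      simp [hk]
    · simp
  have hprodL : ∀ u, ∏ i : Fin n, L u (Sum.inl i) = ∏ i : Fin n, u (Sum.inl i) := by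
    intro u
    simp only [hcoord]
    rw [Finset.prod_mul_distrib, hdc, one_mul]
  have hsum : ∀ (a : Fin n → ℂ) k, (∑ i, EuclideanSpace.single (Sum.inl i) (a i) : CSpace n m) k =
      Sum.elim a (fun _ => 0) k := by
    intro a k
    rw [WithLp.ofLp_sum, Finset.sum_apply]
    rcases k with k | k
    · simp
    · simp
  ext v
  constructor
  · rintro ⟨e, he, hnorm, rfl, hr⟩
    choose a ha using fun i => hnormal i (e i) (he i)
    have hv : ∑ i, e i = L (∑ i, EuclideanSpace.single (Sum.inl i) (a i)) := by
      rw [map_sum]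
      exact Finset.sum_congr rfl fun i _ => ha i
    rw [hv, hprodL] at hr
    refine ⟨_, ⟨fun k => ?_, hr, fun i j => ?_⟩, hv.symm⟩
    · rw [hsum]; rfl
    · have h1 := hnorm i j
      rw [ha i, ha j, hsingle, hsingle] at h1
      rw [hsum, hsum]
      exact (pow_left_inj₀ (norm_nonneg _) (norm_nonneg _) two_ne_zero).1
        (mul_left_cancel₀ hc.ne' h1)
  · rintro ⟨u, ⟨hw, hr, hnorm⟩, rfl⟩
    refine ⟨fun i => L (EuclideanSpace.single (Sum.inl i) (u (Sum.inl i))), fun i => hmem i _,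
      fun i j => ?_, ?_, by rwa [hprodL]⟩
    · rw [hsingle, hsingle, hnorm i j]
    · rw [← map_sum]
      congr 1
      ext k
      rw [hsum]
      rcases k with k | k
      · rfl
      · exact hw k

end HermitianMetric

/-! ### Transport of the conclusions along affine similarities. -/

section Transport

open Set

variable {n m : ℕ}

/-- The affine map `z ↦ p + L (z - p')` multiplies the metric by a constant and respects the
functions. -/
structure IsAffineSimilarity (g g' : HermitianMetric n m) (F F' : CSpace n m → ℝ)
    (p p' : CSpace n m) (L : CSpace n m ≃L[ℝ] CSpace n m) (c : ℝ) : Prop where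
  ne_zero : c ≠ 0
  form_eq : ∀ z u v, g.form (p + L (z - p')) (L u) (L v) = c * g'.form z u v
  map_eq : ∀ z, F (p + L (z - p')) = F' z

namespace IsAffineSimilarity

variable {g g' : HermitianMetric n m} {F F' : CSpace n m → ℝ} {p p' : CSpace n m}
  {L : CSpace n m ≃L[ℝ] CSpace n m} {c : ℝ}

theorem symm (h : IsAffineSimilarity g g' F F' p p' L c) :
    IsAffineSimilarity g' g F' F p' p L.symm c⁻¹ where
  ne_zero := inv_ne_zero h.ne_zero
  form_eq z u v := by
    have := h.form_eq (p' + L.symm (z - p)) (L.symm u) (L.symm v)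
    simp only [add_sub_cancel_left, ContinuousLinearEquiv.apply_symm_apply,
      add_sub_cancel] at this
    rw [this, inv_mul_cancel_left₀ h.ne_zero]
  map_eq z := by
    have := h.map_eq (p' + L.symm (z - p))
    simp only [add_sub_cancel_left, ContinuousLinearEquiv.apply_symm_apply,
      add_sub_cancel] at this
    exact this.symm

theorem fderiv_eq (h : IsAffineSimilarity g g' F F' p p' L c) (z u : CSpace n m) :
    fderiv ℝ F (p + L (z - p')) (L u) = fderiv ℝ F' z u := by
  have h1 : F' = fun z => (fun y => F (p + y)) (L (z - p')) := funext fun z => (h.map_eq z).symm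
  rw [h1, fderiv_comp_sub (f := fun z => (fun y => F (p + y)) (L z))]
  change _ = fderiv ℝ ((fun y => F (p + y)) ∘ L) (z - p') u
  rw [L.comp_right_fderiv, fderiv_comp_add_left]
  rfl

theorem grad_eq (h : IsAffineSimilarity g g' F F' p p' L c) (z : CSpace n m) :
    g.grad F (p + L (z - p')) = c⁻¹ • L (g'.grad F' z) := by
  refine g.form_ext (z := p + L (z - p')) fun v => ?_
  obtain ⟨u, rfl⟩ := L.surjective v
  rw [g.form_grad, h.fderiv_eq, map_smul, smul_apply, h.form_eq, g'.form_grad, smul_eq_mul,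
    inv_mul_cancel_left₀ h.ne_zero]

/-- Multiplying the metric by `c` multiplies both `∇f` and `|∇f|²` by `c⁻¹`, so their quotient is
unchanged. Constant factors in the metric are therefore harmless. -/
theorem field_eq (h : IsAffineSimilarity g g' F F' p p' L c) (z : CSpace n m) :
    g.field F (p + L (z - p')) = L (g'.field F' z) := by
  have hc := h.ne_zero
  rw [HermitianMetric.field, HermitianMetric.field, h.grad_eq, map_smul, map_smul, smul_apply,
    map_smul, h.form_eq, smul_smul, smul_eq_mul, smul_eq_mul]
  congr 1
  field_simp

theorem isSolutionCurve (h : IsAffineSimilarity g g' F F' p p' L c) {I : Set ℝ}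
    {γ : ℝ → CSpace n m} (hγ : g'.IsSolutionCurve F' I γ) :
    g.IsSolutionCurve F I fun t => p + L (γ t - p') where
  isOpen := hγ.isOpen
  ordConnected := hγ.ordConnected
  nonempty := hγ.nonempty
  regular t ht h0 := hγ.regular t ht (by
    ext u
    rw [← h.fderiv_eq, h0]
    rfl)
  hasDerivAt t ht := by
    rw [h.field_eq]
    exact (L.hasFDerivAt.comp_hasDerivAt t ((hγ.hasDerivAt t ht).sub_const p')).const_add p

end IsAffineSimilarity

theorem ComesOutOf.map_affine {I : Set ℝ} {γ : ℝ → CSpace n m} {p' u : CSpace n m}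
    (h : ComesOutOf I γ p' u) (p : CSpace n m) (L : CSpace n m ≃L[ℝ] CSpace n m) :
    ComesOutOf I (fun t => p + L (γ t - p')) p (‖L u‖⁻¹ • L u) := by
  have hu : u ≠ 0 := norm_ne_zero_iff.1 (by rw [h.norm_eq_one]; exact one_ne_zero)
  have hLu : ‖L u‖ ≠ 0 := norm_ne_zero_iff.2 (by simpa using hu)
  refine ⟨by rw [norm_smul, norm_inv, norm_norm, inv_mul_cancel₀ hLu], ?_, ?_⟩
  · have := ((L.continuous.tendsto _).comp (h.tendsto.sub_const p')).const_add p
    simpa using this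
  · have h1 : Tendsto (fun t : I => L (‖γ t - p'‖⁻¹ • (γ t - p'))) atBot (𝓝 (L u)) :=
      (L.continuous.tendsto _).comp h.direction
    have h2 := (h1.norm.inv₀ hLu).smul h1
    -- Because `0⁻¹ = 0`, the normalised vector is zero wherever `γ = p'`. Its norm tends to `1`, so
    -- this eventually does not happen and the norm can be cancelled.
    have h3 : Tendsto (fun t : I => ‖‖γ t - p'‖⁻¹ • (γ t - p')‖) atBot (𝓝 1) := by
      simpa [h.norm_eq_one] using h.direction.norm
    refine h2.congr' ?_
    filter_upwards [h3.eventually_ne one_ne_zero] with t ht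
    have hne : ‖(γ t : CSpace n m) - p'‖ ≠ 0 := fun h0 => ht (by simp [h0])
    rw [add_sub_cancel_left, map_smul, norm_smul, norm_inv, norm_norm, smul_smul, mul_inv, inv_inv,
      mul_right_comm, mul_inv_cancel₀ hne, one_mul]

theorem AccumulatesBackwardAt.map_affine {I : Set ℝ} {γ : ℝ → CSpace n m} {p' : CSpace n m}
    (h : AccumulatesBackwardAt I γ p') (p : CSpace n m) (L : CSpace n m ≃L[ℝ] CSpace n m) :
    AccumulatesBackwardAt I (fun t => p + L (γ t - p')) p := by
  have hc : ContinuousAt (fun z => p + L (z - p')) p' := by fun_prop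
  have := MapClusterPt.continuousAt_comp hc h
  rwa [sub_self, map_zero, add_zero] at this

/-- The affine homeomorphism `z ↦ p + L (z - p')`. -/
def similarityHomeomorph (p p' : CSpace n m) (L : CSpace n m ≃L[ℝ] CSpace n m) :
    CSpace n m ≃ₜ CSpace n m :=
  ((Homeomorph.subRight p').trans L.toHomeomorph).trans (Homeomorph.addLeft p)

theorem similarityHomeomorph_apply (p p' : CSpace n m) (L : CSpace n m ≃L[ℝ] CSpace n m)
    (z : CSpace n m) : similarityHomeomorph p p' L z = p + L (z - p') := rfl

theorem IsConeOverTorus.image {k : ℕ} {C : Set (CSpace n m)} (h : IsConeOverTorus k C)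
    (L : CSpace n m ≃L[ℝ] CSpace n m) : IsConeOverTorus k (L '' C) := by
  obtain ⟨Ψ, hΨ⟩ := h
  refine ⟨Ψ.trans (L.toHomeomorph.image C), fun x t => ?_⟩
  change L (Ψ (TopCone.mk x t)) = (t : ℝ) • L (Ψ (TopCone.mk x 1))
  rw [hΨ, map_smul]

namespace IsAffineSimilarity

variable {g g' : HermitianMetric n m} {F F' : CSpace n m → ℝ} {p p' : CSpace n m}
  {L : CSpace n m ≃L[ℝ] CSpace n m} {c : ℝ}

theorem map_mem_unstableVariety (h : IsAffineSimilarity g g' F F' p p' L c) {z : CSpace n m}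
    (hz : z ∈ unstableVariety g' F' p') : p + L (z - p') ∈ unstableVariety g F p := by
  rcases hz with rfl | ⟨I, γ, u, hγ, hout, t, ht, rfl⟩
  · left; simp
  · exact Or.inr ⟨I, _, _, h.isSolutionCurve hγ, hout.map_affine p L, t, ht, rfl⟩

theorem image_unstableVariety (h : IsAffineSimilarity g g' F F' p p' L c) :
    similarityHomeomorph p p' L '' unstableVariety g' F' p' = unstableVariety g F p := by
  ext z
  constructor
  · rintro ⟨y, hy, rfl⟩
    exact h.map_mem_unstableVariety hy
  · intro hz
    refine ⟨_, h.symm.map_mem_unstableVariety hz, ?_⟩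
    rw [similarityHomeomorph_apply, add_sub_cancel_left, L.apply_symm_apply, add_sub_cancel]

/-- Conjugates the homeomorphism by the affine map. As `L` and `L⁻¹` are bounded, the `o(|v|)` error
survives; rays go to rays, with their unit directions renormalised. -/
theorem unstableVarietyModelledOn (h : IsAffineSimilarity g g' F F' p p' L c)
    {C : Set (CSpace n m)} (hC : UnstableVarietyModelledOn g' F' p' C) :
    UnstableVarietyModelledOn g F p (L '' C) := by
  obtain ⟨Φ, hvertex, hlittle, hray⟩ := hC
  let T : C ≃ₜ L '' C := L.toHomeomorph.image C
  have hT : ∀ v : C, (T v : CSpace n m) = L v := fun v => rfl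
  let Φ' : L '' C ≃ₜ unstableVariety g F p :=
    (T.symm.trans Φ).trans (((similarityHomeomorph p p' L).image _).trans
      (Homeomorph.setCongr h.image_unstableVariety))
  have hΦ' : ∀ v : C, (Φ' (T v) : CSpace n m) = p + L (Φ v - p') := by
    intro v
    change p + L (Φ (T.symm (T v)) - p') = _
    rw [T.symm_apply_apply]
  refine ⟨Φ', ?_, ?_, ?_⟩
  · intro w hw
    obtain ⟨v, rfl⟩ := T.surjective w
    rw [hT] at hw
    rw [hΦ', hvertex v (by simpa using hw)]
    simp
  · have hTs : Tendsto T.symm (comap (fun w : L '' C => (w : CSpace n m)) (𝓝 0))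
        (comap (fun v : C => (v : CSpace n m)) (𝓝 0)) := by
      rw [tendsto_comap_iff]
      have h1 : (fun v : C => (v : CSpace n m)) ∘ T.symm = L.symm ∘ fun w : L '' C => (w : CSpace n m) := by
        funext w
        obtain ⟨v, rfl⟩ := T.surjective w
        simp [hT]
      rw [h1]
      have h2 : Tendsto L.symm (𝓝 0) (𝓝 0) := by
        simpa using L.symm.continuous.tendsto 0
      exact h2.comp tendsto_comap
    have h1 := hlittle.comp_tendsto hTs
    have h2 : (fun w : L '' C => (Φ' w : CSpace n m) - p - w) =O[comap (fun w : L '' C => (w : CSpace n m)) (𝓝 0)]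
        ((fun v : C => (Φ v : CSpace n m) - p' - v) ∘ T.symm) := by
      refine Asymptotics.IsBigO.of_bound ‖(L : CSpace n m →L[ℝ] CSpace n m)‖ (Eventually.of_forall fun w => ?_)
      obtain ⟨v, rfl⟩ := T.surjective w
      rw [hΦ', hT, add_sub_cancel_left, ← map_sub, Function.comp_apply, T.symm_apply_apply]
      exact (L : CSpace n m →L[ℝ] CSpace n m).le_opNorm _
    have h3 : ((fun v : C => (v : CSpace n m)) ∘ T.symm) =O[comap (fun w : L '' C => (w : CSpace n m)) (𝓝 0)]
        fun w : L '' C => (w : CSpace n m) := by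
      refine Asymptotics.IsBigO.of_bound ‖(L.symm : CSpace n m →L[ℝ] CSpace n m)‖
        (Eventually.of_forall fun w => ?_)
      obtain ⟨v, rfl⟩ := T.surjective w
      have := (L.symm : CSpace n m →L[ℝ] CSpace n m).le_opNorm (L v)
      simpa [hT] using this
    exact (h2.trans_isLittleO h1).trans_isBigO h3
  · intro w hw
    obtain ⟨v, rfl⟩ := T.surjective w
    rw [hT] at hw ⊢
    have hv : (v : CSpace n m) ≠ 0 := by simpa using hw
    obtain ⟨I, γ, hγ, hout, him⟩ := hray v hv
    refine ⟨I, _, h.isSolutionCurve hγ, ?_, ?_⟩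
    · have h1 := hout.map_affine p L
      have h2 : 0 < ‖(v : CSpace n m)‖⁻¹ := inv_pos.2 (norm_pos_iff.2 hv)
      rw [map_smul, norm_smul, Real.norm_of_nonneg h2.le, smul_smul, mul_inv, mul_right_comm,
        inv_mul_cancel₀ h2.ne', one_mul] at h1
      exact h1
    · rw [← Function.comp_def (fun z => p + L (z - p')) γ, image_comp, ← him]
      ext z
      constructor
      · rintro ⟨w', ⟨a, ha, hw'⟩, rfl⟩
        obtain ⟨v', rfl⟩ := T.surjective w'
        rw [hT, ← map_smul] at hw'
        exact ⟨_, ⟨v', ⟨a, ha, L.injective hw'⟩, rfl⟩, (hΦ' v').symm⟩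
      · rintro ⟨_, ⟨v', ⟨a, ha, hv'⟩, rfl⟩, rfl⟩
        exact ⟨T v', ⟨a, ha, by rw [hT, hv', map_smul]⟩, (hΦ' v').symm⟩

theorem image_subset_unstableVariety (h : IsAffineSimilarity g g' F F' p p' L c)
    (hacc : ∀ (I : Set ℝ) (γ : ℝ → CSpace n m), g'.IsSolutionCurve F' I γ →
      AccumulatesBackwardAt I γ p' → γ '' I ⊆ unstableVariety g' F' p')
    {I : Set ℝ} {γ : ℝ → CSpace n m} (hγ : g.IsSolutionCurve F I γ)
    (hp : AccumulatesBackwardAt I γ p) : γ '' I ⊆ unstableVariety g F p := by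
  rintro _ ⟨t, ht, rfl⟩
  have h1 := hacc I _ (h.symm.isSolutionCurve hγ) (hp.map_affine p' L.symm) ⟨t, ht, rfl⟩
  simpa using h.map_mem_unstableVariety h1

end IsAffineSimilarity

end Transport

/-! ### Reduction of a general point to a metric standard at the origin. -/

namespace HermitianMetric

variable {n m : ℕ} (g : HermitianMetric n m)

/-- The pullback of a metric under the affine map `z ↦ p + L z`, divided by a constant. -/
def affinePullback (p : CSpace n m) (L : CSpace n m ≃L[ℂ] CSpace n m) {c : ℝ} (hc : 0 < c) :
    HermitianMetric n m where
  form z := c⁻¹ • (((ContinuousLinearMap.compL ℝ (CSpace n m) (CSpace n m) ℝ).flip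
    (L.restrictScalars ℝ : CSpace n m →L[ℝ] CSpace n m)).comp (g.form (p + L z))).comp
      (L.restrictScalars ℝ : CSpace n m →L[ℝ] CSpace n m)
  smooth := by
    have h : ContDiff ℝ ∞ fun z => g.form (p + L z) :=
      g.smooth.comp (contDiff_const.add (L.restrictScalars ℝ).contDiff)
    exact ((contDiff_const.clm_comp h).clm_comp contDiff_const).const_smul c⁻¹
  symm z u v := by
    change c⁻¹ * g.form (p + L z) (L u) (L v) = c⁻¹ * g.form (p + L z) (L v) (L u)
    rw [g.symm]
  pos z v hv := mul_pos (inv_pos.2 hc) (g.pos (p + L z) (L v) (by simpa using hv))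
  invariant z u v := by
    change c⁻¹ * g.form (p + L z) (L (Complex.I • u)) (L (Complex.I • v)) =
      c⁻¹ * g.form (p + L z) (L u) (L v)
    rw [map_smul L, map_smul L, g.invariant]

theorem affinePullback_form (p : CSpace n m) (L : CSpace n m ≃L[ℂ] CSpace n m) {c : ℝ} (hc : 0 < c)
    (z u v : CSpace n m) :
    (g.affinePullback p L hc).form z u v = c⁻¹ * g.form (p + L z) (L u) (L v) := rfl

/-- The conclusions at a point of `{z₁ = … = zₙ = 0}` where the normal lines are orthogonal. -/
theorem conclusions_of_orthogonal {p : CSpace n m} (hn : 1 ≤ n)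
    (hp : ∀ i : Fin n, p (Sum.inl i) = 0)
    (hort : ∀ i j, i ≠ j → ∀ u ∈ g.normalLine p i, ∀ v ∈ g.normalLine p j, g.form p u v = 0) :
    IsConeOverTorus (n - 1) (modelCone g p) ∧
      UnstableVarietyModelledOn g (reProd n m) p (modelCone g p) ∧
      ∀ (I : Set ℝ) (γ : ℝ → CSpace n m), g.IsSolutionCurve (reProd n m) I γ →
        AccumulatesBackwardAt I γ p → γ '' I ⊆ unstableVariety g (reProd n m) p := by
  obtain ⟨L, c, d, hc, hd, hprod, hform, hcoord⟩ := g.exists_adapted_frame hort hn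
  have hdc : ∏ i, (d i : ℂ) = 1 := by exact_mod_cast hprod
  set g' := g.affinePullback p L hc with hg'
  have hstd : g'.IsStandardAt 0 := fun u v => by
    rw [hg', affinePullback_form, map_zero, add_zero, hform, inv_mul_cancel_left₀ hc.ne']
  have hsim : IsAffineSimilarity g g' (reProd n m) (reProd n m) p 0 (L.restrictScalars ℝ) c := by
    refine ⟨hc.ne', fun z u v => ?_, fun z => ?_⟩
    · rw [sub_zero, hg', affinePullback_form, mul_inv_cancel_left₀ hc.ne']
      rfl
    · rw [sub_zero, reProd, reProd]
      congr 1
      have h1 : ∀ i, (p + L z) (Sum.inl i) = d i * z (Sum.inl i) := fun i => by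
        rw [PiLp.add_apply, hp, zero_add, hcoord]
      change ∏ i : Fin n, (p + L z) (Sum.inl i) = _
      simp only [h1]
      rw [Finset.prod_mul_distrib, hdc, one_mul]
  have hcone : modelCone g p = L.restrictScalars ℝ '' standardCone n m :=
    g.modelCone_eq_image hc hd hprod hform hcoord
  obtain ⟨h1, h2, h3⟩ := standard_conclusions hstd hn
  rw [hcone]
  exact ⟨h1.image _, hsim.unstableVarietyModelledOn h2,
    fun I γ hγ hacc => hsim.image_subset_unstableVariety h3 hγ hacc⟩

end HermitianMetric

end
theorem theorem5p2 (n m : ℕ) (hn : 1 ≤ n) :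
    (∀ g : HermitianMetric n m, g.IsKahler → g.IsToroidal →
      ∀ p : CSpace n m, (∀ i : Fin n, p (Sum.inl i) = 0) →
        IsConeOverTorus (n - 1) (modelCone g p) ∧
        UnstableVarietyModelledOn g (reProd n m) p (modelCone g p) ∧
        ∀ (I : Set ℝ) (γ : ℝ → CSpace n m), g.IsSolutionCurve (reProd n m) I γ →
          AccumulatesBackwardAt I γ p → γ '' I ⊆ unstableVariety g (reProd n m) p) ∧
    (∀ g : HermitianMetric n m, g.IsStandardAt 0 →
        IsConeOverTorus (n - 1) (standardCone n m) ∧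
        UnstableVarietyModelledOn g (reProd n m) 0 (standardCone n m) ∧
        ∀ (I : Set ℝ) (γ : ℝ → CSpace n m), g.IsSolutionCurve (reProd n m) I γ →
          AccumulatesBackwardAt I γ 0 → γ '' I ⊆ unstableVariety g (reProd n m) 0) := by
  refine ⟨fun g _ htor p hp => ?_, fun g hg => HermitianMetric.standard_conclusions hg hn⟩
  exact g.conclusions_of_orthogonal hn hp fun i j hij u hu v hv =>
    htor i j hij p (hp i) (hp j) u hu v hv
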